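/- **Setting.** Fix a dimension $d\ge 1$, a scale $M\ge 1$ and $b>0$ such that $b^{-1}$ is an integer exceeding $2dM$. Let $Y=\{Y_z\}_{z\in\mathbb Z^d}$ be iid random elements of a measurable space. For $x\in b\mathbb Z^d$ let $\mathcal U_x=\mathcal U_x(Y)\ge 0$ be a random variable and $\mathcal Q_x=\mathcal Q_x(\cdot\,;Y)$ a random probability measure on the cube $Mx+[0,Mb]^d$, both measurable functions of $Y$ and translation covariant: for $z_0\in\mathbb Z^d$, $\mathcal U_{x+z_0}(Y)=\mathcal U_x(\{Y_{z+z_0}\}_{z})$, and $\mathcal Q_{x+z_0}(\cdot\,;Y)$ is the translate by $Mz_0$ of $\mathcal Q_x(\cdot\,;\{Y_{z+z_0}\}_{z})$. Put $\mathcal E_x=\mathcal U_x\mathcal Q_x$; the environment is $\mathcal E=\sum_{x\in b\mathbb Z^d}\mathcal E_x$. Fix a bimeasurable bijection $\Gamma:[0,Mb]^d\to[0,1]$, let $\Phi_x$ be the distribution function of the image under $\Gamma$ of $\mathcal Q_x$ translated by $-Mx$, and $\Phi_x^{-1}(v)=\inf\{t\ge 0:\Phi_x(t)\ge v\}$. For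 $\lambda>0$ let $\{V_x\}_{x\in b\mathbb Z^d}$ be iid homogeneous Poisson point processes on $[0,1]\times[0,\infty)$ with intensity $\lambda$, independent of $Y$, and let $$X^{\mathsf s}=\bigcup_{x\in b\mathbb Z^d}\big\{Mx+\Gamma^{-1}(\Phi_x^{-1}(v)) : (v,u)\in V_x,\ u\le\mathcal U_x\big\},$$ which is a Cox point process with intensity $\lambda\mathcal E$. Write $\mathbb P_\lambda$ for the probability with parameter $\lambda$. **Assumptions.** For $z\in\mathbb Z^d$ let $I_b(z)=b\mathbb Z^d\cap(z+[0,1)^d)$, $I_b^+(z)=b\mathbb Z^d\cap(z+[-1,2)^d)$ and $I_b^{++}(z)=b\mathbb Z^d\cap(z+[-2,3)^d)$. Call $x\in b\mathbb Z^d$ non-empty if $\mathcal U_x>0$, and $z\in\mathbb Z^d$ non-empty if some $x\in I_b(z)$ is non-empty. Let $q_0(d)\in[0,1]$ be such that every 6-dependent site percolation model on $\mathbb Z^d$ with marginal probabilities at least $q_0(d)$ percolates almost surely. Assume: 1. (1-dependence) for $x\in I_b(z)$, $\mathcal E_x$ depends on $Y$ only through $\{Y_{w}\}_{w\in z+\{-1,0,1\}^d}$;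 2. (bounded local intensity) there is $\rho>0$ such that almost surely $\mathcal U_x\le\rho$ for all $x\in b\mathbb Z^d$; 3. (coverage) $\mathbb P(o\in\mathbb Z^d\text{ is non-empty})>q_0(d)$; 4. (essential connectedness) there is $\eta>0$ such that, almost surely, for every $z\in\mathbb Z^d$ any two non-empty $x,x'\in I_b^+(z)$ are joined by a chain of sites in which consecutive sites are at $d_\infty$-distance $b$ and all sites strictly between $x$ and $x'$ lie in $I_b^{++}(z)$ and satisfy $\mathcal U\ge\eta$. **Percolation.** For $A,B\subset\mathbb R^d$ write $A\leftrightsquigarrow B$ if there is a path from $A$ to $B$ inside the union of the open Euclidean balls of radius $1/2$ centred at the points of $X^{\mathsf s}$. Let $\Lambda_r=[-r,r]^d$ and $\partial\Lambda_r=\Lambda_{r-M}\setminus\Lambda_{r-2M}$. Put $\theta(\lambda)=\lim_{n\to\infty}\mathbb P_\lambda(\Lambda_{3M}\leftrightsquigarrow\partial\Lambda_n)$ and $\lambda_c=\inf\{\lambda>0:\theta(\lambda)>0\}$. Let $\theta_n(\lambda)=\mathbb P_\lambda(\Lambda_{3M}\leftrightsquigarrow\partial\Lambda_{Mn})$ for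 $n\ge 5$ and $\theta_n(\lambda)=1$ for $n\le 4$. **Proposition 5.1 (Differential inequality).** Let $\lambda'>\lambda_c$. Then there exists $c>0$ such that for every integer $n\ge 1$ and every $\lambda\in(\lambda_c,\lambda')$ the function $\theta_n$ is differentiable at $\lambda$ and $$\frac{\mathrm d}{\mathrm d\lambda}\theta_n(\lambda)\ \ge\ c\,\frac{n}{\sum_{s=1}^n\theta_s(\lambda)}\,\theta_n(\lambda)\,\bigl(1-\theta_n(\lambda)\bigr).$$ -/

import Mathlib

open MeasureTheory ProbabilityTheory Filter
open scoped NNReal ENNReal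

noncomputable section

namespace CoxPercolation

/-- The Euclidean space `ℝ^d`. -/
abbrev Space (d : ℕ) : Type := EuclideanSpace ℝ (Fin d)

/-- The lattice `ℤ^d`. It indexes the coarse sites `z ∈ ℤ^d`, and also the fine sites
`x ∈ b ℤ^d` with `b = 1 / N`: the integer vector `k` stands for `x = b k`. -/
abbrev Lattice (d : ℕ) : Type := Fin d → ℤ

/-! ### Boxes and index sets -/

/-- The box `Λ_r = [-r, r]^d`; it is empty for `r < 0`. -/
def box (d : ℕ) (r : ℝ) : Set (Space d) := {p | ∀ i, |p i| ≤ r}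

/-- The annulus `∂Λ_r = Λ_{r - M} \ Λ_{r - 2M}`. -/
def annulus (d : ℕ) (M r : ℝ) : Set (Space d) := box d (r - M) \ box d (r - 2 * M)

/-- The cube `[0, M b]^d` with `b = 1 / N`. -/
def cell (d N : ℕ) (M : ℝ) : Set (Space d) := {p | ∀ i, 0 ≤ p i ∧ p i ≤ M * (1 / (N : ℝ))}

/-- The point `M x` for the fine site `x = b k`, where `b = 1 / N`. -/
def corner {d : ℕ} (N : ℕ) (M : ℝ) (k : Lattice d) : Space d :=
  WithLp.toLp 2 fun i => M * (1 / (N : ℝ) * (k i : ℝ))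

/-- The point `M z` for the coarse site `z ∈ ℤ^d`. -/
def coarsePoint {d : ℕ} (M : ℝ) (z : Lattice d) : Space d :=
  WithLp.toLp 2 fun i => M * (z i : ℝ)

/-- The fine sites in `z + [-r, r + 1)^d`. So `r = 0, 1, 2` give `I_b(z)`, `I_b⁺(z)` and
`I_b⁺⁺(z)`. -/
def fineSites {d : ℕ} (N : ℕ) (r : ℤ) (z : Lattice d) : Set (Lattice d) :=
  {k | ∀ i, (N : ℤ) * (z i - r) ≤ k i ∧ k i < (N : ℤ) * (z i + r + 1)}

/-- The coarse sites `I⁺(z) = z + {-1, 0, 1}^d`. -/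
def coarseNeighbors {d : ℕ} (z : Lattice d) : Set (Lattice d) := {w | ∀ i, |w i - z i| ≤ 1}

/-- Two fine sites are adjacent if their `d_∞`-distance is `b`. -/
def Adjacent {d : ℕ} (k l : Lattice d) : Prop := k ≠ l ∧ ∀ i, |k i - l i| ≤ 1

/-! ### Environments -/

/-- An environment with a factor of iid representation: the random measure
`∑_x 𝒰_x(Y) 𝒬_x(·; Y)`, where `𝒰_x` is a nonnegative random variable, `𝒬_x` is a random
probability measure on the cube `M x + [0, M b]^d`, and both are measurable translation covariant
functions of the family `Y` with values in `S`. -/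
structure Environment (d N : ℕ) (M : ℝ) (S : Type*) [MeasurableSpace S] where
  U : Lattice d → (Lattice d → S) → ℝ≥0
  measurable_U : ∀ k, Measurable (U k)
  Q : Lattice d → Kernel (Lattice d → S) (Space d)
  isMarkov_Q : ∀ k, IsMarkovKernel (Q k)
  Q_cell : ∀ k y, Q k y {p | p - corner N M k ∈ cell d N M}ᶜ = 0
  U_translate : ∀ k z₀ y, U (k + (N : ℤ) • z₀) y = U k fun z => y (z + z₀)
  Q_translate : ∀ k z₀ y, Q (k + (N : ℤ) • z₀) y =
    (Q k fun z => y (z + z₀)).map fun p => p + coarsePoint M z₀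

namespace Environment

variable {d N : ℕ} {M : ℝ} {S : Type*} [MeasurableSpace S]

/-- The part `ℰ_x(·; Y) = 𝒰_x(Y) 𝒬_x(·; Y)` of the environment. -/
def part (E : Environment d N M S) (k : Lattice d) (y : Lattice d → S) : Measure (Space d) :=
  E.U k y • E.Q k y

/-- The law of the iid family `Y` with one-site law `μ`. -/
def lawY (d : ℕ) (μ : Measure S) : Measure (Lattice d → S) := Measure.infinitePi fun _ => μ

/-- 1-dependence. -/
def OneDependent (E : Environment d N M S) : Prop :=
  ∀ z : Lattice d, ∀ k ∈ fineSites N 0 z, ∀ y y' : Lattice d → S,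
    (∀ w ∈ coarseNeighbors z, y w = y' w) → E.part k y = E.part k y'

/-- Uniformly bounded local intensity. -/
def UniformlyBounded (E : Environment d N M S) (μ : Measure S) [IsProbabilityMeasure μ] : Prop :=
  ∃ ρ : ℝ, 0 < ρ ∧ ∀ᵐ y ∂(lawY d μ), ∀ k : Lattice d, (E.U k y : ℝ) ≤ ρ

end Environment

/-! ### The coverage condition -/

/-- The nearest-neighbour graph on `ℤ^d`. -/
def latticeGraph (d : ℕ) : SimpleGraph (Lattice d) where
  Adj z w := ∑ i, |z i - w i| = 1
  symm := ⟨fun z w h => by simpa only [abs_sub_comm] using h⟩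
  loopless := ⟨fun z h => by simp at h⟩

/-- The open sites (those with value `true`) contain an infinite connected component. -/
def SitePercolates {d : ℕ} (ω : Lattice d → Bool) : Prop :=
  ∃ C : ((latticeGraph d).induce {z | ω z = true}).ConnectedComponent, C.supp.Infinite

/-- A site percolation model is `m`-dependent if its restrictions to any two sets of sites at
`d_∞`-distance greater than `m` are independent (`dist` on `Fin d → ℤ` is the `d_∞`-distance). -/
def SiteDependent {d : ℕ} (m : ℕ) (ν : Measure (Lattice d → Bool)) : Prop :=
  ∀ A B : Set (Lattice d), (∀ a ∈ A, ∀ b ∈ B, (m : ℝ) < dist a b) →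
    IndepFun (fun ω (a : A) => ω a) (fun ω (b : B) => ω b) ν

/-- `q` is an admissible value of the constant `q₀(d) ∈ [0, 1]`: any 6-dependent site percolation
model on `ℤ^d` with marginal probabilities at least `q` percolates. -/
def IsPercolationBound (d : ℕ) (q : ℝ) : Prop :=
  0 ≤ q ∧ q ≤ 1 ∧ ∀ ν : Measure (Lattice d → Bool), IsProbabilityMeasure ν → SiteDependent 6 ν →
    (∀ z, q ≤ ν.real {ω | ω z = true}) → ∀ᵐ ω ∂ν, SitePercolates ω

namespace Environment

variable {d N : ℕ} {M : ℝ} {S : Type*} [MeasurableSpace S]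

/-- Coverage: the origin of `ℤ^d` is non-empty with probability greater than `q₀(d)`. -/
def Coverage (E : Environment d N M S) (μ : Measure S) [IsProbabilityMeasure μ] : Prop :=
  ∃ q : ℝ, IsPercolationBound d q ∧
    q < (lawY d μ).real {y | ∃ k ∈ fineSites N 0 (0 : Lattice d), 0 < E.U k y}

/-- Essential connectedness. The sites strictly inside the chain are required to be `η`-supported;
the two non-empty end points are not. -/
def EssentiallyConnected (E : Environment d N M S) (μ : Measure S) [IsProbabilityMeasure μ] :
    Prop :=
  ∃ η : ℝ, 0 < η ∧ ∀ᵐ y ∂(lawY d μ), ∀ z : Lattice d,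
    ∀ k ∈ fineSites N 1 z, ∀ k' ∈ fineSites N 1 z, 0 < E.U k y → 0 < E.U k' y →
      ∃ (m : ℕ) (γ : ℕ → Lattice d), γ 0 = k ∧ γ m = k' ∧
        (∀ i < m, Adjacent (γ i) (γ (i + 1))) ∧
        ∀ i, 0 < i → i < m → γ i ∈ fineSites N 2 z ∧ η ≤ (E.U (γ i) y : ℝ)

end Environment

/-! ### Poisson point processes on `[0, 1] × [0, ∞)` -/

/-- A realization of a point process on `[0, 1] × [0, ∞)`: for each `j`, a number `n` and a
sequence `p` in the unit square, whose first `n` entries, moved up by `j`, are the points in the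
strip `[0, 1] × [j, j + 1]`. -/
abbrev PointConfig : Type := ℕ → ℕ × (ℕ → unitInterval × unitInterval)

/-- The points `(v, u)` of a realization. -/
def PointConfig.points (c : PointConfig) : Set (unitInterval × ℝ) :=
  {q | ∃ j i : ℕ, i < (c j).1 ∧
    q = (((c j).2 i).1, (j : ℝ) + ((((c j).2 i).2 : unitInterval) : ℝ))}

/-- The law of a homogeneous Poisson point process on `[0, 1] × [0, ∞)` with intensity `lam`:
independently for each of the unit-area strips `[0, 1] × [j, j + 1]`, a Poisson number of points
with mean `lam`, placed independently and uniformly in the strip. -/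
def poissonProcessLaw (lam : ℝ) : Measure PointConfig :=
  Measure.infinitePi fun _ : ℕ =>
    (poissonMeasure lam.toNNReal).prod
      (Measure.infinitePi fun _ : ℕ => (volume : Measure (unitInterval × unitInterval)))

/-! ### The Cox process -/

namespace Environment

variable {d N : ℕ} {M : ℝ} {S : Type*} [MeasurableSpace S]

/-- The distribution function `Φ_x(t; Y)` of the image of `𝒬_x(·; Y)`, moved to `[0, M b]^d`,
under the bijection `Γ`. -/
def cdf (E : Environment d N M S) (Γ : cell d N M ≃ᵐ unitInterval) (k : Lattice d)
    (y : Lattice d → S) (t : ℝ) : ℝ :=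
  (E.Q k y).real {p | ∃ h : p - corner N M k ∈ cell d N M, (Γ ⟨p - corner N M k, h⟩ : ℝ) ≤ t}

/-- The inverse distribution function `Φ_x⁻¹(v) = inf {t ≥ 0 : Φ_x(t) ≥ v}`. -/
def quantile (E : Environment d N M S) (Γ : cell d N M ≃ᵐ unitInterval) (k : Lattice d)
    (y : Lattice d → S) (v : ℝ) : ℝ :=
  sInf {t : ℝ | 0 ≤ t ∧ v ≤ E.cdf Γ k y t}

theorem quantile_mem (E : Environment d N M S) (Γ : cell d N M ≃ᵐ unitInterval) (k : Lattice d)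
    (y : Lattice d → S) (v : unitInterval) : E.quantile Γ k y v ∈ unitInterval := by
  have hcdf : E.cdf Γ k y 1 = 1 := by
    have := E.isMarkov_Q k
    have hset : {p | ∃ h : p - corner N M k ∈ cell d N M, (Γ ⟨p - corner N M k, h⟩ : ℝ) ≤ 1}
        = {p | p - corner N M k ∈ cell d N M} := by
      ext p
      exact ⟨fun ⟨h, _⟩ => h, fun h => ⟨h, (Γ _).2.2⟩⟩
    have hfull : (E.Q k y) {p | p - corner N M k ∈ cell d N M} = 1 :=
      by
      rw [measure_of_measure_compl_eq_zero (E.Q_cell k y), measure_univ]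
    rw [cdf, hset, Measure.real, hfull]
    simp
  refine ⟨le_csInf ⟨1, zero_le_one, by rw [hcdf]; exact v.2.2⟩ fun t ht => ht.1,
    csInf_le ⟨0, fun t ht => ht.1⟩ ⟨zero_le_one, by rw [hcdf]; exact v.2.2⟩⟩

/-- The points `Ψ_x(V_x; Y) = {M x + Γ⁻¹(Φ_x⁻¹(v; Y)) : (v, u) ∈ V_x, u ≤ 𝒰_x(Y)}`. -/
def cellPoints (E : Environment d N M S) (Γ : cell d N M ≃ᵐ unitInterval) (k : Lattice d)
    (c : PointConfig) (y : Lattice d → S) : Set (Space d) :=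
  {p | ∃ q ∈ c.points, q.2 ≤ (E.U k y : ℝ) ∧
    p = corner N M k + (Γ.symm ⟨E.quantile Γ k y q.1, E.quantile_mem Γ k y q.1⟩ : Space d)}

/-- The Cox process `X^s = ⋃_x Ψ_x(V_x; Y)`. -/
def coxPoints (E : Environment d N M S) (Γ : cell d N M ≃ᵐ unitInterval)
    (ω : (Lattice d → PointConfig) × (Lattice d → S)) : Set (Space d) :=
  ⋃ k : Lattice d, E.cellPoints Γ k (ω.1 k) ω.2

end Environment

/-- The joint law of `(V, Y)`: the `V_x` are iid Poisson point processes with intensity `lam`, the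
`Y_z` are iid with law `μ`, and the two families are independent. -/
def jointLaw {S : Type*} [MeasurableSpace S] (d : ℕ) (μ : Measure S) (lam : ℝ) :
    Measure ((Lattice d → PointConfig) × (Lattice d → S)) :=
  (Measure.infinitePi fun _ : Lattice d => poissonProcessLaw lam).prod (Environment.lawY d μ)

/-! ### Percolation -/

/-- `A` and `B` are connected by a path in the union of the balls of radius `1/2` centred at `X`. -/
def Connects {d : ℕ} (X A B : Set (Space d)) : Prop :=
  ∃ a ∈ A, ∃ b ∈ B, JoinedIn (⋃ x ∈ X, Metric.ball x (1 / 2)) a b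

namespace Environment

variable {d N : ℕ} {M : ℝ} {S : Type*} [MeasurableSpace S]

/-- The probability that `Λ_{3M}` and `∂Λ_r` are connected in the Cox percolation model with
parameter `lam`. -/
def connProb (E : Environment d N M S) (Γ : cell d N M ≃ᵐ unitInterval) (μ : Measure S)
    (r lam : ℝ) : ℝ :=
  (jointLaw d μ lam).real {ω | Connects (E.coxPoints Γ ω) (box d (3 * M)) (annulus d M r)}

/-- The percolation probability `θ(lam)`. -/
def theta (E : Environment d N M S) (Γ : cell d N M ≃ᵐ unitInterval) (μ : Measure S)
    (lam : ℝ) : ℝ :=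
  limUnder atTop fun n : ℕ => E.connProb Γ μ n lam

/-- The critical intensity `inf {lam > 0 : θ(lam) > 0}`, which is `⊤` if there is no such `lam`. -/
def criticalIntensity (E : Environment d N M S) (Γ : cell d N M ≃ᵐ unitInterval)
    (μ : Measure S) : EReal :=
  sInf ((fun lam : ℝ => (lam : EReal)) '' {lam : ℝ | 0 < lam ∧ 0 < E.theta Γ μ lam})

/-- `θ_n(lam)`: the probability that `Λ_{3M}` and `∂Λ_{Mn}` are connected if `n ≥ 5`, and `1` if
`n ≤ 4`. -/
def thetaN (E : Environment d N M S) (Γ : cell d N M ≃ᵐ unitInterval) (μ : Measure S) (n : ℕ)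
    (lam : ℝ) : ℝ :=
  if n ≤ 4 then 1 else E.connProb Γ μ (M * n) lam

end Environment

end CoxPercolation

end

noncomputable section

set_option linter.unusedSectionVars false

namespace CoxPercolation

/-! ### Products of measures -/

section Product

variable {α β γ δ : Type*} [MeasurableSpace α] [MeasurableSpace β] [MeasurableSpace γ]
  [MeasurableSpace δ]

/-! The proof runs the OSSS inequality over independent coordinates of two kinds: the unit strips of
the Poisson processes `V_x`, and the variables `Y_z`. For `n ≥ 5`, bounded local intensity makes the
crossing event `A` almost surely equal to an event in a finite window of coordinates
(`connProb_eq_crossing`). OSSS (`Strategy.osss`, `osss_exploration`) bounds `P(A)(1 - P(A))` by the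
sum over coordinates of revealment times influence, for any exploration that decides `A`.

Revealment. For each `s` in `[1, n]` the clusters of `∂Λ_{Ms}` are explored. A crossing must pass
through this annulus when `5 ≤ s ≤ n`, so once no eligible coordinate is left every crossing is
visible (`connects_visible_of_closed`). A coordinate at the coarse site `z` is revealed only if a
box around `Mz` meets `∂Λ_{Ms}` or is connected to it, which by translation invariance has
probability at most `θ_k` with `k = |s - |z||` (`jointLaw_reachEvent_le`). Summed over `s` this
gives at most a constant times `∑ θ_s` (`sum_antitone_dist_le`), uniformly in `z`.

Influence. Resampling one coordinate alters the points of boundedly many strips only, by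
1-dependence. Since `A` is increasing, if it survives the removal of all points in these strips then
it survives the resampling (`mix_mem_crossing`). So an influence is at most twice the probability
that emptying these strips destroys `A`. This holds for `Y_z` as well as for a strip, so a resampled
environment is controlled by Poisson points alone.

Derivative. Russo's formula for Poisson counts writes the derivative of `P(A)` as the sum over
strips of the expected effect of adding one point (`hasDerivAt_jointLaw_real`). Emptying strips is
compared with adding a point by two elementary Poisson estimates: the tail beyond `j` is at most
`e^λ` times the weight of `j`, and an empty strip has probability `e^{-λ}`
(`measure_emptyStrips_le`). Hence the sum of the influences is at most a constant times the
derivative (`sum_influence_le`); the constant increases with `λ`, so its value at `λ'` serves all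
smaller intensities. -/

theorem measurePreserving_prodLeftComm (μ : Measure α) (ν : Measure β) (ξ : Measure γ)
    [SFinite μ] [SFinite ν] [SFinite ξ] :
    MeasurePreserving (fun p : α × β × γ => (p.2.1, (p.1, p.2.2)))
      (μ.prod (ν.prod ξ)) (ν.prod (μ.prod ξ)) :=
  ((measurePreserving_prodAssoc ν μ ξ).comp
    (Measure.measurePreserving_swap.prod (MeasurePreserving.id ξ))).comp
    (measurePreserving_prodAssoc μ ν ξ).symm

theorem measurePreserving_prodProdProdComm (μ : Measure α) (ν : Measure β) (ξ : Measure γ)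
    (ζ : Measure δ) [SFinite μ] [SFinite ν] [SFinite ξ] [SFinite ζ] :
    MeasurePreserving (fun p : (α × β) × (γ × δ) => ((p.1.1, p.2.1), (p.1.2, p.2.2)))
      ((μ.prod ν).prod (ξ.prod ζ)) ((μ.prod ξ).prod (ν.prod ζ)) :=
  ((measurePreserving_prodAssoc μ ξ (ν.prod ζ)).symm.comp
    ((MeasurePreserving.id μ).prod (measurePreserving_prodLeftComm ν ξ ζ))).comp
    (measurePreserving_prodAssoc μ ν (ξ.prod ζ))

end Product

/-! ### Infinite product measures: pairing coordinates and resampling one of them. -/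

section InfiniteProduct

variable {ι α β : Type*} [MeasurableSpace α] [MeasurableSpace β]

/-- The whole space is a square cylinder. -/
def spanningSquareCylinders (ξ : Measure (ι → α)) [IsProbabilityMeasure ξ] :
    ξ.FiniteSpanningSetsIn (squareCylinders fun _ : ι => {s : Set α | MeasurableSet s}) where
  set _ := Set.univ
  set_mem _ := ⟨∅, fun _ => Set.univ, by simp, by simp⟩
  finite _ := measure_lt_top _ _
  spanning := Set.iUnion_const _

/-- Square cylinders generate both factors and form a π-system, so it suffices to compare the two
laws on products of two cylinders. -/
theorem measurePreserving_infinitePi_unzip (μ : Measure α) (ν : Measure β)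
    [IsProbabilityMeasure μ] [IsProbabilityMeasure ν] :
    MeasurePreserving (fun h : ι → α × β => ((fun i => (h i).1), fun i => (h i).2))
      (Measure.infinitePi fun _ => μ.prod ν)
      ((Measure.infinitePi fun _ => μ).prod (Measure.infinitePi fun _ => ν)) := by
  classical
  have hmeas : Measurable fun h : ι → α × β => ((fun i => (h i).1), fun i => (h i).2) := by
    fun_prop
  refine ⟨hmeas, ?_⟩
  symm
  refine Measure.prod_eq_generateFrom generateFrom_squareCylinders generateFrom_squareCylinders
    (isPiSystem_squareCylinders (fun _ => MeasurableSpace.isPiSystem_measurableSet) (by simp))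
    (isPiSystem_squareCylinders (fun _ => MeasurableSpace.isPiSystem_measurableSet) (by simp))
    (spanningSquareCylinders _) (spanningSquareCylinders _) ?_
  rintro _ ⟨s, t, ht, rfl⟩ _ ⟨s', t', ht', rfl⟩
  simp only [Set.mem_pi, Set.mem_univ, true_implies, Set.mem_ofPred_eq] at ht ht'
  rw [Measure.map_apply hmeas ((MeasurableSet.pi s.countable_toSet fun i _ => ht i).prod
    (MeasurableSet.pi s'.countable_toSet fun i _ => ht' i))]
  -- Padding with the whole space puts both cylinders over the common index set `s ∪ s'`, where the
  -- preimage is again a cylinder.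
  let u : ι → Set α := fun i => if i ∈ s then t i else Set.univ
  let u' : ι → Set β := fun i => if i ∈ s' then t' i else Set.univ
  have hu : ∀ i, MeasurableSet (u i) := fun i => by
    by_cases h : i ∈ s <;> simp [u, h, ht]
  have hu' : ∀ i, MeasurableSet (u' i) := fun i => by
    by_cases h : i ∈ s' <;> simp [u', h, ht']
  have e1 : (s : Set ι).pi t = ((s ∪ s' : Finset ι) : Set ι).pi u := by
    ext x
    simp only [Set.mem_pi, SetLike.mem_coe, Finset.mem_union, u]
    exact ⟨fun h i _ => by by_cases hi : i ∈ s <;> simp [hi, h],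
      fun h i hi => by simpa [hi] using h i (Or.inl hi)⟩
  have e2 : (s' : Set ι).pi t' = ((s ∪ s' : Finset ι) : Set ι).pi u' := by
    ext x
    simp only [Set.mem_pi, SetLike.mem_coe, Finset.mem_union, u']
    exact ⟨fun h i _ => by by_cases hi : i ∈ s' <;> simp [hi, h],
      fun h i hi => by simpa [hi] using h i (Or.inr hi)⟩
  have e3 : (fun h : ι → α × β => ((fun i => (h i).1), fun i => (h i).2)) ⁻¹'
      (((s ∪ s' : Finset ι) : Set ι).pi u ×ˢ ((s ∪ s' : Finset ι) : Set ι).pi u') =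
      ((s ∪ s' : Finset ι) : Set ι).pi fun i => u i ×ˢ u' i := by
    ext x
    simp only [Set.mem_preimage, Set.mem_prod, Set.mem_pi]
    exact ⟨fun h i hi => ⟨h.1 i hi, h.2 i hi⟩, fun h => ⟨fun i hi => (h i hi).1,
      fun i hi => (h i hi).2⟩⟩
  rw [e1, e2, e3, Measure.infinitePi_pi _ fun i _ => (hu i).prod (hu' i),
    Measure.infinitePi_pi _ fun i _ => hu i, Measure.infinitePi_pi _ fun i _ => hu' i,
    ← Finset.prod_mul_distrib]
  simp [Measure.prod_prod]

theorem measurePreserving_infinitePi_zip (μ : Measure α) (ν : Measure β)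
    [IsProbabilityMeasure μ] [IsProbabilityMeasure ν] :
    MeasurePreserving (fun (p : (ι → α) × (ι → β)) (i : ι) => (p.1 i, p.2 i))
      ((Measure.infinitePi fun _ => μ).prod (Measure.infinitePi fun _ => ν))
      (Measure.infinitePi fun _ => μ.prod ν) := by
  have hmeas : Measurable fun (p : (ι → α) × (ι → β)) (i : ι) => (p.1 i, p.2 i) := by fun_prop
  refine ⟨hmeas, ?_⟩
  rw [← (measurePreserving_infinitePi_unzip μ ν).map_eq,
    Measure.map_map hmeas (measurePreserving_infinitePi_unzip μ ν).measurable]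
  exact Measure.map_id

/-- A map that acts on each pair of coordinates of two independent copies of a product measure by
a measure preserving map is measure preserving. -/
theorem measurePreserving_infinitePi_prod_map (μ : Measure α) [IsProbabilityMeasure μ]
    {T : ι → α × α → α × α} (hT : ∀ i, MeasurePreserving (T i) (μ.prod μ) (μ.prod μ)) :
    MeasurePreserving (fun p : (ι → α) × (ι → α) =>
        ((fun i => (T i (p.1 i, p.2 i)).1), fun i => (T i (p.1 i, p.2 i)).2))
      ((Measure.infinitePi fun _ => μ).prod (Measure.infinitePi fun _ => μ))
      ((Measure.infinitePi fun _ => μ).prod (Measure.infinitePi fun _ => μ)) := by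
  have hmid : MeasurePreserving (fun (h : ι → α × α) i => T i (h i))
      (Measure.infinitePi fun _ => μ.prod μ) (Measure.infinitePi fun _ => μ.prod μ) := by
    refine ⟨measurable_pi_lambda _ fun i => (hT i).measurable.comp (measurable_pi_apply i), ?_⟩
    rw [Measure.infinitePi_map_pi _ fun i => (hT i).measurable]
    simp only [(hT _).map_eq]
  exact ((measurePreserving_infinitePi_unzip μ μ).comp hmid).comp
    (measurePreserving_infinitePi_zip μ μ)

/-- Replacing one coordinate of a product measure by an independent copy. -/
theorem measurePreserving_infinitePi_update [DecidableEq ι] (μ : Measure α)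
    [IsProbabilityMeasure μ] (i : ι) :
    MeasurePreserving (fun p : (ι → α) × α => Function.update p.1 i p.2)
      ((Measure.infinitePi fun _ => μ).prod μ) (Measure.infinitePi fun _ => μ) := by
  have hmeas : Measurable fun p : (ι → α) × α => Function.update p.1 i p.2 := by
    refine measurable_pi_lambda _ fun j => ?_
    by_cases h : j = i
    · subst h; simpa using measurable_snd
    · simp only [Function.update_of_ne h]
      fun_prop
  refine ⟨hmeas, Measure.eq_infinitePi _ fun s t ht => ?_⟩
  rw [Measure.map_apply hmeas (MeasurableSet.pi s.countable_toSet fun i _ => ht i)]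
  by_cases hi : i ∈ s
  · have : (fun p : (ι → α) × α => Function.update p.1 i p.2) ⁻¹' (s : Set ι).pi t =
        ((s.erase i : Finset ι) : Set ι).pi t ×ˢ t i := by
      ext p
      simp only [Set.mem_preimage, Set.mem_pi, SetLike.mem_coe, Set.mem_prod, Finset.mem_erase]
      constructor
      · exact fun h => ⟨fun j hj => by simpa [hj.1] using h j hj.2, by simpa using h i hi⟩
      · rintro ⟨h, h'⟩ j hj
        by_cases hji : j = i
        · subst hji; simpa using h'
        · simpa [hji] using h j ⟨hji, hj⟩
    rw [this, Measure.prod_prod, Measure.infinitePi_pi _ fun i _ => ht i,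
      Finset.prod_erase_mul _ _ hi]
  · have : (fun p : (ι → α) × α => Function.update p.1 i p.2) ⁻¹' (s : Set ι).pi t =
        (s : Set ι).pi t ×ˢ Set.univ := by
      ext p
      simp only [Set.mem_preimage, Set.mem_pi, SetLike.mem_coe, Set.mem_prod, Set.mem_univ,
        and_true]
      refine forall₂_congr fun j hj => ?_
      rw [Function.update_of_ne (by rintro rfl; exact hi hj)]
    rw [this, Measure.prod_prod, Measure.infinitePi_pi _ fun i _ => ht i, measure_univ, mul_one]

end InfiniteProduct

/-! ### The OSSS inequality -/

/-- A probability space with coordinates indexed by `ι` that can be resampled independently: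
`mix R ω ω'` has the coordinates of `ω'` on `R` and those of `ω` off `R`. -/
structure Resampling (ι : Type*) {Ω : Type*} [MeasurableSpace Ω] (P : Measure Ω) where
  agree : ι → Ω → Ω → Prop
  equiv : ∀ i, Equivalence (agree i)
  ext : ∀ ω ω', (∀ i, agree i ω ω') → ω = ω'
  mix : Finset ι → Ω → Ω → Ω
  mix_mem : ∀ {R i} ω ω', i ∈ R → agree i (mix R ω ω') ω'
  mix_notMem : ∀ {R i} ω ω', i ∉ R → agree i (mix R ω ω') ω
  preserving : ∀ R, MeasurePreserving (fun p : Ω × Ω => (mix R p.1 p.2, mix R p.2 p.1))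
    (P.prod P) (P.prod P)

namespace Resampling

variable {ι Ω : Type*} [MeasurableSpace Ω] {P : Measure Ω} (𝓡 : Resampling ι P)

/-- The set `B` is determined by the coordinates in `R`. -/
def Determines (R : Finset ι) (B : Set Ω) : Prop :=
  ∀ ω ω', (∀ i ∈ R, 𝓡.agree i ω ω') → ω ∈ B → ω' ∈ B

variable {𝓡}

theorem Determines.iff {R : Finset ι} {B : Set Ω} (h : 𝓡.Determines R B) {ω ω' : Ω}
    (hω : ∀ i ∈ R, 𝓡.agree i ω ω') : ω ∈ B ↔ ω' ∈ B :=
  ⟨h ω ω' hω, h ω' ω fun i hi => (𝓡.equiv i).symm (hω i hi)⟩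

variable (𝓡)

theorem measurable_mix (R : Finset ι) : Measurable fun p : Ω × Ω => 𝓡.mix R p.1 p.2 :=
  (𝓡.preserving R).measurable.fst

theorem mix_empty (ω ω' : Ω) : 𝓡.mix ∅ ω ω' = ω :=
  𝓡.ext _ _ fun _ => 𝓡.mix_notMem _ _ (by simp)

/-- Exchanging the coordinates in `R` between the two copies turns one more revealed coordinate into
a plain resampling of `i`. This puts each step of the OSSS interpolation into the form of an
influence. -/
theorem mix_insert [DecidableEq ι] {R : Finset ι} {i : ι} (hi : i ∉ R) (ω ω' : Ω) :
    𝓡.mix (insert i R) ω ω' = 𝓡.mix {i} (𝓡.mix R ω ω') (𝓡.mix R ω' ω) := by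
  refine 𝓡.ext _ _ fun j => ?_
  have hE := 𝓡.equiv j
  by_cases hj : j = i
  · subst hj
    exact hE.trans (𝓡.mix_mem _ _ (by simp)) (hE.symm
      (hE.trans (𝓡.mix_mem _ _ (by simp)) (𝓡.mix_notMem _ _ hi)))
  · by_cases hR : j ∈ R
    · exact hE.trans (𝓡.mix_mem _ _ (by simp [hR])) (hE.symm
        (hE.trans (𝓡.mix_notMem _ _ (by simp [hj])) (𝓡.mix_mem _ _ hR)))
    · exact hE.trans (𝓡.mix_notMem _ _ (by simp [hR, hj])) (hE.symm
        (hE.trans (𝓡.mix_notMem _ _ (by simp [hj])) (𝓡.mix_notMem _ _ hR)))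

theorem mix_mix_right (R : Finset ι) (ω ω' ω'' : Ω) :
    𝓡.mix R ω (𝓡.mix R ω' ω'') = 𝓡.mix R ω ω'' := by
  refine 𝓡.ext _ _ fun j => ?_
  have hE := 𝓡.equiv j
  by_cases hR : j ∈ R
  · exact hE.trans (𝓡.mix_mem _ _ hR) (hE.trans (𝓡.mix_mem _ _ hR) (hE.symm (𝓡.mix_mem _ _ hR)))
  · exact hE.trans (𝓡.mix_notMem _ _ hR) (hE.symm (𝓡.mix_notMem _ _ hR))

/-- The event that resampling the coordinate `i` changes the occurrence of `A`. -/
def flipSet (A : Set Ω) (i : ι) : Set (Ω × Ω) :=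
  {p | ¬(p.1 ∈ A ↔ 𝓡.mix {i} p.1 p.2 ∈ A)}

/-- The probability that resampling the coordinate `i` changes the occurrence of `A`. -/
def influence (A : Set Ω) (i : ι) : ℝ≥0∞ := (P.prod P) (𝓡.flipSet A i)

theorem measurableSet_flipSet {A : Set Ω} (hA : MeasurableSet A) (i : ι) :
    MeasurableSet (𝓡.flipSet A i) :=
  (MeasurableSet.iff (measurable_fst hA) (𝓡.measurable_mix {i} hA)).compl

/-- After the coordinates in `R` are exchanged, `B` looks at the second copy on `R` only, whereas
the flip looks at the first copy and at coordinate `i` of the second. As `i ∉ R`, the two are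
independent. -/
theorem measure_inter_flip_of_determines [IsProbabilityMeasure P] [DecidableEq ι] {A B : Set Ω}
    (hA : MeasurableSet A) (hB : MeasurableSet B) {R : Finset ι} {i : ι} (hi : i ∉ R)
    (hBR : 𝓡.Determines R B) :
    (P.prod P) {p | p.1 ∈ B ∧ ¬(𝓡.mix R p.1 p.2 ∈ A ↔ 𝓡.mix (insert i R) p.1 p.2 ∈ A)} =
      P B * 𝓡.influence A i := by
  have hflip := 𝓡.measurableSet_flipSet hA i
  have h1 : {p : Ω × Ω | p.1 ∈ B ∧
      ¬(𝓡.mix R p.1 p.2 ∈ A ↔ 𝓡.mix (insert i R) p.1 p.2 ∈ A)} =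
      (fun p : Ω × Ω => (𝓡.mix R p.1 p.2, 𝓡.mix R p.2 p.1)) ⁻¹'
        {q | q.2 ∈ B ∧ q ∈ 𝓡.flipSet A i} := by
    ext p
    have : p.1 ∈ B ↔ 𝓡.mix R p.2 p.1 ∈ B :=
      hBR.iff fun j hj => (𝓡.equiv j).symm (𝓡.mix_mem _ _ hj)
    simp [flipSet, 𝓡.mix_insert hi, this]
  have hm : MeasurableSet {q : Ω × Ω | q.2 ∈ B ∧ q ∈ 𝓡.flipSet A i} :=
    (measurable_snd hB).inter hflip
  rw [h1, (𝓡.preserving R).measure_preimage hm.nullMeasurableSet]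
  have hnot : ∀ ω ω', 𝓡.mix {i} ω ω' ∈ B ↔ ω ∈ B := fun ω ω' =>
    hBR.iff fun j hj => 𝓡.mix_notMem _ _ (by rintro h; simp at h; exact hi (h ▸ hj))
  have hfst : MeasurePreserving (fun p : Ω × Ω => 𝓡.mix {i} p.1 p.2) (P.prod P) P :=
    measurePreserving_fst.comp (𝓡.preserving {i})
  -- The second copy is assembled from two independent ones, the last of which supplies coordinate
  -- `i` alone. Then `B` sees one of them, the flip sees the other, and the probability factors.
  have h3 : MeasurePreserving (fun p : Ω × Ω × Ω => (p.1, 𝓡.mix {i} p.2.1 p.2.2))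
      (P.prod (P.prod P)) (P.prod P) := (MeasurePreserving.id P).prod hfst
  rw [← h3.measure_preimage hm.nullMeasurableSet]
  have h4 : (fun p : Ω × Ω × Ω => (p.1, 𝓡.mix {i} p.2.1 p.2.2)) ⁻¹'
      {q : Ω × Ω | q.2 ∈ B ∧ q ∈ 𝓡.flipSet A i} =
      (fun p : Ω × Ω × Ω => (p.2.1, (p.1, p.2.2))) ⁻¹' (B ×ˢ 𝓡.flipSet A i) := by
    ext p
    simp [flipSet, hnot, 𝓡.mix_mix_right]
  rw [h4, (measurePreserving_prodLeftComm P P P).measure_preimage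
    (hB.prod hflip).nullMeasurableSet, Measure.prod_prod]
  rfl

/-- Once all coordinates that determine `B` are replaced by fresh ones, the resulting sample is
independent of `B`. -/
theorem measure_inter_mix_of_determines [IsProbabilityMeasure P] {A B : Set Ω}
    (hA : MeasurableSet A) (hB : MeasurableSet B) {R : Finset ι} (hBR : 𝓡.Determines R B) :
    (P.prod P) {p | p.1 ∈ B ∧ 𝓡.mix R p.1 p.2 ∉ A} = P B * P Aᶜ := by
  have h1 : {p : Ω × Ω | p.1 ∈ B ∧ 𝓡.mix R p.1 p.2 ∉ A} =
      (fun p : Ω × Ω => (𝓡.mix R p.1 p.2, 𝓡.mix R p.2 p.1)) ⁻¹' (Aᶜ ×ˢ B) := by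
    ext p
    have : p.1 ∈ B ↔ 𝓡.mix R p.2 p.1 ∈ B :=
      hBR.iff fun j hj => (𝓡.equiv j).symm (𝓡.mix_mem _ _ hj)
    simp [this, and_comm]
  rw [h1, (𝓡.preserving R).measure_preimage (hA.compl.prod hB).nullMeasurableSet,
    Measure.prod_prod, mul_comm]

/-- The influence of a coordinate is at most twice the probability that `A` occurs and is
destroyed by the resampling. -/
theorem influence_le_two_mul {A : Set Ω} (hA : MeasurableSet A) (i : ι) :
    𝓡.influence A i ≤ 2 * (P.prod P) {p | p.1 ∈ A ∧ 𝓡.mix {i} p.1 p.2 ∉ A} := by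
  have hm : MeasurableSet {p : Ω × Ω | p.1 ∈ A ∧ 𝓡.mix {i} p.1 p.2 ∉ A} :=
    (measurable_fst hA).inter (𝓡.measurable_mix {i} hA).compl
  have hback : ∀ p : Ω × Ω, 𝓡.mix {i} (𝓡.mix {i} p.1 p.2) (𝓡.mix {i} p.2 p.1) = p.1 := by
    intro p
    refine 𝓡.ext _ _ fun j => ?_
    have hE := 𝓡.equiv j
    by_cases hR : j ∈ ({i} : Finset ι)
    · exact hE.trans (𝓡.mix_mem _ _ hR) (𝓡.mix_mem _ _ hR)
    · exact hE.trans (𝓡.mix_notMem _ _ hR) (𝓡.mix_notMem _ _ hR)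
  have h := (𝓡.preserving {i}).measure_preimage hm.nullMeasurableSet
  have hsub : 𝓡.flipSet A i ⊆ {p | p.1 ∈ A ∧ 𝓡.mix {i} p.1 p.2 ∉ A} ∪
      (fun p : Ω × Ω => (𝓡.mix {i} p.1 p.2, 𝓡.mix {i} p.2 p.1)) ⁻¹'
        {p | p.1 ∈ A ∧ 𝓡.mix {i} p.1 p.2 ∉ A} := by
    intro p hp
    simp only [flipSet, Set.mem_ofPred_eq, Set.mem_union, Set.mem_preimage, hback] at hp ⊢
    tauto
  calc 𝓡.influence A i ≤ _ := measure_mono hsub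
    _ ≤ _ := measure_union_le _ _
    _ = _ := by rw [h, two_mul]

theorem influence_le_two_mul_of_forall [IsProbabilityMeasure P] {A B : Set Ω}
    (hA : MeasurableSet A) (hB : MeasurableSet B) (i : ι)
    (h : ∀ ω ω', ω ∈ A → 𝓡.mix {i} ω ω' ∉ A → ω ∈ B) : 𝓡.influence A i ≤ 2 * P B := by
  refine (𝓡.influence_le_two_mul hA i).trans (mul_le_mul_right ?_ _)
  rw [← (measurePreserving_fst (μ := P) (ν := P)).measure_preimage hB.nullMeasurableSet]
  exact measure_mono fun p hp => h p.1 p.2 hp.1 hp.2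

end Resampling

/-- A rule that chooses the next coordinate to be revealed from the set of coordinates revealed
before and their values. -/
structure Strategy {ι Ω : Type*} [MeasurableSpace Ω] {P : Measure Ω} (𝓡 : Resampling ι P)
    (F : Finset ι) where
  next : Finset ι → Ω → Option ι
  measurableSet_next : ∀ R i, MeasurableSet {ω | next R ω = i}
  determines_next : ∀ R i, 𝓡.Determines R {ω | next R ω = i}
  next_notMem : ∀ {R ω i}, next R ω = some i → i ∉ R
  next_mem : ∀ {R ω i}, next R ω = some i → i ∈ F

/-! ### Running a strategy, and the OSSS bound -/

namespace Strategy

variable {ι Ω : Type*} [MeasurableSpace Ω] {P : Measure Ω} {𝓡 : Resampling ι P} {F : Finset ι}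
  [DecidableEq ι] (σ : Strategy 𝓡 F)

/-- The set of coordinates revealed in the first `t` steps. -/
def revealed : ℕ → Ω → Finset ι
  | 0, _ => ∅
  | t + 1, ω => (σ.next (revealed t ω) ω).elim (revealed t ω) fun i => insert i (revealed t ω)

theorem revealed_subset (t : ℕ) (ω : Ω) : σ.revealed t ω ⊆ F := by
  induction t with
  | zero => simp [revealed]
  | succ t ih =>
    rw [revealed]
    cases h : σ.next (σ.revealed t ω) ω with
    | none => simpa using ih
    | some i => simpa [Finset.insert_subset_iff, ih] using σ.next_mem h

/-- Every choice depends on values already revealed, so agreement on the coordinates revealed at `ω`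
forces the same run at `ω'`. -/
theorem revealed_eq_of_agree {t : ℕ} {ω ω' : Ω}
    (h : ∀ i ∈ σ.revealed t ω, 𝓡.agree i ω ω') : σ.revealed t ω' = σ.revealed t ω := by
  induction t with
  | zero => rfl
  | succ t ih =>
    rw [revealed] at h
    have hsub : ∀ i ∈ σ.revealed t ω, 𝓡.agree i ω ω' := by
      intro i hi
      apply h
      cases σ.next (σ.revealed t ω) ω <;> simp [hi]
    have h1 := ih hsub
    have h2 : σ.next (σ.revealed t ω) ω' = σ.next (σ.revealed t ω) ω :=
      σ.determines_next _ _ ω ω' hsub rfl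
    rw [revealed, revealed, h1, h2]

theorem determines_revealed (t : ℕ) (R : Finset ι) :
    𝓡.Determines R {ω | σ.revealed t ω = R} := by
  intro ω ω' h hω
  simp only [Set.mem_ofPred_eq] at hω ⊢
  subst hω
  exact σ.revealed_eq_of_agree h

theorem measurableSet_revealed (t : ℕ) (R : Finset ι) :
    MeasurableSet {ω | σ.revealed t ω = R} := by
  induction t generalizing R with
  | zero => simp [revealed]
  | succ t ih =>
    have : {ω | σ.revealed (t + 1) ω = R} =
        ⋃ R' ∈ F.powerset, {ω | σ.revealed t ω = R'} ∩
          (({ω | σ.next R' ω = none} ∩ {_ω | R' = R}) ∪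
            ⋃ i ∈ F, {ω | σ.next R' ω = some i} ∩ {_ω | insert i R' = R}) := by
      ext ω
      simp only [Set.mem_ofPred_eq, Set.mem_iUnion, Set.mem_inter_iff, Set.mem_union,
        Finset.mem_powerset, exists_prop]
      constructor
      · intro h
        refine ⟨_, σ.revealed_subset t ω, rfl, ?_⟩
        rw [revealed] at h
        cases hn : σ.next (σ.revealed t ω) ω with
        | none => left; simpa [hn] using h
        | some i => right; exact ⟨i, σ.next_mem hn, rfl, by simpa [hn] using h⟩
      · rintro ⟨R', -, rfl, h | ⟨i, -, h, h'⟩⟩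
        · simpa [revealed, h.1] using h.2
        · simpa [revealed, h] using h'
    rw [this]
    refine Finset.measurableSet_biUnion _ fun R' _ => (ih R').inter ?_
    refine ((σ.measurableSet_next R' none).inter (MeasurableSet.const _)).union ?_
    exact Finset.measurableSet_biUnion _ fun i _ =>
      (σ.measurableSet_next R' (some i)).inter (MeasurableSet.const _)

/-- The event that the coordinate `i` is revealed in step `t` with `R` revealed before. -/
def revealStep (t : ℕ) (i : ι) (R : Finset ι) : Set Ω :=
  {ω | σ.revealed t ω = R ∧ σ.next R ω = some i}

theorem measurableSet_revealStep (t : ℕ) (i : ι) (R : Finset ι) :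
    MeasurableSet (σ.revealStep t i R) :=
  (σ.measurableSet_revealed t R).inter (σ.measurableSet_next R _)

theorem determines_revealStep (t : ℕ) (i : ι) (R : Finset ι) :
    𝓡.Determines R (σ.revealStep t i R) := fun ω ω' h hω =>
  ⟨σ.determines_revealed t R ω ω' h hω.1, σ.determines_next R _ ω ω' h hω.2⟩

/-- A coordinate is revealed at most once, so the events for different steps and different `R` are
disjoint. -/
theorem sum_measure_revealStep_le (T : ℕ) (i : ι) :
    ∑ t ∈ Finset.range T, ∑ R ∈ F.powerset, P (σ.revealStep t i R) ≤
      P {ω | i ∈ σ.revealed T ω} := by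
  induction T with
  | zero => simp
  | succ T ih =>
    rw [Finset.sum_range_succ]
    have hdisj : Set.PairwiseDisjoint (F.powerset : Set (Finset ι)) (σ.revealStep T i) := by
      intro R _ R' _ hne
      refine Set.disjoint_left.2 fun ω h h' => hne ?_
      rw [← h.1, ← h'.1]
    rw [← measure_biUnion_finset hdisj fun R _ => σ.measurableSet_revealStep T i R]
    refine (add_le_add_left ih _).trans ?_
    rw [← measure_union _ (Finset.measurableSet_biUnion _ fun R _ =>
      σ.measurableSet_revealStep T i R)]
    · refine measure_mono fun ω hω => ?_
      simp only [Set.mem_ofPred_eq, revealed]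
      rcases hω with hω | hω
      · have hω : i ∈ σ.revealed T ω := hω
        cases σ.next (σ.revealed T ω) ω <;> simp [hω]
      · simp only [Set.mem_iUnion] at hω
        obtain ⟨R, -, hR, hn⟩ := hω
        simp [hR, hn]
    · refine Set.disjoint_left.2 fun ω h h' => ?_
      simp only [Set.mem_iUnion] at h'
      obtain ⟨R, -, hR, hn⟩ := h'
      exact σ.next_notMem hn (hR ▸ h)

/-- The OSSS inequality: if the coordinates revealed in `T` steps determine `A`, then the variance
of the indicator of `A` is at most the sum over the coordinates of the revealment times the
influence. -/
theorem osss [IsProbabilityMeasure P] {A : Set Ω} (hA : MeasurableSet A) (T : ℕ)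
    (hT : ∀ R, 𝓡.Determines R ({ω | σ.revealed T ω = R} ∩ A)) :
    P A * P Aᶜ ≤ ∑ i ∈ F, P {ω | i ∈ σ.revealed T ω} * 𝓡.influence A i := by
  -- This interpolates between `ω` and a sample independent of the occurrence of `A` at `ω`: the
  -- coordinates queried at `ω` are replaced one at a time. If `A` holds at the start and fails at
  -- the end, some single replacement flips it.
  let W : ℕ → Ω × Ω → Ω := fun t p => 𝓡.mix (σ.revealed t p.1) p.1 p.2
  have hstart : P A * P Aᶜ = (P.prod P) {p | p.1 ∈ A ∧ W T p ∉ A} := by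
    have hset : {p : Ω × Ω | p.1 ∈ A ∧ W T p ∉ A} = ⋃ R ∈ F.powerset,
        {p : Ω × Ω | p.1 ∈ {ω | σ.revealed T ω = R} ∩ A ∧ 𝓡.mix R p.1 p.2 ∉ A} := by
      ext p
      simp only [Set.mem_ofPred_eq, Set.mem_iUnion, Set.mem_inter_iff, Finset.mem_powerset,
        exists_prop, W]
      constructor
      · rintro ⟨h, h'⟩
        exact ⟨_, σ.revealed_subset T p.1, ⟨rfl, h⟩, h'⟩
      · rintro ⟨R, -, ⟨rfl, h⟩, h'⟩
        exact ⟨h, h'⟩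
    have hB : ∀ R, MeasurableSet ({ω | σ.revealed T ω = R} ∩ A) := fun R =>
      (σ.measurableSet_revealed T R).inter hA
    rw [hset, measure_biUnion_finset, Finset.sum_congr rfl fun R _ =>
      𝓡.measure_inter_mix_of_determines hA (hB R) (hT R), ← Finset.sum_mul]
    · congr 1
      rw [← measure_biUnion_finset]
      · congr 1
        ext ω
        simp only [Set.mem_iUnion, Set.mem_inter_iff, Set.mem_ofPred_eq, Finset.mem_powerset,
          exists_prop]
        exact ⟨fun h => ⟨_, σ.revealed_subset T ω, rfl, h⟩, by rintro ⟨R, -, -, h⟩; exact h⟩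
      · intro R _ R' _ hne
        refine Set.disjoint_left.2 fun ω h h' => hne ?_
        rw [← h.1, ← h'.1]
      · exact fun R _ => hB R
    · intro R _ R' _ hne
      refine Set.disjoint_left.2 fun ω h h' => hne ?_
      rw [← h.1.1, ← h'.1.1]
    · exact fun R _ => (measurable_fst (hB R)).inter (𝓡.measurable_mix R hA).compl
  have htel : {p : Ω × Ω | p.1 ∈ A ∧ W T p ∉ A} ⊆
      ⋃ t ∈ Finset.range T, {p | ¬(W t p ∈ A ↔ W (t + 1) p ∈ A)} := by
    intro p hp
    by_contra hcon
    simp only [Set.mem_iUnion, Finset.mem_range, Set.mem_ofPred_eq, exists_prop, not_exists,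
      not_and, not_not] at hcon
    have : ∀ t ≤ T, (W t p ∈ A ↔ p.1 ∈ A) := by
      intro t
      induction t with
      | zero => intro _; simp [W, revealed, 𝓡.mix_empty]
      | succ t ih => intro ht; rw [← hcon t (by omega), ih (by omega)]
    exact hp.2 ((this T le_rfl).2 hp.1)
  have hstep : ∀ t, (P.prod P) {p | ¬(W t p ∈ A ↔ W (t + 1) p ∈ A)} ≤
      ∑ i ∈ F, ∑ R ∈ F.powerset, P (σ.revealStep t i R) * 𝓡.influence A i := by
    intro t
    have hsub : {p | ¬(W t p ∈ A ↔ W (t + 1) p ∈ A)} ⊆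
        ⋃ i ∈ F, ⋃ R ∈ F.powerset, {p : Ω × Ω | p.1 ∈ σ.revealStep t i R ∧
          ¬(𝓡.mix R p.1 p.2 ∈ A ↔ 𝓡.mix (insert i R) p.1 p.2 ∈ A)} := by
      intro p hp
      simp only [Set.mem_ofPred_eq, W, revealed] at hp
      cases hn : σ.next (σ.revealed t p.1) p.1 with
      | none => simp [hn] at hp
      | some i =>
        simp only [Set.mem_iUnion, Finset.mem_powerset, exists_prop]
        refine ⟨i, σ.next_mem hn, _, σ.revealed_subset t p.1, ⟨rfl, hn⟩, ?_⟩
        simpa [hn] using hp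
    refine (measure_mono hsub).trans ((measure_biUnion_finset_le _ _).trans ?_)
    refine Finset.sum_le_sum fun i _ => (measure_biUnion_finset_le _ _).trans ?_
    refine Finset.sum_le_sum fun R _ => ?_
    by_cases hi : i ∈ R
    · have : {p : Ω × Ω | p.1 ∈ σ.revealStep t i R ∧
          ¬(𝓡.mix R p.1 p.2 ∈ A ↔ 𝓡.mix (insert i R) p.1 p.2 ∈ A)} = ∅ := by
        ext p
        simp [Finset.insert_eq_of_mem hi]
      simp [this]
    · rw [𝓡.measure_inter_flip_of_determines hA (σ.measurableSet_revealStep t i R) hi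
        (σ.determines_revealStep t i R)]
  rw [hstart]
  calc _ ≤ _ := measure_mono htel
    _ ≤ ∑ t ∈ Finset.range T, (P.prod P) {p | ¬(W t p ∈ A ↔ W (t + 1) p ∈ A)} :=
      measure_biUnion_finset_le _ _
    _ ≤ ∑ t ∈ Finset.range T, ∑ i ∈ F, ∑ R ∈ F.powerset,
        P (σ.revealStep t i R) * 𝓡.influence A i := Finset.sum_le_sum fun t _ => hstep t
    _ = ∑ i ∈ F, (∑ t ∈ Finset.range T, ∑ R ∈ F.powerset, P (σ.revealStep t i R)) *
        𝓡.influence A i := by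
      rw [Finset.sum_comm]
      simp only [Finset.sum_mul]
    _ ≤ _ := Finset.sum_le_sum fun i _ =>
      mul_le_mul_left (σ.sum_measure_revealStep_le T i) _

/-- Each step before the strategy stops adds a new element of `F`, so after `|F|` steps it has
stopped or has exhausted `F`. -/
theorem next_revealed_card (ω : Ω) (hnone : ∀ {R ω}, F ⊆ R → σ.next R ω = none) :
    σ.next (σ.revealed F.card ω) ω = none := by
  have key : ∀ t, σ.next (σ.revealed t ω) ω = none ∨ (σ.revealed t ω).card = t := by
    intro t
    induction t with
    | zero => right; rfl
    | succ t ih =>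
      cases hn : σ.next (σ.revealed t ω) ω with
      | none => left; simp [revealed, hn]
      | some i =>
        right
        have := ih.resolve_left (by simp [hn])
        simp [revealed, hn, Finset.card_insert_of_notMem (σ.next_notMem hn), this]
  rcases key F.card with h | h
  · exact h
  · exact hnone (Finset.eq_of_subset_of_card_le (σ.revealed_subset _ ω) h.ge).ge

end Strategy

/-! ### Explorations driven by an eligibility rule -/

section Exploration

variable {ι Ω : Type*} [MeasurableSpace Ω] {P : Measure Ω}

open Classical in
/-- The strategy that reveals coordinates of `F` as long as there are eligible ones, where the
eligible coordinates are given by `C`. -/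
def exploration (𝓡 : Resampling ι P) (F : Finset ι) (C : Finset ι → Ω → Set ι)
    (hmeas : ∀ R i, MeasurableSet {ω | i ∈ C R ω})
    (hdet : ∀ R i, 𝓡.Determines R {ω | i ∈ C R ω}) : Strategy 𝓡 F where
  next R ω :=
    if h : (F.filter fun i => i ∉ R ∧ i ∈ C R ω).Nonempty then some h.choose else none
  measurableSet_next R o := by
    -- The choice is a function of the finite set of eligible coordinates alone, so the event is a
    -- finite union over the possible values of that set.
    let pick : Finset ι → Option ι := fun s => if h : s.Nonempty then some h.choose else none
    have : {ω | (if h : (F.filter fun i => i ∉ R ∧ i ∈ C R ω).Nonempty then some h.choose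
        else none) = o} = ⋃ s ∈ F.powerset.filter fun s => pick s = o,
          {ω | (F.filter fun i => i ∉ R ∧ i ∈ C R ω) = s} := by
      ext ω
      simp only [Set.mem_ofPred_eq, Set.mem_iUnion, Finset.mem_filter, Finset.mem_powerset,
        exists_prop, exists_eq_right']
      exact ⟨fun h => ⟨Finset.filter_subset _ _, h⟩, fun h => h.2⟩
    rw [this]
    refine Finset.measurableSet_biUnion _ fun s hs => ?_
    have hsF : s ⊆ F := Finset.mem_powerset.1 (Finset.mem_filter.1 hs).1
    have : {ω | (F.filter fun i => i ∉ R ∧ i ∈ C R ω) = s} =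
        ⋂ i ∈ F, {ω | (i ∉ R ∧ i ∈ C R ω) ↔ i ∈ s} := by
      ext ω
      simp only [Set.mem_ofPred_eq, Set.mem_iInter, Finset.ext_iff, Finset.mem_filter]
      constructor
      · intro h i hi
        simpa [hi] using h i
      · intro h i
        by_cases hi : i ∈ F
        · simpa [hi] using h i hi
        · simpa [hi] using fun h => hi (hsF h)
    rw [this]
    exact Finset.measurableSet_biInter _ fun i _ =>
      ((MeasurableSet.const _).inter (hmeas R i)).iff (MeasurableSet.const _)
  determines_next R o := by
    intro ω ω' h hω
    have : ∀ i, i ∈ C R ω' ↔ i ∈ C R ω := fun i => ((hdet R i).iff h).symm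
    simpa [this] using hω
  next_notMem {R ω i} h := by
    split_ifs at h with hne
    have := Finset.mem_filter.1 hne.choose_spec
    simp only [Option.some.injEq] at h
    exact h ▸ this.2.1
  next_mem {R ω i} h := by
    split_ifs at h with hne
    have := Finset.mem_filter.1 hne.choose_spec
    simp only [Option.some.injEq] at h
    exact h ▸ this.1

/-- The OSSS inequality for an exploration: `C R ω` is the set of coordinates that are eligible
when those in `R` have been revealed, and `H i` contains the event that `i` is ever eligible. -/
theorem osss_exploration [IsProbabilityMeasure P] (𝓡 : Resampling ι P) (F : Finset ι)
    (C : Finset ι → Ω → Set ι) (hmeas : ∀ R i, MeasurableSet {ω | i ∈ C R ω})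
    (hdet : ∀ R i, 𝓡.Determines R {ω | i ∈ C R ω}) {A : Set Ω} (hA : MeasurableSet A)
    (hAdet : ∀ R ⊆ F, ∀ ω ω', (∀ i ∈ R, 𝓡.agree i ω ω') → (∀ i ∈ F, i ∈ C R ω → i ∈ R) →
      ω ∈ A → ω' ∈ A)
    (H : ι → Set Ω) (hH : ∀ R ⊆ F, ∀ i ω, i ∈ C R ω → ω ∈ H i) :
    P A * P Aᶜ ≤ ∑ i ∈ F, P (H i) * 𝓡.influence A i := by
  classical
  let σ := exploration 𝓡 F C hmeas hdet
  have hnone : ∀ {R ω}, F ⊆ R → σ.next R ω = none := by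
    intro R ω h
    refine dif_neg ?_
    rintro ⟨i, hi⟩
    have := Finset.mem_filter.1 hi
    exact this.2.1 (h this.1)
  have hfin : ∀ ω, ∀ i ∈ F, i ∈ C (σ.revealed F.card ω) ω → i ∈ σ.revealed F.card ω := by
    intro ω i hi hC
    by_contra hR
    have h1 := σ.next_revealed_card ω hnone
    have hne : (F.filter fun i => i ∉ σ.revealed F.card ω ∧
        i ∈ C (σ.revealed F.card ω) ω).Nonempty :=
      ⟨i, Finset.mem_filter.2 ⟨hi, hR, hC⟩⟩
    have h2 : σ.next (σ.revealed F.card ω) ω = some hne.choose := dif_pos hne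
    simp [h1] at h2
  refine (σ.osss hA F.card ?_).trans (Finset.sum_le_sum fun i _ => mul_le_mul_left ?_ _)
  · rintro R ω ω' h ⟨hR, hω⟩
    refine ⟨σ.determines_revealed _ R ω ω' h hR, ?_⟩
    have hR : σ.revealed F.card ω = R := hR
    refine hAdet R (hR ▸ σ.revealed_subset _ ω) ω ω' h ?_ hω
    have := hfin ω
    rwa [hR] at this
  · refine measure_mono fun ω hω => ?_
    have key : ∀ t, i ∈ σ.revealed t ω → ω ∈ H i := by
      intro t
      induction t with
      | zero => simp [Strategy.revealed]
      | succ t ih =>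
        intro h
        rw [Strategy.revealed] at h
        cases hn : σ.next (σ.revealed t ω) ω with
        | none => exact ih (by simpa [hn] using h)
        | some j =>
          rcases Finset.mem_insert.1 (by simpa [hn] using h : i ∈ insert j _) with rfl | h
          · have hn' : (if h : (F.filter fun i => i ∉ σ.revealed t ω ∧
                i ∈ C (σ.revealed t ω) ω).Nonempty then some h.choose else none) = some i := hn
            split_ifs at hn' with hne
            have := Finset.mem_filter.1 hne.choose_spec
            simp only [Option.some.injEq] at hn'
            exact hH _ (σ.revealed_subset t ω) i ω (hn' ▸ this.2.2)
          · exact ih h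
    exact key _ hω

end Exploration

/-! ### The sample space -/

section SampleSpace

/-- The space of the pairs `(V, Y)`. -/
abbrev Sample (d : ℕ) (S : Type*) : Type _ := (Lattice d → PointConfig) × (Lattice d → S)

/-- The strips `(k, j)` of the Poisson processes: `j` is the number of the strip of `V_k`. -/
abbrev Strip (d : ℕ) : Type := Lattice d × ℕ

/-- The coordinates of the sample space: the strips of the Poisson processes and the coarse
sites. -/
abbrev Coord (d : ℕ) : Type := Strip d ⊕ Lattice d

/-- The law of the positions of the points in a strip. -/
def positionLaw : Measure (ℕ → unitInterval × unitInterval) :=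
  Measure.infinitePi fun _ => (volume : Measure (unitInterval × unitInterval))

instance : IsProbabilityMeasure positionLaw := by unfold positionLaw; infer_instance

theorem poissonProcessLaw_eq (lam : ℝ) : poissonProcessLaw lam =
    Measure.infinitePi fun _ : ℕ => (poissonMeasure lam.toNNReal).prod positionLaw := rfl

instance (lam : ℝ) : IsProbabilityMeasure (poissonProcessLaw lam) := by
  rw [poissonProcessLaw_eq]; infer_instance

variable {S : Type*} [MeasurableSpace S] {d : ℕ} (μ : Measure S) [IsProbabilityMeasure μ]

instance : IsProbabilityMeasure (Environment.lawY d μ) := by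
  unfold Environment.lawY; infer_instance

instance (lam : ℝ) : IsProbabilityMeasure (jointLaw d μ lam) := by
  unfold jointLaw; infer_instance

theorem measurePreserving_swap_or_id {α : Type*} [MeasurableSpace α] (ν : Measure α) [SFinite ν]
    (p : Prop) [Decidable p] :
    MeasurePreserving (fun q : α × α => (if p then q.2 else q.1, if p then q.1 else q.2))
      (ν.prod ν) (ν.prod ν) := by
  by_cases h : p
  · simp only [h, if_true]
    exact Measure.measurePreserving_swap
  · simp only [h, if_false]
    exact MeasurePreserving.id _

open Classical in
/-- The coordinates of the sample space can be resampled independently. -/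
def sampleResampling (d : ℕ) (lam : ℝ) : Resampling (Coord d) (jointLaw d μ lam) where
  agree i ω ω' := i.elim (fun a : Strip d => ω.1 a.1 a.2 = ω'.1 a.1 a.2) fun z => ω.2 z = ω'.2 z
  equiv i := by
    rcases i with a | z
    · exact ⟨fun _ => rfl, fun h => Eq.symm h, fun h h' => Eq.trans h h'⟩
    · exact ⟨fun _ => rfl, fun h => Eq.symm h, fun h h' => Eq.trans h h'⟩
  ext ω ω' h := Prod.ext (funext fun k => funext fun j => h (Sum.inl (k, j)))
    (funext fun z => h (Sum.inr z))
  mix R ω ω' := (fun k j => if Sum.inl (k, j) ∈ R then ω'.1 k j else ω.1 k j,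
    fun z => if Sum.inr z ∈ R then ω'.2 z else ω.2 z)
  mix_mem {R i} ω ω' h := by
    rcases i with a | z <;> simp [h]
  mix_notMem {R i} ω ω' h := by
    rcases i with a | z <;> simp [h]
  preserving R := by
    have hV : MeasurePreserving
        (fun p : (Lattice d → PointConfig) × (Lattice d → PointConfig) =>
          ((fun k j => if Sum.inl (k, j) ∈ R then p.2 k j else p.1 k j),
            fun k j => if Sum.inl (k, j) ∈ R then p.1 k j else p.2 k j))
        ((Measure.infinitePi fun _ : Lattice d => poissonProcessLaw lam).prod
          (Measure.infinitePi fun _ : Lattice d => poissonProcessLaw lam))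
        ((Measure.infinitePi fun _ : Lattice d => poissonProcessLaw lam).prod
          (Measure.infinitePi fun _ : Lattice d => poissonProcessLaw lam)) :=
      measurePreserving_infinitePi_prod_map (poissonProcessLaw lam)
        (T := fun k q => ((fun j => if Sum.inl (k, j) ∈ R then q.2 j else q.1 j),
          fun j => if Sum.inl (k, j) ∈ R then q.1 j else q.2 j))
        fun k => measurePreserving_infinitePi_prod_map
          ((poissonMeasure lam.toNNReal).prod positionLaw)
          (T := fun j q => (if Sum.inl (k, j) ∈ R then q.2 else q.1,
            if Sum.inl (k, j) ∈ R then q.1 else q.2))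
          fun j => measurePreserving_swap_or_id _ _
    have hY : MeasurePreserving
        (fun p : (Lattice d → S) × (Lattice d → S) =>
          ((fun z => if Sum.inr z ∈ R then p.2 z else p.1 z),
            fun z => if Sum.inr z ∈ R then p.1 z else p.2 z))
        ((Environment.lawY d μ).prod (Environment.lawY d μ))
        ((Environment.lawY d μ).prod (Environment.lawY d μ)) :=
      measurePreserving_infinitePi_prod_map μ
        (T := fun z q => (if Sum.inr z ∈ R then q.2 else q.1, if Sum.inr z ∈ R then q.1 else q.2))
        fun z => measurePreserving_swap_or_id _ _
    exact ((measurePreserving_prodProdProdComm _ _ _ _).comp (hV.prod hY)).comp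
      (measurePreserving_prodProdProdComm _ _ _ _)

/-- The part of the randomness that does not depend on the intensity: the positions of the points
and the family `Y`. -/
abbrev Marks (d : ℕ) (S : Type*) : Type _ :=
  (Strip d → ℕ → unitInterval × unitInterval) × (Lattice d → S)

/-- The sample with the given numbers of points in the strips. -/
def assemble (κ : Strip d → ℕ) (m : Marks d S) : Sample d S :=
  (fun k j => (κ (k, j), m.1 (k, j)), m.2)

/-- The law of the marks. -/
def markLaw (d : ℕ) (μ : Measure S) : Measure (Marks d S) :=
  (Measure.infinitePi fun _ => positionLaw).prod (Environment.lawY d μ)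

instance : IsProbabilityMeasure (markLaw d μ) := by
  unfold markLaw; infer_instance

/-- The law of the numbers of points in the strips. -/
def countLaw (d : ℕ) (lam : ℝ) : Measure (Strip d → ℕ) :=
  Measure.infinitePi fun _ => poissonMeasure lam.toNNReal

instance (lam : ℝ) : IsProbabilityMeasure (countLaw d lam) := by
  unfold countLaw; infer_instance

/-- The intensity enters through the counts only. Differentiation in `lam` therefore concerns
independent Poisson variables, with the marks as a fixed background. -/
theorem measurePreserving_assemble (lam : ℝ) :
    MeasurePreserving (fun p : (Strip d → ℕ) × Marks d S => assemble p.1 p.2)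
      ((countLaw d lam).prod (markLaw d μ)) (jointLaw d μ lam) := by
  have h1 := measurePreserving_infinitePi_zip (ι := Strip d) (poissonMeasure lam.toNNReal)
    positionLaw
  have h2 : MeasurePreserving (MeasurableEquiv.curry (Lattice d) ℕ
        (ℕ × (ℕ → unitInterval × unitInterval)))
      (Measure.infinitePi fun _ : Strip d => (poissonMeasure lam.toNNReal).prod positionLaw)
      (Measure.infinitePi fun _ : Lattice d => poissonProcessLaw lam) :=
    ⟨MeasurableEquiv.measurable _,
      Measure.infinitePi_map_curry fun _ _ => (poissonMeasure lam.toNNReal).prod positionLaw⟩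
  exact ((h2.comp h1).prod (MeasurePreserving.id (Environment.lawY d μ))).comp
    (measurePreserving_prodAssoc _ _ _).symm

/-- The shift of the sample by the coarse site `z₀`. -/
def shift (N : ℕ) (z₀ : Lattice d) (ω : Sample d S) : Sample d S :=
  (fun k => ω.1 (k + (N : ℤ) • z₀), fun z => ω.2 (z + z₀))

theorem measurePreserving_shift (N : ℕ) (z₀ : Lattice d) (lam : ℝ) :
    MeasurePreserving (shift N z₀ : Sample d S → Sample d S) (jointLaw d μ lam)
      (jointLaw d μ lam) := by
  have h1 : MeasurePreserving (fun (v : Lattice d → PointConfig) k => v (k + (N : ℤ) • z₀))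
      (Measure.infinitePi fun _ : Lattice d => poissonProcessLaw lam)
      (Measure.infinitePi fun _ : Lattice d => poissonProcessLaw lam) :=
    ⟨by fun_prop, Measure.map_infinitePi_infinitePi_of_inj (add_left_injective _)⟩
  have h2 : MeasurePreserving (fun (y : Lattice d → S) z => y (z + z₀))
      (Environment.lawY d μ) (Environment.lawY d μ) :=
    ⟨by fun_prop, Measure.map_infinitePi_infinitePi_of_inj (add_left_injective _)⟩
  exact h1.prod h2

/-- Almost surely no point lies on the bottom of its strip. -/
theorem ae_height_ne_zero (lam : ℝ) :
    ∀ᵐ ω ∂(jointLaw d μ lam), ∀ k j i, ((ω.1 k j).2 i).2 ≠ 0 := by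
  simp only [ae_all_iff]
  intro k j i
  have h1 : MeasurePreserving (fun ω : Sample d S => ω.1) (jointLaw d μ lam)
      (Measure.infinitePi fun _ : Lattice d => poissonProcessLaw lam) := measurePreserving_fst
  have h2 := measurePreserving_eval_infinitePi (fun _ : Lattice d => poissonProcessLaw lam) k
  have h3 := measurePreserving_eval_infinitePi
    (fun _ : ℕ => (poissonMeasure lam.toNNReal).prod positionLaw) j
  have h4 : MeasurePreserving (Prod.snd : ℕ × (ℕ → unitInterval × unitInterval) → _)
      ((poissonMeasure lam.toNNReal).prod positionLaw) positionLaw := measurePreserving_snd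
  have h5 := measurePreserving_eval_infinitePi
    (fun _ : ℕ => (volume : Measure (unitInterval × unitInterval))) i
  have h6 : MeasurePreserving (Prod.snd : unitInterval × unitInterval → unitInterval)
      (volume : Measure (unitInterval × unitInterval)) volume := measurePreserving_snd
  have h := h6.comp (h5.comp (h4.comp (h3.comp (h2.comp h1))))
  exact h.quasiMeasurePreserving.ae (p := fun x => x ≠ 0) (Measure.ae_ne volume 0)

end SampleSpace

/-! ### Functions of independent Poisson variables -/

section PoissonDerivative

variable {ι : Type*} [Fintype ι]

/-- The probability that independent Poisson variables with mean `lam` take the values `k`. -/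
def poissonWeight (k : ι → ℕ) (lam : ℝ) : ℝ :=
  Real.exp (-(Fintype.card ι * lam)) * lam ^ (∑ i, k i) / ∏ i, ((k i).factorial : ℝ)

/-- The product of Poisson laws with mean `lam`. -/
def poissonPi (ι : Type*) [Fintype ι] (lam : ℝ) : Measure (ι → ℕ) :=
  Measure.pi fun _ => poissonMeasure lam.toNNReal

instance (lam : ℝ) : IsProbabilityMeasure (poissonPi ι lam) := by
  unfold poissonPi; infer_instance

theorem poissonPi_real_singleton {lam : ℝ} (hlam : 0 ≤ lam) (k : ι → ℕ) :
    (poissonPi ι lam).real {k} = poissonWeight k lam := by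
  rw [poissonPi, Measure.real, Measure.pi_singleton, ENNReal.toReal_prod]
  have : ∀ i, ((poissonMeasure lam.toNNReal) {k i}).toReal =
      Real.exp (-lam) * lam ^ k i / (k i).factorial := by
    intro i
    have := poissonMeasure_real_singleton lam.toNNReal (k i)
    rwa [Real.coe_toNNReal _ hlam] at this
  simp only [this, Finset.prod_div_distrib, Finset.prod_mul_distrib, Finset.prod_const,
    Finset.card_univ, poissonWeight, Finset.prod_pow_eq_pow_sum, ← Real.exp_nat_mul]
  ring_nf

theorem poissonWeight_nonneg {lam : ℝ} (hlam : 0 ≤ lam) (k : ι → ℕ) :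
    0 ≤ poissonWeight k lam := by
  unfold poissonWeight; positivity

theorem summable_poissonWeight {lam : ℝ} (hlam : 0 ≤ lam) :
    Summable fun k : ι → ℕ => poissonWeight k lam := by
  have h : ∑' k : ι → ℕ, (poissonPi ι lam) {k} ≠ ∞ := by
    have := lintegral_countable' (μ := poissonPi ι lam) fun _ => 1
    simp only [lintegral_const, measure_univ, one_mul] at this
    rw [← this]
    simp
  have := ENNReal.summable_toReal h
  simp only [← poissonPi_real_singleton hlam]
  exact this

theorem integral_poissonPi {lam : ℝ} (hlam : 0 ≤ lam) {F : (ι → ℕ) → ℝ} {c : ℝ}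
    (hF : ∀ k, |F k| ≤ c) :
    ∫ k, F k ∂(poissonPi ι lam) = ∑' k, poissonWeight k lam * F k := by
  have hinteg : Integrable F (poissonPi ι lam) :=
    Integrable.of_bound (Measurable.of_discrete).aestronglyMeasurable c (ae_of_all _ hF)
  rw [integral_countable hinteg]
  simp [poissonPi_real_singleton hlam]

/-- The derivative of `poissonWeight`. -/
def poissonWeightDeriv (k : ι → ℕ) (lam : ℝ) : ℝ :=
  Real.exp (-(Fintype.card ι * lam)) *
    (((∑ i, k i : ℕ) : ℝ) * lam ^ ((∑ i, k i) - 1) - Fintype.card ι * lam ^ (∑ i, k i)) /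
    ∏ i, ((k i).factorial : ℝ)

theorem hasDerivAt_poissonWeight (k : ι → ℕ) (lam : ℝ) :
    HasDerivAt (poissonWeight k) (poissonWeightDeriv k lam) lam := by
  unfold poissonWeight poissonWeightDeriv
  have h1 : HasDerivAt (fun lam : ℝ => Real.exp (-(Fintype.card ι * lam)))
      (Real.exp (-(Fintype.card ι * lam)) * -(Fintype.card ι : ℝ)) lam := by
    have := ((hasDerivAt_id lam).const_mul (Fintype.card ι : ℝ)).neg.exp
    simpa using this
  have h := (h1.mul (hasDerivAt_pow (∑ i, k i) lam)).div_const (∏ i, ((k i).factorial : ℝ))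
  exact h.congr_deriv (by ring)

/-- A summable bound, uniform for intensities in `[0, R]`: since `s ≤ 2 ^ s`, the factor produced by
the derivative is absorbed by passing to mean `2R`. -/
theorem abs_poissonWeightDeriv_le (k : ι → ℕ) {lam R : ℝ} (h0 : 0 ≤ lam) (hR : lam ≤ R)
    (h1 : 1 ≤ R) :
    |poissonWeightDeriv k lam| ≤
      (1 + Fintype.card ι) * Real.exp (Fintype.card ι * (2 * R)) * poissonWeight k (2 * R) := by
  have hw : (1 + Fintype.card ι) * Real.exp (Fintype.card ι * (2 * R)) * poissonWeight k (2 * R) =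
      (1 + Fintype.card ι) * (2 * R) ^ (∑ i, k i) / ∏ i, ((k i).factorial : ℝ) := by
    have : Real.exp (Fintype.card ι * (2 * R)) * Real.exp (-(Fintype.card ι * (2 * R))) = 1 := by
      rw [← Real.exp_add]; simp
    rw [poissonWeight, mul_div_assoc, mul_assoc, ← mul_assoc (Real.exp _), this, one_mul,
      mul_div_assoc]
  rw [hw, poissonWeightDeriv, abs_div, abs_of_nonneg (by positivity :
    0 ≤ ∏ i, ((k i).factorial : ℝ)), abs_mul, abs_of_pos (Real.exp_pos _)]
  refine div_le_div_of_nonneg_right ?_ (by positivity)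
  set s := ∑ i, k i
  have he : Real.exp (-(Fintype.card ι * lam)) ≤ 1 := by
    rw [Real.exp_le_one_iff]
    have : 0 ≤ (Fintype.card ι : ℝ) * lam := by positivity
    linarith
  have ha : (s : ℝ) * lam ^ (s - 1) ≤ (2 * R) ^ s := by
    rw [mul_pow]
    refine mul_le_mul (by exact_mod_cast (Nat.lt_two_pow_self).le) ?_ (by positivity)
      (by positivity)
    exact (pow_le_pow_left₀ h0 hR _).trans (pow_le_pow_right₀ h1 (Nat.sub_le _ _))
  have hb : (Fintype.card ι : ℝ) * lam ^ s ≤ Fintype.card ι * (2 * R) ^ s := by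
    gcongr
    linarith
  have ha0 : 0 ≤ (s : ℝ) * lam ^ (s - 1) := by positivity
  have hb0 : 0 ≤ (Fintype.card ι : ℝ) * lam ^ s := by positivity
  calc Real.exp (-(Fintype.card ι * lam)) * |(s : ℝ) * lam ^ (s - 1) - Fintype.card ι * lam ^ s|
      ≤ 1 * |(s : ℝ) * lam ^ (s - 1) - Fintype.card ι * lam ^ s| := by gcongr
    _ ≤ _ := by
      rw [one_mul, abs_le]
      constructor <;> nlinarith

variable [DecidableEq ι]

/-- Cancelling `k i` against the factorial turns the summand into the weight of `k` with one point
removed from `i`. Terms with `k i = 0` vanish, so the shift by one point covers all the others. -/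
theorem tsum_poissonWeight_add (i : ι) (lam : ℝ) (F : (ι → ℕ) → ℝ) :
    ∑' k, Real.exp (-(Fintype.card ι * lam)) * ((k i : ℝ) * lam ^ ((∑ i, k i) - 1)) /
      (∏ i, ((k i).factorial : ℝ)) * F k =
      ∑' k, poissonWeight k lam * F (k + Pi.single i 1) := by
  have hinj : Function.Injective fun k : ι → ℕ => k + Pi.single i 1 := add_left_injective _
  rw [← hinj.tsum_eq]
  · refine tsum_congr fun k => ?_
    have hs : ∑ j, (k + Pi.single i 1 : ι → ℕ) j = (∑ j, k j) + 1 := by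
      simp [Finset.sum_add_distrib]
    have hp : ∏ j, (((k + Pi.single i 1 : ι → ℕ) j).factorial : ℝ) =
        (k i + 1) * ∏ j, ((k j).factorial : ℝ) := by
      rw [← Finset.mul_prod_erase _ _ (Finset.mem_univ i),
        ← Finset.mul_prod_erase Finset.univ (fun j => ((k j).factorial : ℝ)) (Finset.mem_univ i),
        ← mul_assoc]
      congr 1
      · simp [Nat.factorial_succ]
      · refine Finset.prod_congr rfl fun j hj => ?_
        simp [(Finset.mem_erase.1 hj).1]
    rw [hs, hp, poissonWeight]
    have : ((k i : ℝ) + 1) ≠ 0 := by positivity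
    have : ∏ j, ((k j).factorial : ℝ) ≠ 0 := by positivity
    simp only [Pi.add_apply, Pi.single_eq_same, Nat.cast_add, Nat.cast_one, add_tsub_cancel_right]
    field_simp
  · intro k hk
    have hki : k i ≠ 0 := by
      rintro h
      simp [h] at hk
    refine ⟨k - Pi.single i 1, ?_⟩
    funext j
    by_cases hj : j = i
    · subst hj; simp; omega
    · simp [hj]

/-- Russo's formula for bounded functions of independent Poisson variables. -/
theorem hasDerivAt_integral_poissonPi {F : (ι → ℕ) → ℝ} {c : ℝ} (hF : ∀ k, |F k| ≤ c) {lam : ℝ}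
    (hlam : 0 < lam) :
    HasDerivAt (fun lam => ∫ k, F k ∂(poissonPi ι lam))
      (∑ i, ∫ k, (F (k + Pi.single i 1) - F k) ∂(poissonPi ι lam)) lam := by
  have hc : 0 ≤ c := (abs_nonneg _).trans (hF 0)
  set R : ℝ := lam + 1
  have hR : 1 ≤ R := by simp [R, hlam.le]
  have hmem : lam ∈ Set.Ioo 0 R := ⟨hlam, by simp [R]⟩
  have hsumm : ∀ {G : (ι → ℕ) → ℝ} {y : ℝ}, 0 ≤ y → (∀ k, |G k| ≤ c) →
      Summable fun k => poissonWeight k y * G k := by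
    intro G y hy hG
    refine Summable.of_norm_bounded ((summable_poissonWeight hy).mul_right c) fun k => ?_
    rw [Real.norm_eq_abs, abs_mul, abs_of_nonneg (poissonWeight_nonneg hy k)]
    exact mul_le_mul_of_nonneg_left (hG k) (poissonWeight_nonneg hy k)
  have hder : HasDerivAt (fun y => ∑' k, poissonWeight k y * F k)
      (∑' k, poissonWeightDeriv k lam * F k) lam := by
    refine hasDerivAt_tsum_of_isPreconnected (t := Set.Ioo 0 R) (y₀ := lam)
      (u := fun k => (1 + Fintype.card ι) * Real.exp (Fintype.card ι * (2 * R)) *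
        poissonWeight k (2 * R) * c)
      (((summable_poissonWeight (by linarith)).mul_left _).mul_right c) isOpen_Ioo
      isPreconnected_Ioo (fun k y _ => (hasDerivAt_poissonWeight k y).mul_const _)
      (fun k y hy => ?_) hmem (hsumm hlam.le hF) hmem
    rw [Real.norm_eq_abs, abs_mul]
    exact mul_le_mul (abs_poissonWeightDeriv_le k hy.1.le hy.2.le hR) (hF k) (abs_nonneg _)
      ((abs_nonneg _).trans (abs_poissonWeightDeriv_le k hy.1.le hy.2.le hR))
  have hval : ∑' k, poissonWeightDeriv k lam * F k =
      ∑ i, ∫ k, (F (k + Pi.single i 1) - F k) ∂(poissonPi ι lam) := by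
    have hinteg : ∀ i, ∫ k, (F (k + Pi.single i 1) - F k) ∂(poissonPi ι lam) =
        ∑' k, (Real.exp (-(Fintype.card ι * lam)) * ((k i : ℝ) * lam ^ ((∑ i, k i) - 1)) /
          (∏ i, ((k i).factorial : ℝ)) * F k) - ∑' k, poissonWeight k lam * F k := by
      intro i
      rw [integral_sub, integral_poissonPi hlam.le fun k => hF _, integral_poissonPi hlam.le hF,
        tsum_poissonWeight_add]
      · exact Integrable.of_bound (Measurable.of_discrete).aestronglyMeasurable c
          (ae_of_all _ fun k => hF _)
      · exact Integrable.of_bound (Measurable.of_discrete).aestronglyMeasurable c (ae_of_all _ hF)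
    -- Summability is needed for each `i` separately to exchange the finite sum with the series; `k
    -- i ≤ ∑ i, k i` bounds each part by the derivative plus a multiple of the weight.
    have hsumm' : ∀ i, Summable fun k : ι → ℕ => Real.exp (-(Fintype.card ι * lam)) *
        ((k i : ℝ) * lam ^ ((∑ i, k i) - 1)) / (∏ i, ((k i).factorial : ℝ)) * F k := by
      intro i
      refine Summable.of_norm_bounded (((summable_poissonWeight (ι := ι)
        (by linarith : 0 ≤ 2 * R)).mul_left
        ((1 + Fintype.card ι) * Real.exp (Fintype.card ι * (2 * R)))).mul_right c |>.add
        ((summable_poissonWeight (ι := ι) hlam.le).mul_left (Fintype.card ι * c))) fun k => ?_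
      have e : Real.exp (-(Fintype.card ι * lam)) * ((k i : ℝ) * lam ^ ((∑ i, k i) - 1)) /
          (∏ i, ((k i).factorial : ℝ)) ≤
          poissonWeightDeriv k lam + Fintype.card ι * poissonWeight k lam := by
        rw [poissonWeightDeriv, poissonWeight, ← mul_div_assoc, ← add_div]
        gcongr
        have hki : (k i : ℝ) ≤ (∑ i, k i : ℕ) := by
          exact_mod_cast Finset.single_le_sum (fun _ _ => Nat.zero_le _) (Finset.mem_univ i)
        calc _ ≤ Real.exp (-(Fintype.card ι * lam)) *
              (((∑ i, k i : ℕ) : ℝ) * lam ^ ((∑ i, k i) - 1)) := by gcongr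
          _ = _ := by ring
      rw [Real.norm_eq_abs, abs_mul, abs_of_nonneg (by positivity)]
      have h2 := (le_abs_self _).trans (abs_poissonWeightDeriv_le k hmem.1.le hmem.2.le hR)
      calc _ ≤ (poissonWeightDeriv k lam + Fintype.card ι * poissonWeight k lam) * c :=
            mul_le_mul e (hF k) (abs_nonneg _) (le_trans (by positivity) e)
        _ ≤ _ := by nlinarith
    simp only [hinteg]
    rw [Finset.sum_sub_distrib, ← Summable.tsum_finsetSum fun i _ => hsumm' i]
    simp only [Finset.sum_const, Finset.card_univ, nsmul_eq_mul]
    rw [← tsum_mul_left, ← Summable.tsum_sub (summable_sum fun i _ => hsumm' i)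
      ((hsumm hlam.le hF).mul_left _)]
    refine tsum_congr fun k => ?_
    rw [poissonWeightDeriv, poissonWeight, Nat.cast_sum, ← Finset.sum_mul, ← Finset.sum_div,
      ← Finset.mul_sum, ← Finset.sum_mul]
    ring
  rw [← hval]
  refine hder.congr_of_eventuallyEq ?_
  -- The series represents the integral for nonnegative intensities only, as `toNNReal` truncates; a
  -- neighbourhood of `lam > 0` is enough.
  filter_upwards [lt_mem_nhds hlam] with y hy
  exact integral_poissonPi hy.le hF

end PoissonDerivative

/-! ### Emptying Poisson coordinates against adding a point -/

section PoissonComparison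

theorem lintegral_poissonMeasure (r : ℝ≥0) (a : ℕ → ℝ≥0∞) :
    ∫⁻ m, a m ∂(poissonMeasure r) =
      ∑' m, a m * ENNReal.ofReal (Real.exp (-r) * r ^ m / m.factorial) := by
  rw [lintegral_countable']
  simp [poissonMeasure_singleton]

/-- The upper tail of a Poisson law is at most a constant times the weight of its end point. -/
theorem tsum_poisson_tail_le (r : ℝ≥0) (j : ℕ) :
    ∑' m, (if j < m then ENNReal.ofReal (Real.exp (-r) * r ^ m / m.factorial) else 0) ≤
      ENNReal.ofReal (Real.exp r) * ENNReal.ofReal (Real.exp (-r) * r ^ j / j.factorial) := by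
  have hinj : Function.Injective fun i : ℕ => j + i := add_right_injective j
  rw [← hinj.tsum_eq]
  · have hexp : ENNReal.ofReal (Real.exp r) =
        ∑' i : ℕ, ENNReal.ofReal ((r : ℝ) ^ i / i.factorial) := by
      rw [← ENNReal.ofReal_tsum_of_nonneg (fun i => by positivity)
        (Real.summable_pow_div_factorial r), Real.exp_eq_exp_ℝ,
        NormedSpace.exp_eq_tsum_div]
    rw [hexp, ← ENNReal.tsum_mul_right]
    refine ENNReal.tsum_le_tsum fun i => ?_
    refine le_trans (b := ENNReal.ofReal (Real.exp (-r) * r ^ (j + i) / (j + i).factorial)) ?_ ?_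
    · split_ifs <;> simp
    · rw [← ENNReal.ofReal_mul (by positivity)]
      refine ENNReal.ofReal_le_ofReal ?_
      -- With `m = j + i`, the bound `j! i! ≤ (j + i)!` separates the weight of `j` from the
      -- exponential series in `i`.
      have hf : ((j.factorial * i.factorial : ℕ) : ℝ) ≤ ((j + i).factorial : ℝ) := by
        exact_mod_cast Nat.le_of_dvd (Nat.factorial_pos _)
          (Nat.factorial_mul_factorial_dvd_factorial_add j i)
      push_cast at hf
      rw [div_mul_div_comm, pow_add]
      have : (r : ℝ) ^ i * (Real.exp (-r) * r ^ j) = Real.exp (-r) * (r ^ j * r ^ i) := by ring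
      rw [this, mul_comm (i.factorial : ℝ)]
      gcongr
  · intro m hm
    have : j < m := by
      by_contra h
      simp [h] at hm
    exact ⟨m - j, by simp; omega⟩

/-- Telescoping `a m - a 0` and exchanging the sums weights the increment at `j` by the tail beyond
`j`, which is at most `e^r` times the weight of `j`. -/
theorem lintegral_poisson_sub_zero_le (r : ℝ≥0) {a : ℕ → ℝ} (ha : Monotone a) :
    ∫⁻ m, ENNReal.ofReal (a m - a 0) ∂(poissonMeasure r) ≤
      ENNReal.ofReal (Real.exp r) * ∫⁻ m, ENNReal.ofReal (a (m + 1) - a m) ∂(poissonMeasure r) := by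
  have hd : ∀ j, 0 ≤ a (j + 1) - a j := fun j => sub_nonneg.2 (ha (Nat.le_succ j))
  have hsplit : ∀ m, ENNReal.ofReal (a m - a 0) =
      ∑' j, if j < m then ENNReal.ofReal (a (j + 1) - a j) else 0 := by
    intro m
    rw [← Finset.sum_range_sub, ENNReal.ofReal_sum_of_nonneg fun j _ => hd j,
      tsum_eq_sum (s := Finset.range m)]
    · exact Finset.sum_congr rfl fun j hj => by simp [Finset.mem_range.1 hj]
    · intro j hj
      simp only [Finset.mem_range] at hj
      simp [hj]
  rw [lintegral_poissonMeasure, lintegral_poissonMeasure]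
  simp only [hsplit, ← ENNReal.tsum_mul_right]
  rw [ENNReal.tsum_comm, ← ENNReal.tsum_mul_left]
  refine ENNReal.tsum_le_tsum fun j => ?_
  calc _ = ENNReal.ofReal (a (j + 1) - a j) *
        ∑' m, (if j < m then ENNReal.ofReal (Real.exp (-r) * r ^ m / m.factorial) else 0) := by
        rw [← ENNReal.tsum_mul_left]
        refine tsum_congr fun m => ?_
        split_ifs <;> simp
    _ ≤ _ := by
        rw [mul_left_comm]
        gcongr
        exact tsum_poisson_tail_le r j

variable {ι : Type*} [DecidableEq ι] (r : ℝ≥0)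

theorem lintegral_poisson_update {h : (ι → ℕ) → ℝ≥0∞} (hh : Measurable h) (i : ι) :
    ∫⁻ κ, h κ ∂(Measure.infinitePi fun _ => poissonMeasure r) =
      ∫⁻ κ, ∫⁻ m, h (Function.update κ i m) ∂(poissonMeasure r)
        ∂(Measure.infinitePi fun _ => poissonMeasure r) := by
  have hp := measurePreserving_infinitePi_update (poissonMeasure r) i
  rw [← hp.lintegral_comp hh]
  exact lintegral_prod _ (hh.comp hp.measurable).aemeasurable

theorem lintegral_sub_update_zero_le {F : (ι → ℕ) → ℝ} (hF : Measurable F) (hmono : Monotone F)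
    (i : ι) :
    ∫⁻ κ, ENNReal.ofReal (F κ - F (Function.update κ i 0))
        ∂(Measure.infinitePi fun _ => poissonMeasure r) ≤
      ENNReal.ofReal (Real.exp r) *
        ∫⁻ κ, ENNReal.ofReal (F (κ + Pi.single i 1) - F κ)
          ∂(Measure.infinitePi fun _ => poissonMeasure r) := by
  have h0 : Measurable fun κ : ι → ℕ => Function.update κ i 0 := by fun_prop
  have h1 : Measurable fun κ : ι → ℕ => κ + Pi.single i 1 := by
    refine measurable_pi_lambda _ fun j => ?_
    exact (measurable_pi_apply j).add_const _
  rw [lintegral_poisson_update r (by fun_prop) i,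
    lintegral_poisson_update r (h := fun κ => ENNReal.ofReal (F (κ + Pi.single i 1) - F κ))
      ((hF.comp h1).sub hF).ennreal_ofReal i,
    ← lintegral_const_mul' _ _ ENNReal.ofReal_ne_top]
  refine lintegral_mono fun κ => ?_
  have := lintegral_poisson_sub_zero_le r (a := fun m => F (Function.update κ i m))
    fun m m' h => hmono (update_le_update_iff.2 ⟨h, fun _ _ => le_rfl⟩)
  convert this using 5 with m
  · simp
  · refine congrArg (fun x => F x - _) (funext fun j => ?_)
    by_cases hj : j = i
    · subst hj; simp
    · simp [hj]

/-- A coordinate vanishes with probability `e^{-r}`, so forcing it to vanish costs at most the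
factor `e^r`. -/
theorem lintegral_update_zero_le {h : (ι → ℕ) → ℝ≥0∞} (hh : Measurable h) (i : ι) :
    ∫⁻ κ, h (Function.update κ i 0) ∂(Measure.infinitePi fun _ => poissonMeasure r) ≤
      ENNReal.ofReal (Real.exp r) *
        ∫⁻ κ, h κ ∂(Measure.infinitePi fun _ => poissonMeasure r) := by
  rw [lintegral_poisson_update r hh i, ← lintegral_const_mul' _ _ ENNReal.ofReal_ne_top]
  refine lintegral_mono fun κ => ?_
  rw [lintegral_poissonMeasure]
  refine le_trans ?_ (mul_le_mul_right (ENNReal.le_tsum 0) _)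
  rw [mul_left_comm, ← ENNReal.ofReal_mul (by positivity)]
  simp [← Real.exp_add]

/-- The numbers of points with those in `J` set to zero. -/
def zeroOn (J : Finset ι) (κ : ι → ℕ) : ι → ℕ := fun i => if i ∈ J then 0 else κ i

theorem zeroOn_empty (κ : ι → ℕ) : zeroOn ∅ κ = κ := by
  funext j
  simp [zeroOn]

theorem zeroOn_insert (i : ι) (J : Finset ι) (κ : ι → ℕ) :
    zeroOn (insert i J) κ = Function.update (zeroOn J κ) i 0 := by
  funext j
  by_cases hj : j = i
  · subst hj; simp [zeroOn]
  · simp [zeroOn, hj]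

theorem zeroOn_update (i : ι) (J : Finset ι) (κ : ι → ℕ) :
    zeroOn J (Function.update κ i 0) = Function.update (zeroOn J κ) i 0 := by
  funext j
  by_cases hj : j = i
  · subst hj; simp [zeroOn]
  · simp [zeroOn, hj]

theorem zeroOn_le (J : Finset ι) (κ : ι → ℕ) : zeroOn J κ ≤ κ := by
  intro i
  by_cases h : i ∈ J <;> simp [zeroOn, h]

theorem measurable_zeroOn (J : Finset ι) : Measurable (zeroOn J : (ι → ℕ) → ι → ℕ) := by
  refine measurable_pi_lambda _ fun i => ?_
  by_cases h : i ∈ J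
  · simp [zeroOn, h]
  · simpa [zeroOn, h] using measurable_pi_apply i

theorem lintegral_zeroOn_le {h : (ι → ℕ) → ℝ≥0∞} (hh : Measurable h) (J : Finset ι) :
    ∫⁻ κ, h (zeroOn J κ) ∂(Measure.infinitePi fun _ => poissonMeasure r) ≤
      ENNReal.ofReal (Real.exp r) ^ J.card *
        ∫⁻ κ, h κ ∂(Measure.infinitePi fun _ => poissonMeasure r) := by
  induction J using Finset.induction_on with
  | empty => simp [zeroOn_empty]
  | insert i J hi ih =>
    rw [Finset.card_insert_of_notMem hi, pow_succ', mul_assoc]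
    simp only [zeroOn_insert, ← zeroOn_update]
    exact (lintegral_update_zero_le r (hh.comp (measurable_zeroOn J)) i).trans
      (mul_le_mul_right ih _)

/-- The coordinates are emptied one by one. Each increment is evaluated at a configuration partly
emptied before; returning to the original law costs `e^r` per emptied coordinate. -/
theorem lintegral_sub_zeroOn_le {F : (ι → ℕ) → ℝ} (hF : Measurable F) (J : Finset ι) :
    ∫⁻ κ, ENNReal.ofReal (F κ - F (zeroOn J κ))
        ∂(Measure.infinitePi fun _ => poissonMeasure r) ≤
      ENNReal.ofReal (Real.exp r) ^ J.card * ∑ i ∈ J,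
        ∫⁻ κ, ENNReal.ofReal (F κ - F (Function.update κ i 0))
          ∂(Measure.infinitePi fun _ => poissonMeasure r) := by
  have h0 : ∀ i, Measurable fun κ : ι → ℕ => Function.update κ i 0 := fun i => by fun_prop
  have hone : 1 ≤ ENNReal.ofReal (Real.exp r) := by
    rw [ENNReal.one_le_ofReal]
    exact Real.one_le_exp r.2
  induction J using Finset.induction_on with
  | empty => simp [zeroOn_empty]
  | insert i J hi ih =>
    have hmi : Measurable fun κ : ι → ℕ => ENNReal.ofReal (F κ - F (Function.update κ i 0)) :=
      (hF.sub (hF.comp (h0 i))).ennreal_ofReal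
    calc ∫⁻ κ, ENNReal.ofReal (F κ - F (zeroOn (insert i J) κ))
          ∂(Measure.infinitePi fun _ => poissonMeasure r)
        ≤ ∫⁻ κ, (ENNReal.ofReal (F κ - F (zeroOn J κ)) +
          ENNReal.ofReal (F (zeroOn J κ) - F (Function.update (zeroOn J κ) i 0)))
          ∂(Measure.infinitePi fun _ => poissonMeasure r) := by
          refine lintegral_mono fun κ => ?_
          rw [zeroOn_insert]
          refine le_trans (ENNReal.ofReal_le_ofReal (le_of_eq ?_)) ENNReal.ofReal_add_le
          ring
      _ = _ := lintegral_add_left ((hF.sub (hF.comp (measurable_zeroOn J))).ennreal_ofReal) _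
      _ ≤ _ + _ := add_le_add ih (lintegral_zeroOn_le r hmi J)
      _ ≤ _ := by
          rw [← mul_add, Finset.sum_insert hi, add_comm (Finset.sum _ _),
            Finset.card_insert_of_notMem hi]
          gcongr
          · omega

end PoissonComparison

/-! ### Russo's formula for the Cox process -/

section Russo

variable {S : Type*} [MeasurableSpace S] {d : ℕ} (μ : Measure S) [IsProbabilityMeasure μ]

/-- The conditional probability of `A` given the numbers of points in the strips. -/
def condProb (A : Set (Sample d S)) (κ : Strip d → ℕ) : ℝ :=
  (markLaw d μ).real {m | assemble κ m ∈ A}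

/-- The expected increase of the conditional probability of `A` when a point is added to the
strip `a`. -/
def pivotal (A : Set (Sample d S)) (lam : ℝ) (a : Strip d) : ℝ :=
  ∫ κ, (condProb μ A (κ + Pi.single a 1) - condProb μ A κ) ∂(countLaw d lam)

/-- The sample with the strips in `J` made empty. -/
def emptyStrips (J : Finset (Strip d)) (ω : Sample d S) : Sample d S :=
  (fun k j => (if (k, j) ∈ J then 0 else (ω.1 k j).1, (ω.1 k j).2), ω.2)

theorem measurable_assemble :
    Measurable fun p : (Strip d → ℕ) × Marks d S => assemble p.1 p.2 :=
  by unfold assemble; fun_prop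

variable {A : Set (Sample d S)}

theorem measurable_condProb (hA : MeasurableSet A) : Measurable (condProb μ A) := by
  have := measurable_measure_prodMk_left (ν := markLaw d μ) (measurable_assemble hA)
  exact this.ennreal_toReal

theorem jointLaw_apply (hA : MeasurableSet A) (lam : ℝ) :
    jointLaw d μ lam A = ∫⁻ κ, (markLaw d μ) {m | assemble κ m ∈ A} ∂(countLaw d lam) := by
  rw [← (measurePreserving_assemble μ lam).measure_preimage hA.nullMeasurableSet,
    Measure.prod_apply (measurable_assemble hA)]
  rfl

theorem condProb_nonneg (κ : Strip d → ℕ) : 0 ≤ condProb μ A κ := measureReal_nonneg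

theorem condProb_le_one (κ : Strip d → ℕ) : condProb μ A κ ≤ 1 := measureReal_le_one

theorem jointLaw_real_eq (hA : MeasurableSet A) (lam : ℝ) :
    (jointLaw d μ lam).real A = ∫ κ, condProb μ A κ ∂(countLaw d lam) := by
  rw [Measure.real, jointLaw_apply μ hA, integral_eq_lintegral_of_nonneg_ae
    (ae_of_all _ (condProb_nonneg μ)) (measurable_condProb μ hA).aestronglyMeasurable]
  simp [condProb]

/-- The event `A` is preserved when points are added to strips. -/
def Increasing (A : Set (Sample d S)) : Prop :=
  ∀ κ ξ : Strip d → ℕ, κ ≤ ξ → ∀ m, assemble κ m ∈ A → assemble ξ m ∈ A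

/-- The event `A` depends on the numbers of points in the strips of `G` only. -/
def CountsIn (G : Finset (Strip d)) (A : Set (Sample d S)) : Prop :=
  ∀ κ ξ : Strip d → ℕ, (∀ a ∈ G, κ a = ξ a) → ∀ m, assemble κ m ∈ A → assemble ξ m ∈ A

theorem Increasing.monotone_condProb (hinc : Increasing A) : Monotone (condProb μ A) :=
  fun κ κ' h => measureReal_mono fun m hm => hinc κ κ' h m hm

theorem CountsIn.condProb_eq {G : Finset (Strip d)} (hG : CountsIn G A) {κ κ' : Strip d → ℕ}
    (h : ∀ a ∈ G, κ a = κ' a) : condProb μ A κ = condProb μ A κ' := by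
  unfold condProb
  congr 1
  ext m
  exact ⟨hG κ κ' h m, hG κ' κ (fun a ha => (h a ha).symm) m⟩

theorem pivotal_nonneg (hinc : Increasing A) (lam : ℝ) (a : Strip d) : 0 ≤ pivotal μ A lam a :=
  integral_nonneg fun κ => sub_nonneg.2 (hinc.monotone_condProb μ (by intro b; simp))

/-- Only the counts in `G` matter, so the infinite product may be replaced by a finite one, where
Russo's formula for Poisson variables applies. -/
theorem hasDerivAt_jointLaw_real (hA : MeasurableSet A) {G : Finset (Strip d)}
    (hG : CountsIn G A) {lam : ℝ} (hlam : 0 < lam) :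
    HasDerivAt (fun lam => (jointLaw d μ lam).real A) (∑ a ∈ G, pivotal μ A lam a) lam := by
  let ext : (G → ℕ) → Strip d → ℕ := fun k a => if h : a ∈ G then k ⟨a, h⟩ else 0
  have hext : ∀ κ, condProb μ A κ = condProb μ A (ext (G.restrict κ)) := fun κ =>
    hG.condProb_eq μ fun a ha => by simp [ext, ha]
  have hinteg : ∀ (H : (G → ℕ) → ℝ) (lam : ℝ),
      ∫ κ, H (G.restrict κ) ∂(countLaw d lam) = ∫ k, H k ∂(poissonPi G lam) := fun H lam =>
    integral_restrict_infinitePi _ (Measurable.of_discrete).aestronglyMeasurable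
  have h1 : (fun lam => (jointLaw d μ lam).real A) =
      fun lam => ∫ k, condProb μ A (ext k) ∂(poissonPi G lam) := by
    funext lam
    rw [jointLaw_real_eq μ hA, ← hinteg]
    simp only [← hext]
  rw [h1, ← Finset.sum_coe_sort]
  have h2 : ∀ a : G, pivotal μ A lam a =
      ∫ k, (condProb μ A (ext (k + Pi.single a 1)) - condProb μ A (ext k)) ∂(poissonPi G lam) := by
    intro a
    rw [← hinteg, pivotal]
    refine integral_congr_ae (ae_of_all _ fun κ => ?_)
    simp only [← hext]
    congr 1
    refine hG.condProb_eq μ fun b hb => ?_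
    simp only [Pi.add_apply, hb, dif_pos, Finset.restrict, ext]
    congr 1
    by_cases hab : b = a
    · subst hab; simp
    · rw [Pi.single_eq_of_ne hab, Pi.single_eq_of_ne]
      exact fun h => hab (congrArg Subtype.val h)
  simp only [h2]
  exact hasDerivAt_integral_poissonPi (c := 1) (fun k => by
    rw [abs_of_nonneg (condProb_nonneg μ _)]; exact condProb_le_one μ _) hlam

theorem ofReal_pivotal (hA : MeasurableSet A) (hinc : Increasing A) (lam : ℝ) (a : Strip d) :
    ENNReal.ofReal (pivotal μ A lam a) =
      ∫⁻ κ, ENNReal.ofReal (condProb μ A (κ + Pi.single a 1) - condProb μ A κ)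
        ∂(countLaw d lam) := by
  have h1 : Measurable fun κ : Strip d → ℕ => κ + Pi.single a 1 := by
    refine measurable_pi_lambda _ fun j => ?_
    exact (measurable_pi_apply j).add_const _
  have hm := measurable_condProb μ hA
  refine ofReal_integral_eq_lintegral_ofReal ?_ (ae_of_all _ fun κ =>
    sub_nonneg.2 (hinc.monotone_condProb μ (by intro b; simp)))
  refine Integrable.of_bound ((hm.comp h1).sub hm).aestronglyMeasurable 1 (ae_of_all _ fun κ => ?_)
  rw [Real.norm_eq_abs, abs_le]
  have := condProb_nonneg (A := A) μ κ
  have := condProb_le_one (A := A) μ κ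
  have := condProb_nonneg (A := A) μ (κ + Pi.single a 1)
  have := condProb_le_one (A := A) μ (κ + Pi.single a 1)
  constructor <;> linarith

theorem measurable_emptyStrips (J : Finset (Strip d)) :
    Measurable (emptyStrips J : Sample d S → Sample d S) := by
  refine Measurable.prodMk (measurable_pi_lambda _ fun k => measurable_pi_lambda _ fun j => ?_)
    measurable_snd
  by_cases h : (k, j) ∈ J
  · simp only [h, if_true]; fun_prop
  · simp only [h, if_false]; fun_prop

theorem measurableSet_and_emptyStrips (hA : MeasurableSet A) (J : Finset (Strip d)) :
    MeasurableSet {ω : Sample d S | ω ∈ A ∧ emptyStrips J ω ∉ A} :=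
  hA.inter (measurable_emptyStrips J hA).compl

/-- The probability that `A` is destroyed when the strips in `J` are made empty is bounded by the
pivotality of these strips. -/
theorem measure_emptyStrips_le (hA : MeasurableSet A) (hinc : Increasing A) {lam : ℝ}
    (hlam : 0 ≤ lam) (J : Finset (Strip d)) :
    jointLaw d μ lam {ω | ω ∈ A ∧ emptyStrips J ω ∉ A} ≤
      ENNReal.ofReal (Real.exp lam) ^ (J.card + 1) *
        ∑ a ∈ J, ENNReal.ofReal (pivotal μ A lam a) := by
  have hm := measurableSet_and_emptyStrips hA J
  have hF := measurable_condProb μ hA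
  have hmono := hinc.monotone_condProb μ
  have hr : ((lam.toNNReal : ℝ≥0) : ℝ) = lam := Real.coe_toNNReal _ hlam
  rw [jointLaw_apply μ hm]
  -- Given the counts, emptying `J` replaces `κ` by `zeroOn J κ`. The two events are nested because
  -- `A` is increasing, so the probability is a difference.
  have h1 : ∀ κ, (markLaw d μ) {m | assemble κ m ∈ {ω : Sample d S | ω ∈ A ∧
      emptyStrips J ω ∉ A}} = ENNReal.ofReal (condProb μ A κ - condProb μ A (zeroOn J κ)) := by
    intro κ
    have hsub : {m | assemble (zeroOn J κ) m ∈ A} ⊆ {m : Marks d S | assemble κ m ∈ A} :=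
      fun m hm => hinc _ _ (zeroOn_le J κ) m hm
    have hms : MeasurableSet {m : Marks d S | assemble (zeroOn J κ) m ∈ A} :=
      (measurable_assemble.comp (measurable_prodMk_left (x := zeroOn J κ))) hA
    have : {m | assemble κ m ∈ {ω : Sample d S | ω ∈ A ∧ emptyStrips J ω ∉ A}} =
        {m : Marks d S | assemble κ m ∈ A} \ {m | assemble (zeroOn J κ) m ∈ A} := rfl
    rw [this, condProb, condProb, ← measureReal_sdiff hsub hms, ofReal_measureReal]
  simp only [h1]
  refine (lintegral_sub_zeroOn_le lam.toNNReal hF J).trans ?_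
  rw [hr, pow_succ, mul_assoc, Finset.mul_sum (a := ENNReal.ofReal (Real.exp lam))]
  refine mul_le_mul_right (Finset.sum_le_sum fun a _ => ?_) _
  rw [ofReal_pivotal μ hA hinc]
  have := lintegral_sub_update_zero_le lam.toNNReal hF hmono a
  rwa [hr] at this

end Russo

/-! ### Geometry -/

section Geometry

variable {d : ℕ}

/-- The norm `|p|_∞`. -/
def supNorm (p : Space d) : ℝ := ‖WithLp.ofLp p‖

theorem continuous_supNorm : Continuous (supNorm : Space d → ℝ) :=
  continuous_norm.comp (PiLp.continuous_ofLp 2 _)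

theorem abs_apply_le_supNorm (p : Space d) (i : Fin d) : |p i| ≤ supNorm p :=
  norm_le_pi_norm (WithLp.ofLp p) i

theorem mem_box_iff {r : ℝ} (hr : 0 ≤ r) {p : Space d} : p ∈ box d r ↔ supNorm p ≤ r := by
  rw [supNorm, pi_norm_le_iff_of_nonneg hr]
  rfl

theorem supNorm_sub_le (p q : Space d) : supNorm p ≤ supNorm (p - q) + supNorm q := by
  have : WithLp.ofLp p = WithLp.ofLp (p - q) + WithLp.ofLp q := by simp
  unfold supNorm
  rw [this]
  exact norm_add_le _ _

theorem supNorm_sub_comm (p q : Space d) : supNorm (p - q) = supNorm (q - p) := by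
  unfold supNorm
  rw [WithLp.ofLp_sub, WithLp.ofLp_sub, norm_sub_rev]

theorem abs_sub_apply_le_dist (p q : Space d) (i : Fin d) : |p i - q i| ≤ dist p q := by
  rw [dist_eq_norm]
  exact PiLp.norm_apply_le (p - q) i

/-- A path from below a level of `h` to above it hits the level, and before that stays below. -/
theorem exists_joinedIn_level {E : Type*} [TopologicalSpace E] {U : Set E} {a b : E}
    (hab : JoinedIn U a b) {h : E → ℝ} (hh : Continuous h) {v : ℝ} (ha : h a ≤ v) (hb : v ≤ h b) :
    ∃ c, h c = v ∧ JoinedIn (U ∩ {x | h x ≤ v}) a c ∧ JoinedIn U c b := by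
  obtain ⟨γ, hγ⟩ := hab
  have hcont : Continuous fun t : ℝ => h (γ.extend t) := hh.comp γ.continuous_extend
  have hmem : ∀ t, γ.extend t ∈ U := fun t => by
    have : γ.extend t ∈ Set.range γ := by
      rw [← γ.extend_range]; exact Set.mem_range_self t
    obtain ⟨s, hs⟩ := this
    exact hs ▸ hγ s
  have hcpt : IsCompact (Set.Icc (0 : ℝ) 1 ∩ {t | v ≤ h (γ.extend t)}) :=
    isCompact_Icc.inter_right (isClosed_le continuous_const hcont)
  -- The first time at which the level is reached; by minimality and the intermediate value theorem
  -- the path stays below the level until then.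
  obtain ⟨t, ⟨ht, htv⟩, hmin⟩ := hcpt.exists_isLeast ⟨1, by simp, by simpa using hb⟩
  have htv : v ≤ h (γ.extend t) := htv
  have hlow : ∀ s ∈ Set.Icc 0 t, h (γ.extend s) ≤ v := by
    intro s hs
    by_contra hcon
    push Not at hcon
    have hIVT := intermediate_value_Icc hs.1 (hcont.continuousOn (s := Set.Icc 0 s))
    obtain ⟨u, hu, huv⟩ := hIVT ⟨by simpa using ha, hcon.le⟩
    have huv : h (γ.extend u) = v := huv
    have : t ≤ u := hmin ⟨⟨hu.1, hu.2.trans (hs.2.trans ht.2)⟩, huv.ge⟩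
    have hsu : s = u := le_antisymm (hs.2.trans this) hu.2
    rw [hsu] at hcon
    exact absurd huv hcon.ne'
  refine ⟨γ.extend t, le_antisymm (hlow t ⟨ht.1, le_rfl⟩) htv, ?_, ?_⟩
  · have hpc : IsPathConnected (γ.extend '' Set.Icc 0 t) :=
      ((convex_Icc 0 t).isPathConnected ⟨0, le_rfl, ht.1⟩).image γ.continuous_extend
    refine (hpc.joinedIn _ ⟨0, ⟨le_rfl, ht.1⟩, γ.extend_zero⟩ _ ⟨t, ⟨ht.1, le_rfl⟩, rfl⟩).mono ?_
    rintro _ ⟨s, hs, rfl⟩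
    exact ⟨hmem s, hlow s hs⟩
  · have hpc : IsPathConnected (γ.extend '' Set.Icc t 1) :=
      ((convex_Icc t 1).isPathConnected ⟨1, ht.2, le_rfl⟩).image γ.continuous_extend
    refine (hpc.joinedIn _ ⟨t, ⟨le_rfl, ht.2⟩, rfl⟩ _ ⟨1, ⟨ht.2, le_rfl⟩, γ.extend_one⟩).mono ?_
    rintro _ ⟨s, hs, rfl⟩
    exact hmem s

/-- The union of the balls of radius `1/2` centred at `X`. -/
def ballUnion (X : Set (Space d)) : Set (Space d) := ⋃ x ∈ X, Metric.ball x (1 / 2)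

theorem mem_ballUnion {X : Set (Space d)} {p : Space d} :
    p ∈ ballUnion X ↔ ∃ x ∈ X, p ∈ Metric.ball x (1 / 2) := by
  simp [ballUnion]

theorem isOpen_ballUnion (X : Set (Space d)) : IsOpen (ballUnion X) :=
  isOpen_biUnion fun _ _ => Metric.isOpen_ball

theorem ballUnion_mono {X X' : Set (Space d)} (h : X ⊆ X') : ballUnion X ⊆ ballUnion X' :=
  Set.biUnion_subset_biUnion_left h

theorem joinedIn_ballUnion_of_mem {X : Set (Space d)} {x p q : Space d} (hx : x ∈ X)
    (hp : p ∈ Metric.ball x (1 / 2)) (hq : q ∈ Metric.ball x (1 / 2)) :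
    JoinedIn (ballUnion X) p q :=
  (((convex_ball x (1 / 2)).isPathConnected ⟨p, hp⟩).joinedIn p hp q hq).mono
    fun _ hr => mem_ballUnion.2 ⟨x, hx, hr⟩

theorem Connects.mono {X X' A A' B B' : Set (Space d)} (h : Connects X A B) (hX : X ⊆ X')
    (hA : A ⊆ A') (hB : B ⊆ B') : Connects X' A' B' := by
  obtain ⟨a, ha, b, hb, hab⟩ := h
  exact ⟨a, hA ha, b, hB hb, hab.mono (ballUnion_mono hX)⟩

/-- A connected part of a union of balls that meets an open set which absorbs the balls it meets
lies in the open set. -/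
theorem subset_of_balls_absorbed {X : Set (Space d)} {s K : Set (Space d)} (hs : IsPreconnected s)
    (hsX : s ⊆ ballUnion X) (hK : IsOpen K) (hne : (s ∩ K).Nonempty)
    (habs : ∀ x ∈ X, (Metric.ball x (1 / 2) ∩ K).Nonempty → Metric.ball x (1 / 2) ⊆ K) :
    s ⊆ K := by
  refine hs.subset_of_closure_inter_subset hK hne ?_
  rintro q ⟨hqK, hqs⟩
  obtain ⟨x, hx, hqx⟩ := mem_ballUnion.1 (hsX hqs)
  exact habs x hx (mem_closure_iff.1 hqK _ Metric.isOpen_ball hqx) hqx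

theorem joinedIn_exists_preconnected {U : Set (Space d)} {a b : Space d} (h : JoinedIn U a b) :
    ∃ s ⊆ U, IsPreconnected s ∧ a ∈ s ∧ b ∈ s := by
  obtain ⟨γ, hγ⟩ := h
  refine ⟨Set.range γ, ?_, isPreconnected_range γ.continuous, ⟨0, γ.source⟩, ⟨1, γ.target⟩⟩
  rintro _ ⟨t, rfl⟩
  exact hγ t

/-- Connections in the union of balls in terms of chains of intersecting balls. -/
theorem connects_iff_chain {T : Type*} (p : T → Space d) (Q : Set T) (A B : Set (Space d)) :
    Connects (p '' Q) A B ↔ ∃ t t', t ∈ Q ∧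
      Relation.ReflTransGen (fun u v => v ∈ Q ∧ dist (p u) (p v) < 1) t t' ∧
      p t ∈ Metric.thickening (1 / 2) A ∧ p t' ∈ Metric.thickening (1 / 2) B := by
  simp only [Metric.mem_thickening_iff]
  constructor
  · rintro ⟨a, ha, b, hb, hab⟩
    obtain ⟨s, hsU, hs, has, hbs⟩ := joinedIn_exists_preconnected hab
    obtain ⟨_, ⟨t, ht, rfl⟩, hat⟩ := mem_ballUnion.1 (hsU has)
    let K : Set (Space d) := ⋃ u ∈ {u | Relation.ReflTransGen
      (fun u v => v ∈ Q ∧ dist (p u) (p v) < 1) t u}, Metric.ball (p u) (1 / 2)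
    have hsK : s ⊆ K := by
      refine subset_of_balls_absorbed hs hsU (isOpen_biUnion fun _ _ => Metric.isOpen_ball)
        ⟨a, has, Set.mem_biUnion (show t ∈ {u | _} from Relation.ReflTransGen.refl) hat⟩ ?_
      rintro _ ⟨v, hv, rfl⟩ ⟨q, hqv, hqK⟩
      simp only [K, Set.mem_iUnion, exists_prop] at hqK
      obtain ⟨u, hu, hqu⟩ := hqK
      refine Set.subset_biUnion_of_mem (u := fun u => Metric.ball (p u) (1 / 2))
        (show v ∈ {u | _} from Relation.ReflTransGen.tail hu ⟨hv, ?_⟩)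
      have h1 : dist q (p u) < 1 / 2 := hqu
      have h2 : dist q (p v) < 1 / 2 := hqv
      have := dist_triangle_left (p u) (p v) q
      linarith
    have hbK := hsK hbs
    simp only [K, Set.mem_iUnion, exists_prop] at hbK
    obtain ⟨u, hu, hbu⟩ := hbK
    exact ⟨t, u, ht, hu, ⟨a, ha, by rw [dist_comm]; exact hat⟩,
      ⟨b, hb, by rw [dist_comm]; exact hbu⟩⟩
  · rintro ⟨t, t', ht, hchain, ⟨a, ha, hat⟩, ⟨b, hb, hbt⟩⟩
    have hcen : ∀ u, Relation.ReflTransGen (fun u v => v ∈ Q ∧ dist (p u) (p v) < 1) t u →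
        u ∈ Q ∧ JoinedIn (ballUnion (p '' Q)) (p t) (p u) := by
      intro u hu
      induction hu with
      | refl =>
        exact ⟨ht, joinedIn_ballUnion_of_mem ⟨t, ht, rfl⟩ (by simp) (by simp)⟩
      | tail _ hv ih =>
        rename_i u v _
        refine ⟨hv.1, ih.2.trans ?_⟩
        have hu1 : midpoint ℝ (p u) (p v) ∈ Metric.ball (p u) (1 / 2) := by
          rw [Metric.mem_ball, dist_midpoint_left]
          norm_num
          linarith [hv.2]
        have hv1 : midpoint ℝ (p u) (p v) ∈ Metric.ball (p v) (1 / 2) := by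
          rw [Metric.mem_ball, dist_midpoint_right]
          norm_num
          linarith [hv.2]
        exact (joinedIn_ballUnion_of_mem (X := p '' Q) ⟨u, ih.1, rfl⟩ (by simp) hu1).trans
          (joinedIn_ballUnion_of_mem (X := p '' Q) ⟨v, hv.1, rfl⟩ hv1 (by simp))
    obtain ⟨ht', hj⟩ := hcen t' hchain
    refine ⟨a, ha, b, hb, ?_⟩
    exact ((joinedIn_ballUnion_of_mem (X := p '' Q) ⟨t, ht, rfl⟩
      (by rw [Metric.mem_ball, dist_comm]; exact hat) (by simp)).trans hj).trans (joinedIn_ballUnion_of_mem (X := p '' Q) ⟨t', ht', rfl⟩ (by simp)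
      (by rw [Metric.mem_ball, dist_comm]; exact hbt))

theorem measurableSet_reflTransGen {Ω T : Type*} [MeasurableSpace Ω] [Countable T]
    {r : Ω → T → T → Prop} (hr : ∀ u v, MeasurableSet {ω | r ω u v}) (t t' : T) :
    MeasurableSet {ω | Relation.ReflTransGen (r ω) t t'} := by
  let step : ℕ → T → Set Ω := fun n => n.rec (fun u => {_ω | u = t})
    fun _ S u => ⋃ v, S v ∩ {ω | r ω v u}
  have hstep : ∀ n u, MeasurableSet (step n u) := by
    intro n
    induction n with
    | zero => exact fun u => MeasurableSet.const _
    | succ n ih => exact fun u => MeasurableSet.iUnion fun v => (ih v).inter (hr v u)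
  have : {ω | Relation.ReflTransGen (r ω) t t'} = ⋃ n, step n t' := by
    ext ω
    simp only [Set.mem_ofPred_eq, Set.mem_iUnion]
    constructor
    · intro h
      induction h with
      | refl => exact ⟨0, rfl⟩
      | tail _ hv ih =>
        obtain ⟨n, hn⟩ := ih
        exact ⟨n + 1, Set.mem_iUnion.2 ⟨_, hn, hv⟩⟩
    · rintro ⟨n, hn⟩
      induction n generalizing t' with
      | zero =>
        have : t' = t := hn
        exact this ▸ Relation.ReflTransGen.refl
      | succ n ih =>
        obtain ⟨v, hv, hvr⟩ := Set.mem_iUnion.1 hn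
        exact (ih v hv).tail hvr
  rw [this]
  exact MeasurableSet.iUnion fun n => hstep n t'

/-- Chains of centres reduce a path to countably many conditions. The sets `A` and `B` enter through
open thickenings only, so they may be arbitrary. -/
theorem measurableSet_connects {Ω T : Type*} [MeasurableSpace Ω] [Countable T]
    {p : Ω → T → Space d} (hp : ∀ t, Measurable fun ω => p ω t) {Q : Ω → Set T}
    (hQ : ∀ t, MeasurableSet {ω | t ∈ Q ω}) (A B : Set (Space d)) :
    MeasurableSet {ω | Connects (p ω '' Q ω) A B} := by
  simp only [connects_iff_chain]
  have : {ω | ∃ t t', t ∈ Q ω ∧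
      Relation.ReflTransGen (fun u v => v ∈ Q ω ∧ dist (p ω u) (p ω v) < 1) t t' ∧
      p ω t ∈ Metric.thickening (1 / 2) A ∧ p ω t' ∈ Metric.thickening (1 / 2) B} =
      ⋃ t, ⋃ t', {ω | t ∈ Q ω} ∩ ({ω | Relation.ReflTransGen
        (fun u v => v ∈ Q ω ∧ dist (p ω u) (p ω v) < 1) t t'} ∩
        ({ω | p ω t ∈ Metric.thickening (1 / 2) A} ∩
          {ω | p ω t' ∈ Metric.thickening (1 / 2) B})) := by
    ext ω
    simp
  rw [this]
  refine MeasurableSet.iUnion fun t => MeasurableSet.iUnion fun t' => (hQ t).inter ?_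
  refine (measurableSet_reflTransGen (fun u v => (hQ v).inter ?_) t t').inter ?_
  · exact measurableSet_lt ((hp u).dist (hp v)) measurable_const
  · exact (hp t Metric.isOpen_thickening.measurableSet).inter
      (hp t' Metric.isOpen_thickening.measurableSet)

/-- The box `M z + Λ_{3M}`. -/
def siteBox (M : ℝ) (z : Lattice d) : Set (Space d) := {p | p - coarsePoint M z ∈ box d (3 * M)}

theorem mem_annulus_iff {M : ℝ} (hM : 1 ≤ M) {k : ℕ} (hk : 2 ≤ k) {p : Space d} :
    p ∈ annulus d M (M * k) ↔ M * (k - 2) < supNorm p ∧ supNorm p ≤ M * (k - 1) := by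
  have hk' : (2 : ℝ) ≤ k := by exact_mod_cast hk
  have h1 : M * k - M = M * (k - 1) := by ring
  have h2 : M * k - 2 * M = M * (k - 2) := by ring
  rw [annulus, h1, h2, Set.mem_sdiff, mem_box_iff (by nlinarith), mem_box_iff (by nlinarith),
    not_le, and_comm]

/-- A connection from `Λ_{3M}` to the outside of `Λ_{M(k-2)}` can be shortened to one to the
annulus `∂Λ_{Mk}` inside `Λ_{M(k-1)}`. -/
theorem exists_joinedIn_annulus {M : ℝ} (hM : 1 ≤ M) {k : ℕ} (hk : 5 ≤ k) {U : Set (Space d)}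
    {a b : Space d} (ha : a ∈ box d (3 * M)) (hb : M * (k - 2) < supNorm b)
    (hab : JoinedIn U a b) :
    ∃ c ∈ annulus d M (M * k), JoinedIn (U ∩ {x | supNorm x ≤ M * (k - 1)}) a c ∧
      JoinedIn U c b := by
  have hk' : (5 : ℝ) ≤ k := by exact_mod_cast hk
  have ha' : supNorm a ≤ 3 * M := (mem_box_iff (by linarith)).1 ha
  obtain ⟨c, hc, hac, hcb⟩ := exists_joinedIn_level hab continuous_supNorm
    -- The end point may lie inside the annulus already, hence the minimum. For `k ≥ 5` the start
    -- satisfies `3 * M ≤ M * (k - 2)`, so it lies below the level.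
    (v := min (M * (k - 1)) (supNorm b))
    (ha'.trans (le_min (by nlinarith) (by nlinarith))) (min_le_right _ _)
  refine ⟨c, (mem_annulus_iff hM (by omega)).2 ⟨?_, ?_⟩, hac.mono ?_, hcb⟩
  · rw [hc]
    exact lt_min (by nlinarith) hb
  · rw [hc]
    exact min_le_left _ _
  · exact Set.inter_subset_inter_right _ fun x (hx : supNorm x ≤ _) =>
      show supNorm x ≤ _ from hx.trans (min_le_left _ _)

end Geometry

/-! ### The points of the Cox process -/

section Sites

variable {d : ℕ}

/-- The coarse site `z` with `k ∈ I_b(z)`. -/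
def coarseSite (N : ℕ) (k : Lattice d) : Lattice d := fun i => k i / N

theorem mul_coarseSite_le {N : ℕ} (hN : 0 < N) (k : Lattice d) (i : Fin d) :
    (N : ℤ) * coarseSite N k i ≤ k i := Int.mul_ediv_self_le (by positivity)

theorem lt_mul_coarseSite_add_one {N : ℕ} (hN : 0 < N) (k : Lattice d) (i : Fin d) :
    k i < (N : ℤ) * (coarseSite N k i + 1) := by
  have := Int.lt_ediv_add_one_mul_self (k i) (show (0 : ℤ) < N by positivity)
  rw [mul_comm]
  exact this

theorem mem_fineSites_coarseSite {N : ℕ} (hN : 0 < N) (k : Lattice d) :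
    k ∈ fineSites N 0 (coarseSite N k) := fun i => by
  simpa using ⟨mul_coarseSite_le hN k i, lt_mul_coarseSite_add_one hN k i⟩

theorem corner_add (M : ℝ) {N : ℕ} (hN : 0 < N) (k z₀ : Lattice d) :
    corner N M (k + (N : ℤ) • z₀) = corner N M k + coarsePoint M z₀ := by
  have : (N : ℝ) ≠ 0 := by positivity
  ext i
  simp only [corner, coarsePoint, PiLp.add_apply, Pi.add_apply, Pi.smul_apply, smul_eq_mul,
    Int.cast_add, Int.cast_mul, Int.cast_natCast]
  field_simp

theorem measurableSet_cell (N : ℕ) (M : ℝ) : MeasurableSet (cell d N M) := by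
  have : cell d N M = ⋂ i : Fin d, {p : Space d | 0 ≤ p i ∧ p i ≤ M * (1 / (N : ℝ))} := by
    ext p
    simp [cell]
  rw [this]
  refine MeasurableSet.iInter fun i => ?_
  have hi : Measurable fun p : Space d => p i := (by fun_prop : Continuous _).measurable
  exact (measurableSet_le measurable_const hi).inter (measurableSet_le hi measurable_const)

end Sites

/-! ### Positions, measurability, translations and visible points -/

namespace Environment

variable {d N : ℕ} {M : ℝ} {S : Type*} [MeasurableSpace S] (E : Environment d N M S)
  (Γ : cell d N M ≃ᵐ unitInterval)

/-- The position `M x + Γ⁻¹(Φ_x⁻¹(v))`. -/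
def position (k : Lattice d) (y : Lattice d → S) (v : unitInterval) : Space d :=
  corner N M k + (Γ.symm ⟨E.quantile Γ k y v, E.quantile_mem Γ k y v⟩ : Space d)

theorem position_congr {k : Lattice d} {y y' : Lattice d → S} (h : E.Q k y = E.Q k y')
    (v : unitInterval) : E.position Γ k y v = E.position Γ k y' v := by
  have : E.quantile Γ k y v = E.quantile Γ k y' v := by simp only [quantile, cdf, h]
  simp only [position, this]

theorem cdf_translate (hN : 0 < N) (k z₀ : Lattice d) (y : Lattice d → S) (t : ℝ) :
    E.cdf Γ (k + (N : ℤ) • z₀) y t = E.cdf Γ k (fun z => y (z + z₀)) t := by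
  unfold cdf
  rw [E.Q_translate, Measure.real, Measure.real]
  congr 1
  have hemb : MeasurableEmbedding fun p : Space d => p + coarsePoint M z₀ :=
    (MeasurableEquiv.addRight (coarsePoint M z₀)).measurableEmbedding
  rw [hemb.map_apply]
  congr 1
  ext p
  have h : p + coarsePoint M z₀ - corner N M (k + (N : ℤ) • z₀) = p - corner N M k := by
    rw [corner_add M hN]; abel
  simp only [Set.mem_preimage, Set.mem_ofPred_eq, h]

theorem position_translate (hN : 0 < N) (k z₀ : Lattice d) (y : Lattice d → S)
    (v : unitInterval) :
    E.position Γ (k + (N : ℤ) • z₀) y v =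
      E.position Γ k (fun z => y (z + z₀)) v + coarsePoint M z₀ := by
  have : E.quantile Γ (k + (N : ℤ) • z₀) y v = E.quantile Γ k (fun z => y (z + z₀)) v := by
    simp only [quantile, E.cdf_translate Γ hN]
  simp only [position, this, corner_add M hN]
  abel

theorem position_sub_mem (k : Lattice d) (y : Lattice d → S) (v : unitInterval) :
    E.position Γ k y v - corner N M k ∈ cell d N M := by
  simp only [position, add_sub_cancel_left]
  exact Subtype.coe_prop _

theorem cdf_mono (k : Lattice d) (y : Lattice d → S) : Monotone (E.cdf Γ k y) := by
  intro t t' h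
  have := E.isMarkov_Q k
  exact measureReal_mono fun p ⟨hp, hpt⟩ => ⟨hp, hpt.trans h⟩

theorem measurable_cdf (k : Lattice d) (t : ℝ) : Measurable fun y => E.cdf Γ k y t := by
  have hset : MeasurableSet {p : Space d | ∃ h : p - corner N M k ∈ cell d N M,
      (Γ ⟨p - corner N M k, h⟩ : ℝ) ≤ t} := by
    have : {p : Space d | ∃ h : p - corner N M k ∈ cell d N M,
        (Γ ⟨p - corner N M k, h⟩ : ℝ) ≤ t} =
        (fun p => p - corner N M k) ⁻¹' (Subtype.val '' {c : cell d N M | (Γ c : ℝ) ≤ t}) := by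
      ext p
      simp
    rw [this]
    refine (measurable_id.sub_const _) ((measurableSet_cell N M).subtype_image ?_)
    exact measurableSet_le (measurable_subtype_coe.comp Γ.measurable) measurable_const
  exact ((E.Q k).measurable_coe hset).ennreal_toReal

/-- By monotonicity of the distribution function, the quantile at `v` is below `t` exactly if some
rational `s` in `[0, t)` satisfies `v ≤ Φ(s)`. Right-continuity plays no role. -/
theorem measurable_quantile (k : Lattice d) :
    Measurable fun q : (Lattice d → S) × unitInterval => E.quantile Γ k q.1 q.2 := by
  refine measurable_of_Iio fun t => ?_
  have : (fun q : (Lattice d → S) × unitInterval => E.quantile Γ k q.1 q.2) ⁻¹' Set.Iio t =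
      ⋃ s : ℚ, {q | ((0 : ℝ) ≤ s ∧ (s : ℝ) < t) ∧ (q.2 : ℝ) ≤ E.cdf Γ k q.1 s} := by
    ext ⟨y, v⟩
    simp only [Set.mem_preimage, Set.mem_Iio, Set.mem_iUnion, Set.mem_ofPred_eq]
    constructor
    · intro h
      -- The real infimum of the empty set is `0` by convention; the value `Φ(1) = 1` rules this
      -- case out.
      have hne : {t : ℝ | 0 ≤ t ∧ (v : ℝ) ≤ E.cdf Γ k y t}.Nonempty := by
        by_contra hcon
        rw [Set.not_nonempty_iff_eq_empty] at hcon
        have h1 : E.cdf Γ k y 1 = 1 := by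
          have := E.isMarkov_Q k
          have hset : {p | ∃ h : p - corner N M k ∈ cell d N M,
              (Γ ⟨p - corner N M k, h⟩ : ℝ) ≤ 1} = {p | p - corner N M k ∈ cell d N M} := by
            ext p
            exact ⟨fun ⟨h, _⟩ => h, fun h => ⟨h, (Γ _).2.2⟩⟩
          rw [cdf, hset, Measure.real, measure_of_measure_compl_eq_zero (E.Q_cell k y),
            measure_univ]
          simp
        have : (1 : ℝ) ∈ {t : ℝ | 0 ≤ t ∧ (v : ℝ) ≤ E.cdf Γ k y t} :=
          ⟨zero_le_one, by rw [h1]; exact v.2.2⟩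
        rw [hcon] at this
        exact this
      obtain ⟨s, ⟨hs0, hsv⟩, hst⟩ := exists_lt_of_csInf_lt hne h
      obtain ⟨r, hr1, hr2⟩ := exists_rat_btwn hst
      exact ⟨r, ⟨hs0.trans hr1.le, hr2⟩, hsv.trans (E.cdf_mono Γ k y hr1.le)⟩
    · rintro ⟨s, ⟨hs0, hst⟩, hsv⟩
      exact (csInf_le (s := {t : ℝ | 0 ≤ t ∧ (v : ℝ) ≤ E.cdf Γ k y t}) ⟨0, fun _ ht => ht.1⟩
        ⟨hs0, hsv⟩).trans_lt hst
  rw [this]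
  refine MeasurableSet.iUnion fun s => (MeasurableSet.const _).inter ?_
  exact measurableSet_le (measurable_subtype_coe.comp measurable_snd)
    ((E.measurable_cdf Γ k s).comp measurable_fst)

theorem measurable_position (k : Lattice d) :
    Measurable fun q : (Lattice d → S) × unitInterval => E.position Γ k q.1 q.2 := by
  refine Measurable.const_add ?_ _
  exact measurable_subtype_coe.comp (Γ.symm.measurable.comp
    ((E.measurable_quantile Γ k).subtype_mk))

/-- The index `(k, j, i)` of a point, the point number `i` of the strip `j` of `V_k`, and its
position in the sample `ω`. -/
def indexedPoint (ω : Sample d S) (t : Lattice d × ℕ × ℕ) : Space d :=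
  E.position Γ t.1 ω.2 ((ω.1 t.1 t.2.1).2 t.2.2).1

/-- The height of a point. -/
def height (ω : Sample d S) (t : Lattice d × ℕ × ℕ) : ℝ :=
  t.2.1 + (((ω.1 t.1 t.2.1).2 t.2.2).2 : ℝ)

/-- The indices of the points of the Cox process. -/
def presentPoints (ω : Sample d S) : Set (Lattice d × ℕ × ℕ) :=
  {t | t.2.2 < (ω.1 t.1 t.2.1).1 ∧ height ω t ≤ E.U t.1 ω.2}

/-- Labelling the points by a countable index set is what makes the chain description of connections
measurable. -/
theorem coxPoints_eq (ω : Sample d S) :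
    E.coxPoints Γ ω = E.indexedPoint Γ ω '' E.presentPoints ω := by
  ext p
  simp only [coxPoints, cellPoints, PointConfig.points, Set.mem_iUnion, Set.mem_ofPred_eq,
    Set.mem_image, presentPoints, height, indexedPoint, Prod.exists]
  constructor
  · rintro ⟨k, v, u, ⟨j, i, hi, hq⟩, hU, rfl⟩
    obtain ⟨rfl, rfl⟩ := Prod.ext_iff.1 hq
    exact ⟨k, j, i, ⟨hi, hU⟩, rfl⟩
  · rintro ⟨k, j, i, ⟨hi, hU⟩, rfl⟩
    exact ⟨k, _, _, ⟨j, i, hi, rfl⟩, hU, rfl⟩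

theorem measurable_indexedPoint (t : Lattice d × ℕ × ℕ) :
    Measurable fun ω : Sample d S => E.indexedPoint Γ ω t := by
  obtain ⟨k, j, i⟩ := t
  have h1 : Measurable fun ω : Sample d S => ((ω.1 k j).2 i).1 := by fun_prop
  have h2 : Measurable fun ω : Sample d S => (ω.2, ((ω.1 k j).2 i).1) := measurable_snd.prodMk h1
  have h3 := (E.measurable_position Γ k).comp h2
  simpa only [indexedPoint, Function.comp_def] using h3

theorem measurable_height (t : Lattice d × ℕ × ℕ) :
    Measurable fun ω : Sample d S => height ω t := by
  unfold height
  fun_prop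

theorem measurableSet_presentPoints (t : Lattice d × ℕ × ℕ) :
    MeasurableSet {ω : Sample d S | t ∈ E.presentPoints ω} := by
  have : Measurable fun ω : Sample d S => (ω.1 t.1 t.2.1).1 := by fun_prop
  exact (measurableSet_lt measurable_const this).inter (measurableSet_le (measurable_height t)
    ((E.measurable_U t.1).comp measurable_snd).coe_nnreal_real)

theorem measurableSet_connects_coxPoints (A B : Set (Space d)) :
    MeasurableSet {ω : Sample d S | Connects (E.coxPoints Γ ω) A B} := by
  simp only [coxPoints_eq]
  exact measurableSet_connects (E.measurable_indexedPoint Γ) E.measurableSet_presentPoints A B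

theorem coxPoints_shift (hN : 0 < N) (z₀ : Lattice d) (ω : Sample d S) :
    E.coxPoints Γ ω = (fun p => p + coarsePoint M z₀) '' E.coxPoints Γ (shift N z₀ ω) := by
  rw [coxPoints_eq, coxPoints_eq, Set.image_image]
  have hpos : ∀ t : Lattice d × ℕ × ℕ, E.indexedPoint Γ (shift N z₀ ω) t + coarsePoint M z₀ =
      E.indexedPoint Γ ω (t.1 + (N : ℤ) • z₀, t.2) := fun t =>
    (E.position_translate Γ hN t.1 z₀ ω.2 _).symm
  have hpres : ∀ t : Lattice d × ℕ × ℕ, t ∈ E.presentPoints (shift N z₀ ω) ↔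
      (t.1 + (N : ℤ) • z₀, t.2) ∈ E.presentPoints ω := by
    intro t
    simp only [presentPoints, height, shift, Set.mem_ofPred_eq, E.U_translate]
  ext p
  constructor
  · rintro ⟨t, ht, rfl⟩
    refine ⟨(t.1 - (N : ℤ) • z₀, t.2), (hpres _).2 (by simpa using ht), ?_⟩
    simp only [hpos, sub_add_cancel]
  · rintro ⟨t, ht, rfl⟩
    exact ⟨_, (hpres t).1 ht, (hpos t).symm⟩

/-- The indices of the points that can be computed from the coordinates in `R`. -/
def visiblePoints (R : Set (Coord d)) (ω : Sample d S) : Set (Lattice d × ℕ × ℕ) :=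
  {t | (Sum.inl (t.1, t.2.1) ∈ R ∧ ∀ w ∈ coarseNeighbors (coarseSite N t.1), Sum.inr w ∈ R) ∧
    0 < E.U t.1 ω.2 ∧ t ∈ E.presentPoints ω}

/-- The points of the Cox process that can be computed from the coordinates in `R`. -/
def visible (R : Set (Coord d)) (ω : Sample d S) : Set (Space d) :=
  E.indexedPoint Γ ω '' E.visiblePoints R ω

theorem visible_mono {R R' : Set (Coord d)} (h : R ⊆ R') (ω : Sample d S) :
    E.visible Γ R ω ⊆ E.visible Γ R' ω :=
  Set.image_mono fun _ ht => ⟨⟨h ht.1.1, fun w hw => h (ht.1.2 w hw)⟩, ht.2⟩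

theorem visible_subset_coxPoints (R : Set (Coord d)) (ω : Sample d S) :
    E.visible Γ R ω ⊆ E.coxPoints Γ ω := by
  rw [coxPoints_eq]
  exact Set.image_mono fun _ ht => ht.2.2

theorem measurableSet_connects_visible (R : Set (Coord d)) (A B : Set (Space d)) :
    MeasurableSet {ω : Sample d S | Connects (E.visible Γ R ω) A B} := by
  refine measurableSet_connects (E.measurable_indexedPoint Γ) (fun t => ?_) A B
  exact (MeasurableSet.const _).inter ((measurableSet_lt measurable_const
    ((E.measurable_U t.1).comp measurable_snd)).inter (E.measurableSet_presentPoints t))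

variable {E} in
/-- By 1-dependence, `𝒰_x` and, if it is positive, `𝒬_x` depend on `Y` near `x` only. -/
theorem OneDependent.congr (h : E.OneDependent) (hN : 0 < N) {k : Lattice d}
    {y y' : Lattice d → S} (hy : ∀ w ∈ coarseNeighbors (coarseSite N k), y w = y' w) :
    E.U k y = E.U k y' ∧ (0 < E.U k y → E.Q k y = E.Q k y') := by
  have hpart := h (coarseSite N k) k (mem_fineSites_coarseSite hN k) y y' hy
  have := E.isMarkov_Q k
  -- The total mass of the part recovers `𝒰_x`. Dividing by it recovers `𝒬_x`, which is possible
  -- only where it is positive; this is why visible points carry the condition `0 < 𝒰_x`.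
  have hU : E.U k y = E.U k y' := by
    have := congrArg (fun m : Measure (Space d) => m Set.univ) hpart
    simpa [part] using this
  refine ⟨hU, fun hpos => ?_⟩
  rw [part, part, ← hU] at hpart
  ext s _
  have := congrArg (fun m : Measure (Space d) => m s) hpart
  simp only [Measure.smul_apply, ENNReal.smul_def, smul_eq_mul] at this
  exact (ENNReal.mul_right_inj (by exact_mod_cast hpos.ne') ENNReal.coe_ne_top).1 this

variable {E} in
-- The one-sided condition on the counts serves three purposes: locality of visible points,
-- monotonicity under adding points, and emptied strips. Nothing is required near a strip that is
-- empty in `ω`, so `Y` may change there.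
theorem OneDependent.visible_subset (h : E.OneDependent) (hN : 0 < N) {R : Set (Coord d)}
    {ω ω' : Sample d S} (hV : ∀ k j, Sum.inl (k, j) ∈ R → (∀ w ∈ coarseNeighbors (coarseSite N k),
      Sum.inr w ∈ R) → (∀ i < (ω.1 k j).1, i < (ω'.1 k j).1 ∧ (ω.1 k j).2 = (ω'.1 k j).2 ∧
        ∀ w ∈ coarseNeighbors (coarseSite N k), ω.2 w = ω'.2 w)) :
    E.visible Γ R ω ⊆ E.visible Γ R ω' := by
  rintro _ ⟨⟨k, j, i⟩, ⟨⟨hkj, hw⟩, hU, hi, hh⟩, rfl⟩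
  obtain ⟨hi', hpos, hy⟩ := hV k j hkj hw i hi
  obtain ⟨hUeq, hQ⟩ := h.congr hN hy
  refine ⟨(k, j, i), ⟨⟨hkj, hw⟩, ?_, hi', ?_⟩, ?_⟩
  · exact hUeq ▸ hU
  · simpa [height, ← hUeq, ← hpos] using hh
  · simp only [indexedPoint, ← hpos]
    exact (E.position_congr Γ (hQ hU) _).symm

end Environment

/-! ### Revealment -/

section Sums

/-- The indices `s > m` give distinct distances in `[1, n]`. The indices `s ≤ m` give, after
truncating `m` at `n`, distinct values in `[0, n - 1]`; the extra term `f 0 = f 1` costs one more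
copy of the sum, for a total factor of three. -/
theorem sum_antitone_dist_le {f : ℕ → ℝ} (hf : Antitone f) (h0 : ∀ k, 0 ≤ f k) (h01 : f 0 = f 1)
    {n : ℕ} (hn : 1 ≤ n) (m : ℕ) :
    ∑ s ∈ Finset.Icc 1 n, f (Nat.dist s m) ≤ 3 * ∑ s ∈ Finset.Icc 1 n, f s := by
  have hsplit : ∀ s, f (Nat.dist s m) ≤
      (if m < s then f (s - m) else 0) + (if m < s then 0 else f (min m n - s)) := by
    intro s
    by_cases h : m < s
    · simp only [h, if_true, add_zero, Nat.dist]
      exact hf (by omega)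
    · simp only [h, if_false, zero_add, Nat.dist]
      exact hf (by omega)
  have h1 : ∑ s ∈ Finset.Icc 1 n, (if m < s then f (s - m) else 0) ≤
      ∑ s ∈ Finset.Icc 1 n, f s := by
    rw [← Finset.sum_filter,
      ← Finset.sum_image (s := (Finset.Icc 1 n).filter (m < ·)) (g := fun s => s - m) (f := f)]
    · refine Finset.sum_le_sum_of_subset_of_nonneg ?_ fun k _ _ => h0 k
      intro k hk
      simp only [Finset.mem_image, Finset.mem_filter, Finset.mem_Icc] at hk ⊢
      omega
    · intro a ha b hb hab
      simp only [Finset.coe_filter, Finset.mem_Icc, Set.mem_ofPred_eq] at ha hb hab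
      omega
  have h2 : ∑ s ∈ Finset.Icc 1 n, (if m < s then 0 else f (min m n - s)) ≤
      ∑ s ∈ Finset.range n, f s := by
    have : ∀ s, (if m < s then 0 else f (min m n - s)) =
        if ¬ m < s then f (min m n - s) else 0 := fun s => by split_ifs <;> rfl
    simp only [this]
    rw [← Finset.sum_filter, ← Finset.sum_image
      (s := (Finset.Icc 1 n).filter (¬ m < ·)) (g := fun s => min m n - s) (f := f)]
    · refine Finset.sum_le_sum_of_subset_of_nonneg ?_ fun k _ _ => h0 k
      intro k hk
      simp only [Finset.mem_image, Finset.mem_filter, Finset.mem_Icc, Finset.mem_range] at hk ⊢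
      omega
    · intro a ha b hb hab
      simp only [Finset.coe_filter, Finset.mem_Icc, Set.mem_ofPred_eq] at ha hb hab
      omega
  have h3 : ∑ s ∈ Finset.range n, f s ≤ 2 * ∑ s ∈ Finset.Icc 1 n, f s := by
    have hle : f 1 ≤ ∑ s ∈ Finset.Icc 1 n, f s :=
      Finset.single_le_sum (fun k _ => h0 k) (by simpa using hn)
    have hsub : ∑ s ∈ (Finset.range n).erase 0, f s ≤ ∑ s ∈ Finset.Icc 1 n, f s := by
      refine Finset.sum_le_sum_of_subset_of_nonneg ?_ fun k _ _ => h0 k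
      intro k hk
      simp only [Finset.mem_erase, Finset.mem_range, Finset.mem_Icc] at hk ⊢
      omega
    rw [← Finset.add_sum_erase _ _ (Finset.mem_range.2 hn), h01]
    linarith
  calc _ ≤ ∑ s ∈ Finset.Icc 1 n, ((if m < s then f (s - m) else 0) +
        (if m < s then 0 else f (min m n - s))) := Finset.sum_le_sum fun s _ => hsplit s
    _ ≤ _ := by rw [Finset.sum_add_distrib]; linarith

end Sums

/-! ### Coarse sites relative to the annuli -/

section Location

variable {d : ℕ}

/-- The norm `|z|_∞` of a coarse site. -/
def siteNorm (z : Lattice d) : ℕ := Finset.univ.sup fun i => (z i).natAbs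

theorem supNorm_coarsePoint {M : ℝ} (hM : 1 ≤ M) (z : Lattice d) :
    supNorm (coarsePoint M z) = M * siteNorm z := by
  have habs : ∀ i, |(coarsePoint M z) i| = M * ((z i).natAbs : ℝ) := by
    intro i
    rw [coarsePoint, PiLp.toLp_apply, abs_mul, abs_of_nonneg (by linarith : 0 ≤ M), Nat.cast_natAbs]
    simp
  apply le_antisymm
  · rw [supNorm, pi_norm_le_iff_of_nonneg (by positivity)]
    intro i
    rw [Real.norm_eq_abs, habs i]
    have : (z i).natAbs ≤ siteNorm z :=
      Finset.le_sup (f := fun i => (z i).natAbs) (Finset.mem_univ i)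
    gcongr
  · by_cases hne : (Finset.univ : Finset (Fin d)).Nonempty
    · obtain ⟨i, -, hi⟩ := Finset.exists_mem_eq_sup _ hne fun i => (z i).natAbs
      rw [siteNorm, hi, ← habs i]
      exact abs_apply_le_supNorm _ i
    · rw [Finset.not_nonempty_iff_eq_empty] at hne
      rw [siteNorm, hne]
      simp [supNorm]

theorem mem_siteBox_iff {M : ℝ} {z : Lattice d} {p : Space d} :
    p ∈ siteBox M z ↔ ∀ i, |p i - M * z i| ≤ 3 * M := Iff.rfl

theorem dist_le_of_mem_siteBox_inter_annulus {M : ℝ} (hM : 1 ≤ M) {z : Lattice d} {s : ℕ}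
    (hs : 2 ≤ s) (h : (siteBox M z ∩ annulus d M (M * s)).Nonempty) :
    Nat.dist s (siteNorm z) ≤ 4 := by
  obtain ⟨p, hp, hps⟩ := h
  have h1 : supNorm (p - coarsePoint M z) ≤ 3 * M := (mem_box_iff (by linarith)).1 hp
  rw [mem_annulus_iff hM hs] at hps
  have h2 := supNorm_sub_le p (coarsePoint M z)
  have h3 := supNorm_sub_le (coarsePoint M z) p
  rw [supNorm_sub_comm] at h3
  rw [supNorm_coarsePoint hM] at h2 h3
  have h4 : (s : ℝ) - 2 < siteNorm z + 3 := by
    by_contra hcon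
    push Not at hcon
    nlinarith
  have h5 : (siteNorm z : ℝ) ≤ s + 2 := by
    by_contra hcon
    push Not at hcon
    nlinarith
  have h4' : s < siteNorm z + 5 := by
    have : (s : ℝ) < siteNorm z + 5 := by linarith
    exact_mod_cast this
  have h5' : siteNorm z ≤ s + 2 := by exact_mod_cast h5
  unfold Nat.dist
  omega

theorem lt_supNorm_sub_of_mem_annulus {M : ℝ} (hM : 1 ≤ M) {z : Lattice d} {s : ℕ} (hs : 2 ≤ s)
    {p : Space d} (hp : p ∈ annulus d M (M * s)) :
    M * ((Nat.dist s (siteNorm z) : ℕ) - 2 : ℝ) < supNorm (p - coarsePoint M z) := by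
  rw [mem_annulus_iff hM hs] at hp
  have h2 := supNorm_sub_le p (coarsePoint M z)
  have h3 := supNorm_sub_le (coarsePoint M z) p
  rw [supNorm_sub_comm] at h3
  rw [supNorm_coarsePoint hM] at h2 h3
  rcases le_total s (siteNorm z) with h | h
  · have : ((Nat.dist s (siteNorm z) : ℕ) : ℝ) = siteNorm z - s := by
      rw [Nat.dist_eq_sub_of_le h, Nat.cast_sub h]
    rw [this]
    nlinarith
  · have : ((Nat.dist s (siteNorm z) : ℕ) : ℝ) = s - siteNorm z := by
      rw [Nat.dist_comm, Nat.dist_eq_sub_of_le h, Nat.cast_sub h]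
    rw [this]
    nlinarith

end Location

theorem Connects.of_translate {d : ℕ} {X A B : Set (Space d)} {c : Space d}
    (h : Connects ((fun p => p + c) '' X) A B) :
    Connects X ((fun p => p + c) ⁻¹' A) ((fun p => p + c) ⁻¹' B) := by
  obtain ⟨a, ha, b, hb, γ, hγ⟩ := h
  refine ⟨a - c, by simpa using ha, b - c, by simpa using hb,
    γ.map (f := fun p => p - c) (by fun_prop), fun t => ?_⟩
  obtain ⟨_, ⟨x, hx, rfl⟩, hxt⟩ := mem_ballUnion.1 (hγ t)
  refine mem_ballUnion.2 ⟨x, hx, ?_⟩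
  rw [Metric.mem_ball, dist_eq_norm] at hxt ⊢
  convert hxt using 2
  simp only [Path.map_coe, Function.comp_apply]
  abel

/-! ### Revealment of the annulus clusters -/

namespace Environment

variable {d N : ℕ} {M : ℝ} {S : Type*} [MeasurableSpace S] (E : Environment d N M S)
  (Γ : cell d N M ≃ᵐ unitInterval)

theorem position_apply_bounds (hM : 1 ≤ M) (hN : 0 < N) (k : Lattice d) (y : Lattice d → S)
    (v : unitInterval) (i : Fin d) :
    M * coarseSite N k i ≤ E.position Γ k y v i ∧
      E.position Γ k y v i ≤ M * (coarseSite N k i + 1) := by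
  have hNR : (0 : ℝ) < N := by exact_mod_cast hN
  have h : 0 ≤ E.position Γ k y v i - M * (1 / (N : ℝ) * k i) ∧
      E.position Γ k y v i - M * (1 / (N : ℝ) * k i) ≤ M * (1 / (N : ℝ)) :=
    E.position_sub_mem Γ k y v i
  have h1 : (N : ℝ) * coarseSite N k i ≤ k i := by exact_mod_cast mul_coarseSite_le hN k i
  have h2 : (k i : ℝ) + 1 ≤ N * (coarseSite N k i + 1) := by
    exact_mod_cast lt_mul_coarseSite_add_one hN k i
  have h3 : (coarseSite N k i : ℝ) ≤ 1 / N * k i := by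
    rw [one_div, ← div_eq_inv_mul, le_div_iff₀ hNR]
    linarith
  have h4 : 1 / (N : ℝ) * k i + 1 / N ≤ coarseSite N k i + 1 := by
    rw [one_div, ← mul_add_one, ← div_eq_inv_mul, div_le_iff₀ hNR]
    linarith
  constructor <;> nlinarith

/-- The point lies within `2M` of `M w` in each coordinate, and `1/2 ≤ M`; so side parameter `3M`
suffices. Thus a ball that touches an explored cluster makes all coordinates computing its centre
eligible. -/
theorem ball_subset_siteBox (hM : 1 ≤ M) (hN : 0 < N) (ω : Sample d S)
    (t : Lattice d × ℕ × ℕ) {w : Lattice d} (hw : w ∈ coarseNeighbors (coarseSite N t.1)) :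
    Metric.ball (E.indexedPoint Γ ω t) (1 / 2) ⊆ siteBox M w := by
  intro q hq
  rw [mem_siteBox_iff]
  intro i
  have h1 := E.position_apply_bounds Γ hM hN t.1 ω.2 ((ω.1 t.1 t.2.1).2 t.2.2).1 i
  have h2 : |q i - E.indexedPoint Γ ω t i| < 1 / 2 := (abs_sub_apply_le_dist _ _ i).trans_lt hq
  have h3 : |(w i : ℝ) - coarseSite N t.1 i| ≤ 1 := by exact_mod_cast hw i
  rw [abs_lt] at h2
  rw [abs_le] at h3 ⊢
  change M * _ ≤ E.indexedPoint Γ ω t i ∧ E.indexedPoint Γ ω t i ≤ _ at h1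
  constructor <;> nlinarith

theorem self_mem_coarseNeighbors (z : Lattice d) : z ∈ coarseNeighbors z := fun i => by simp

variable (μ : Measure S) [IsProbabilityMeasure μ]

theorem thetaN_nonneg (n : ℕ) (lam : ℝ) : 0 ≤ E.thetaN Γ μ n lam := by
  unfold thetaN connProb
  split_ifs
  · exact zero_le_one
  · exact measureReal_nonneg

theorem thetaN_of_le {n : ℕ} (hn : n ≤ 4) (lam : ℝ) : E.thetaN Γ μ n lam = 1 := if_pos hn

theorem thetaN_le_one (n : ℕ) (lam : ℝ) : E.thetaN Γ μ n lam ≤ 1 := by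
  unfold thetaN connProb
  split_ifs
  · exact le_rfl
  · exact measureReal_le_one

theorem connects_annulus_of_le (hM : 1 ≤ M) {n m : ℕ} (hn : 5 ≤ n) (hnm : n ≤ m)
    {X : Set (Space d)} (h : Connects X (box d (3 * M)) (annulus d M (M * m))) :
    Connects X (box d (3 * M)) (annulus d M (M * n)) := by
  obtain ⟨a, ha, b, hb, hab⟩ := h
  have hnm' : (n : ℝ) ≤ m := by exact_mod_cast hnm
  obtain ⟨c, hc, hac, -⟩ := exists_joinedIn_annulus hM hn ha
    (lt_of_le_of_lt (by nlinarith) ((mem_annulus_iff hM (by omega)).1 hb).1) hab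
  exact ⟨a, ha, c, hc, hac.mono Set.inter_subset_left⟩

theorem thetaN_antitone (hM : 1 ≤ M) (lam : ℝ) : Antitone fun n => E.thetaN Γ μ n lam := by
  intro n m hnm
  by_cases hn : n ≤ 4
  · simp only [E.thetaN_of_le Γ μ hn]
    exact E.thetaN_le_one Γ μ m lam
  · simp only [thetaN, hn, if_false, show ¬ m ≤ 4 by omega]
    exact measureReal_mono fun ω hω => connects_annulus_of_le hM (by omega) hnm hω

/-- The event that the annulus `∂Λ_{Ms}` intersects the box around `z` or is connected to it. -/
def reachEvent (s : ℕ) (z : Lattice d) : Set (Sample d S) :=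
  {ω | (siteBox M z ∩ annulus d M (M * s)).Nonempty ∨
    Connects (E.coxPoints Γ ω) (siteBox M z) (annulus d M (M * s))}

/-- At distance at most 4 the bound is the convention `θ_k = 1`. Otherwise the box misses the
annulus; after the shift by `z`, the connection starts in `Λ_{3M}` and ends beyond `Λ_{M(k-2)}`,
hence crosses `∂Λ_{Mk}`. -/
theorem jointLaw_reachEvent_le (hM : 1 ≤ M) (hN : 0 < N) (lam : ℝ) {s : ℕ} (hs : 2 ≤ s)
    (z : Lattice d) :
    jointLaw d μ lam (E.reachEvent Γ s z) ≤
      ENNReal.ofReal (E.thetaN Γ μ (Nat.dist s (siteNorm z)) lam) := by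
  set k := Nat.dist s (siteNorm z) with hk
  by_cases hk4 : k ≤ 4
  · rw [E.thetaN_of_le Γ μ hk4, ENNReal.ofReal_one]
    exact prob_le_one
  have hne : ¬(siteBox M z ∩ annulus d M (M * s)).Nonempty := fun h =>
    hk4 (dist_le_of_mem_siteBox_inter_annulus hM hs h)
  have hsub : E.reachEvent Γ s z ⊆ shift N z ⁻¹'
      {ω | Connects (E.coxPoints Γ ω) (box d (3 * M)) (annulus d M (M * k))} := by
    rintro ω (h | h)
    · exact absurd h hne
    · rw [E.coxPoints_shift Γ hN z ω] at h
      obtain ⟨a, ha, b, hb, hab⟩ := h.of_translate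
      have ha' : a ∈ box d (3 * M) := by
        have : a + coarsePoint M z - coarsePoint M z ∈ box d (3 * M) := ha
        simpa using this
      have hb' : M * (k - 2 : ℝ) < supNorm b := by
        simpa using lt_supNorm_sub_of_mem_annulus hM (z := z) hs hb
      obtain ⟨c, hc, hac, -⟩ := exists_joinedIn_annulus hM (by omega) ha' hb' hab
      exact ⟨a, ha', c, hc, hac.mono Set.inter_subset_left⟩
  refine (measure_mono hsub).trans ?_
  rw [(measurePreserving_shift μ N z lam).measure_preimage
    (E.measurableSet_connects_coxPoints Γ _ _).nullMeasurableSet, thetaN, if_neg hk4, connProb,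
    ofReal_measureReal]

/-- If all coordinates that are eligible in the exploration of the clusters of `∂Λ_{Ms}` have been
revealed, then every connection of `Λ_{3M}` and `∂Λ_{Mn}` is visible. -/
theorem connects_visible_of_closed (hM : 1 ≤ M) (hN : 0 < N) {s n : ℕ} (hs : 5 ≤ s) (hsn : s ≤ n)
    {R F : Set (Coord d)} {ω : Sample d S}
    (hclosed : ∀ i ∈ F, ((siteBox M (i.elim (fun a => coarseSite N a.1) id) ∩
        annulus d M (M * s)).Nonempty ∨ Connects (E.visible Γ R ω)
        (siteBox M (i.elim (fun a => coarseSite N a.1) id)) (annulus d M (M * s))) → i ∈ R)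
    (h : Connects (E.visible Γ F ω) (box d (3 * M)) (annulus d M (M * n))) :
    Connects (E.visible Γ R ω) (box d (3 * M)) (annulus d M (M * n)) := by
  obtain ⟨a, ha, b, hb, hab⟩ := h
  have hsn' : (s : ℝ) ≤ n := by exact_mod_cast hsn
  -- The crossing meets `∂Λ_{Ms}` at `c`. The visible cluster of `c` absorbs every ball it touches,
  -- since all coordinates of such a ball are eligible and hence revealed; so both halves of the
  -- crossing lie in it.
  obtain ⟨c, hc, hac, hcb⟩ := exists_joinedIn_annulus hM hs ha
    (lt_of_le_of_lt (by nlinarith) ((mem_annulus_iff hM (by omega)).1 hb).1) hab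
  have hvis : ∀ t ∈ E.visiblePoints F ω, (∀ w ∈ coarseNeighbors (coarseSite N t.1),
      (siteBox M w ∩ annulus d M (M * s)).Nonempty ∨
        Connects (E.visible Γ R ω) (siteBox M w) (annulus d M (M * s))) →
      E.indexedPoint Γ ω t ∈ E.visible Γ R ω := by
    rintro t ⟨⟨ht1, ht2⟩, ht3⟩ hw
    exact ⟨t, ⟨⟨hclosed _ ht1 (hw _ (self_mem_coarseNeighbors _)),
      fun w hwn => hclosed _ (ht2 w hwn) (hw w hwn)⟩, ht3⟩, rfl⟩
  have hcU : c ∈ ballUnion (E.visible Γ R ω) := by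
    obtain ⟨_, ⟨t, ht, rfl⟩, hct⟩ := mem_ballUnion.1 hcb.source_mem
    exact mem_ballUnion.2 ⟨_, hvis t ht fun w hw =>
      Or.inl ⟨c, E.ball_subset_siteBox Γ hM hN ω t hw hct, hc⟩, hct⟩
  have habs : ∀ x ∈ E.visible Γ F ω,
      (Metric.ball x (1 / 2) ∩ pathComponentIn (ballUnion (E.visible Γ R ω)) c).Nonempty →
      Metric.ball x (1 / 2) ⊆ pathComponentIn (ballUnion (E.visible Γ R ω)) c := by
    rintro _ ⟨t, ht, rfl⟩ ⟨q, hqx, hqc⟩ q' hq'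
    have hqc : JoinedIn (ballUnion (E.visible Γ R ω)) c q := hqc
    have hx := hvis t ht fun w hw =>
      Or.inr ⟨q, E.ball_subset_siteBox Γ hM hN ω t hw hqx, c, hc, hqc.symm⟩
    exact hqc.trans (joinedIn_ballUnion_of_mem hx hqx hq')
  have hreach : ∀ {e}, JoinedIn (ballUnion (E.visible Γ F ω)) c e →
      JoinedIn (ballUnion (E.visible Γ R ω)) c e := by
    intro e he
    obtain ⟨u, huU, hu, hcu, heu⟩ := joinedIn_exists_preconnected he
    exact subset_of_balls_absorbed hu huU ((isOpen_ballUnion _).pathComponentIn c)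
      ⟨c, hcu, JoinedIn.refl hcU⟩ habs heu
  exact ⟨a, ha, b, hb, (hreach (hac.mono Set.inter_subset_left).symm).symm.trans (hreach hcb)⟩

end Environment

/-! ### The differential inequality -/

section Window

/-- The strips that are relevant for the connection of `Λ_{3M}` and `∂Λ_{Mn}`, where `L` bounds the
number of strips per fine site. -/
def stripWindow (d N n L : ℕ) : Finset (Strip d) :=
  (Fintype.piFinset fun _ => Finset.Icc (-(N * (n + 1) : ℤ)) (N * (n + 2))) ×ˢ Finset.range L

/-- The relevant coarse sites. -/
def siteWindow (d n : ℕ) : Finset (Lattice d) :=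
  Fintype.piFinset fun _ => Finset.Icc (-(n + 3 : ℤ)) (n + 3)

/-- The relevant coordinates. -/
def window (d N n L : ℕ) : Finset (Coord d) := (stripWindow d N n L).disjSum (siteWindow d n)

variable {d : ℕ}

theorem inl_mem_window {N n L : ℕ} {a : Strip d} :
    (Sum.inl a : Coord d) ∈ window d N n L ↔ a ∈ stripWindow d N n L := Finset.inl_mem_disjSum

theorem coarseNeighbors_mem_window {N n L : ℕ} (hN : 0 < N) {a : Strip d}
    (ha : a ∈ stripWindow d N n L) {w : Lattice d}
    (hw : w ∈ coarseNeighbors (coarseSite N a.1)) : (Sum.inr w : Coord d) ∈ window d N n L := by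
  have hN' : (0 : ℤ) < N := by exact_mod_cast hN
  rw [window, Finset.inr_mem_disjSum, siteWindow, Fintype.mem_piFinset]
  intro i
  rw [stripWindow, Finset.mem_product, Fintype.mem_piFinset] at ha
  have h1 := Finset.mem_Icc.1 (ha.1 i)
  have h2 := mul_coarseSite_le hN a.1 i
  have h3 := lt_mul_coarseSite_add_one hN a.1 i
  have h4 := abs_le.1 (hw i)
  have h5 : coarseSite N a.1 i ≤ n + 2 := by
    by_contra hcon
    push Not at hcon
    nlinarith
  have h6 : -(n + 2 : ℤ) ≤ coarseSite N a.1 i := by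
    by_contra hcon
    push Not at hcon
    nlinarith
  rw [Finset.mem_Icc]
  omega

open Classical in
/-- The strips whose points may change when the coordinate `i` is resampled. -/
def affected (N n L : ℕ) : Coord d → Finset (Strip d)
  | Sum.inl a => {a}
  | Sum.inr z => (stripWindow d N n L).filter fun a => z ∈ coarseNeighbors (coarseSite N a.1)

open Classical in
theorem card_affected_inr_le {N : ℕ} (hN : 0 < N) (n L : ℕ) (z : Lattice d) :
    (affected N n L (Sum.inr z)).card ≤ (3 * N + 1) ^ d * L := by
  have hsub : affected N n L (Sum.inr z) ⊆
      (Fintype.piFinset fun i => Finset.Icc ((N : ℤ) * (z i - 1)) (N * (z i + 2))) ×ˢ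
        Finset.range L := by
    intro a ha
    obtain ⟨ha, hz⟩ := Finset.mem_filter.1 ha
    rw [stripWindow, Finset.mem_product] at ha
    rw [Finset.mem_product, Fintype.mem_piFinset]
    refine ⟨fun i => ?_, ha.2⟩
    have h2 := mul_coarseSite_le hN a.1 i
    have h3 := lt_mul_coarseSite_add_one hN a.1 i
    have h4 := abs_le.1 (hz i)
    rw [Finset.mem_Icc]
    constructor <;> nlinarith
  refine (Finset.card_le_card hsub).trans (le_of_eq ?_)
  rw [Finset.card_product, Fintype.card_piFinset, Finset.card_range]
  have : ∀ i, (Finset.Icc ((N : ℤ) * (z i - 1)) (N * (z i + 2))).card = 3 * N + 1 := by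
    intro i
    rw [Int.card_Icc]
    have : (N : ℤ) * (z i + 2) + 1 - N * (z i - 1) = ((3 * N + 1 : ℕ) : ℤ) := by push_cast; ring
    rw [this, Int.toNat_natCast]
  simp [this]

open Classical in
theorem card_filter_coarseNeighbors_le (s : Finset (Lattice d)) (z : Lattice d) :
    (s.filter fun w => w ∈ coarseNeighbors z).card ≤ 3 ^ d := by
  have hsub : (s.filter fun w => w ∈ coarseNeighbors z) ⊆
      Fintype.piFinset fun i => Finset.Icc (z i - 1) (z i + 1) := by
    intro w hw
    rw [Fintype.mem_piFinset]
    intro i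
    have h4 := abs_le.1 ((Finset.mem_filter.1 hw).2 i)
    rw [Finset.mem_Icc]
    omega
  refine (Finset.card_le_card hsub).trans (le_of_eq ?_)
  rw [Fintype.card_piFinset]
  have : ∀ i, (Finset.Icc (z i - 1) (z i + 1)).card = 3 := by
    intro i
    rw [Int.card_Icc]
    omega
  simp [this]

end Window

/-! ### The crossing event, its influences and its derivative -/

namespace Environment

variable {d N : ℕ} {M : ℝ} {S : Type*} [MeasurableSpace S] (E : Environment d N M S)
  (Γ : cell d N M ≃ᵐ unitInterval)

/-- The event that `Λ_{3M}` and `∂Λ_{Mn}` are connected by the points that can be computed from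
the coordinates in `F`. -/
def crossing (F : Set (Coord d)) (n : ℕ) : Set (Sample d S) :=
  {ω | Connects (E.visible Γ F ω) (box d (3 * M)) (annulus d M (M * n))}

theorem measurableSet_crossing (F : Set (Coord d)) (n : ℕ) :
    MeasurableSet (E.crossing Γ F n) := E.measurableSet_connects_visible Γ F _ _

variable {E}

theorem increasing_crossing (h : E.OneDependent) (hN : 0 < N) (F : Set (Coord d)) (n : ℕ) :
    Increasing (E.crossing Γ F n) := fun _ _ hκ _ hm =>
  Connects.mono hm (h.visible_subset Γ hN fun k j _ _ _ hi =>
    ⟨lt_of_lt_of_le hi (hκ (k, j)), rfl, fun _ _ => rfl⟩) subset_rfl subset_rfl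

theorem countsIn_crossing (h : E.OneDependent) (hN : 0 < N) (n L : ℕ) :
    CountsIn (stripWindow d N n L) (E.crossing Γ (window d N n L) n) := fun κ κ' hκ m hm =>
  Connects.mono hm (h.visible_subset Γ hN fun k j hkj _ i hi => by
    refine ⟨lt_of_lt_of_eq hi (hκ (k, j) ?_), rfl, fun _ _ => rfl⟩
    exact inl_mem_window.1 hkj) subset_rfl subset_rfl

variable (μ : Measure S) [IsProbabilityMeasure μ]

open Classical in
-- A visible point outside the affected strips depends on nothing that is resampled, so the points
-- that remain after emptying are still there after resampling.
theorem mix_mem_crossing (h : E.OneDependent) (hN : 0 < N) (lam : ℝ) (n L : ℕ)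
    (i : Coord d) (ω ω' : Sample d S)
    (hempty : emptyStrips (affected N n L i) ω ∈ E.crossing Γ (window d N n L) n) :
    (sampleResampling μ d lam).mix {i} ω ω' ∈ E.crossing Γ (window d N n L) n := by
  refine Connects.mono hempty (h.visible_subset Γ hN fun k j hkj hw l hl => ?_) subset_rfl
    subset_rfl
  have hkj' : (k, j) ∉ affected N n L i := by
    intro hmem
    simp [emptyStrips, hmem] at hl
  have hl' : l < (ω.1 k j).1 := by simpa [emptyStrips, hkj'] using hl
  rcases i with a | z
  · have hne : (k, j) ≠ a := by simpa [affected] using hkj'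
    simp [sampleResampling, emptyStrips, hne, hl']
  · have hz : z ∉ coarseNeighbors (coarseSite N k) := fun hz =>
      hkj' (Finset.mem_filter.2 ⟨inl_mem_window.1 hkj, hz⟩)
    have hwz : ∀ w ∈ coarseNeighbors (coarseSite N k), w ≠ z := by
      rintro w hw rfl
      exact hz hw
    refine ⟨by simpa [sampleResampling] using hl', by simp [sampleResampling, emptyStrips],
      fun w hw => ?_⟩
    simp [sampleResampling, emptyStrips, hwz w hw]

theorem influence_crossing_le (h : E.OneDependent) (hN : 0 < N) (lam : ℝ) (n L : ℕ)
    (i : Coord d) :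
    (sampleResampling μ d lam).influence (E.crossing Γ (window d N n L) n) i ≤
      2 * jointLaw d μ lam {ω | ω ∈ E.crossing Γ (window d N n L) n ∧
        emptyStrips (affected N n L i) ω ∉ E.crossing Γ (window d N n L) n} := by
  have hA := E.measurableSet_crossing Γ (window d N n L) n
  have hmix := mix_mem_crossing Γ μ h hN lam n L i
  generalize E.crossing Γ (window d N n L) n = A at hA hmix ⊢
  exact (sampleResampling μ d lam).influence_le_two_mul_of_forall hA
    (measurableSet_and_emptyStrips hA _) i fun ω ω' hω hω' =>
      ⟨hω, fun hempty => hω' (hmix ω ω' hempty)⟩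

/-- A strip is affected by itself and by at most `3 ^ d` coarse sites, whence `1 + 3 ^ d`. The
exponent `B + 2` covers, for coordinates of both kinds, the number of affected strips plus one. -/
theorem sum_influence_le (h : E.OneDependent) (hN : 0 < N) {lam : ℝ} (hlam : 0 ≤ lam)
    (n L : ℕ) :
    ∑ i ∈ window d N n L,
        (sampleResampling μ d lam).influence (E.crossing Γ (window d N n L) n) i ≤
      ENNReal.ofReal (2 * Real.exp lam ^ ((3 * N + 1) ^ d * L + 2) * (1 + 3 ^ d)) *
        ∑ a ∈ stripWindow d N n L,
          ENNReal.ofReal (pivotal μ (E.crossing Γ (window d N n L) n) lam a) := by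
  classical
  set A := E.crossing Γ (window d N n L) n
  set B := (3 * N + 1) ^ d * L
  have hA : MeasurableSet A := E.measurableSet_crossing Γ _ _
  have hinc : Increasing A := increasing_crossing Γ h hN _ _
  set D : Strip d → ℝ≥0∞ := fun a => ENNReal.ofReal (pivotal μ A lam a)
  set e : ℝ≥0∞ := ENNReal.ofReal (Real.exp lam)
  have he : 1 ≤ e := by
    rw [ENNReal.one_le_ofReal]
    exact Real.one_le_exp hlam
  have hinf : ∀ i, (affected N n L i).card ≤ B + 1 →
      (sampleResampling μ d lam).influence A i ≤
        2 * e ^ (B + 2) * ∑ a ∈ affected N n L i, D a := by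
    intro i hi
    refine (influence_crossing_le Γ μ h hN lam n L i).trans ?_
    rw [mul_assoc]
    refine mul_le_mul_right ((measure_emptyStrips_le μ hA hinc hlam _).trans ?_) _
    exact mul_le_mul_left (pow_le_pow_right₀ he (by omega)) _
  have hcomm : ∑ z ∈ siteWindow d n, ∑ a ∈ affected N n L (Sum.inr z), D a ≤
      3 ^ d * ∑ a ∈ stripWindow d N n L, D a := by
    simp only [affected, Finset.sum_filter]
    rw [Finset.sum_comm, Finset.mul_sum]
    refine Finset.sum_le_sum fun a _ => ?_
    rw [← Finset.sum_filter, Finset.sum_const, nsmul_eq_mul]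
    refine mul_le_mul_left ?_ _
    exact_mod_cast card_filter_coarseNeighbors_le (siteWindow d n) (coarseSite N a.1)
  rw [window, Finset.sum_disjSum]
  calc _ ≤ ∑ a ∈ stripWindow d N n L, 2 * e ^ (B + 2) * D a +
        ∑ z ∈ siteWindow d n, 2 * e ^ (B + 2) * ∑ a ∈ affected N n L (Sum.inr z), D a := by
        refine add_le_add (Finset.sum_le_sum fun a _ => ?_) (Finset.sum_le_sum fun z _ => ?_)
        · simpa [affected] using hinf (Sum.inl a) (by simp [affected])
        · exact hinf (Sum.inr z) ((card_affected_inr_le hN n L z).trans (Nat.le_succ _))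
    _ ≤ 2 * e ^ (B + 2) * ∑ a ∈ stripWindow d N n L, D a +
        2 * e ^ (B + 2) * (3 ^ d * ∑ a ∈ stripWindow d N n L, D a) := by
        rw [← Finset.mul_sum, ← Finset.mul_sum]
        gcongr
    _ = _ := by
        rw [ENNReal.ofReal_mul (by positivity), ENNReal.ofReal_mul (by positivity),
          ENNReal.ofReal_pow (by positivity), ENNReal.ofReal_add zero_le_one (by positivity),
          ENNReal.ofReal_pow (by positivity)]
        simp only [ENNReal.ofReal_one, ENNReal.ofReal_ofNat, e]
        ring

/-- The coarse site of a coordinate. -/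
def coordSite (N : ℕ) (i : Coord d) : Lattice d := i.elim (fun a => coarseSite N a.1) id

/-- For `s ≤ 4` a crossing need not pass through the annulus, so every coordinate is revealed and
the term `θ_s = 1` pays for it. For larger `s` the clusters of `∂Λ_{Ms}` are explored and the
distance term suffices. -/
theorem osss_crossing (h : E.OneDependent) (hM : 1 ≤ M) (hN : 0 < N) (lam : ℝ) {s n : ℕ}
    (hsn : s ≤ n) (L : ℕ) :
    jointLaw d μ lam (E.crossing Γ (window d N n L) n) *
        jointLaw d μ lam (E.crossing Γ (window d N n L) n)ᶜ ≤
      ∑ i ∈ window d N n L, ENNReal.ofReal (E.thetaN Γ μ s lam +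
          E.thetaN Γ μ (Nat.dist s (siteNorm (coordSite N i))) lam) *
        (sampleResampling μ d lam).influence (E.crossing Γ (window d N n L) n) i := by
  have hA := E.measurableSet_crossing Γ (window d N n L) n
  have hθ := fun k => E.thetaN_nonneg Γ μ k lam
  have hsubset : ∀ (R : Finset (Coord d)) (ω ω' : Sample d S),
      (∀ i ∈ R, (sampleResampling μ d lam).agree i ω ω') →
      E.visible Γ R ω ⊆ E.visible Γ R ω' := by
    intro R ω ω' hag
    refine h.visible_subset Γ hN fun k j hkj hw i hi => ?_
    have h1 : ω.1 k j = ω'.1 k j := hag _ hkj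
    exact ⟨h1 ▸ hi, by rw [h1], fun w hwn => hag _ (hw w hwn)⟩
  by_cases hs : s ≤ 4
  · refine (osss_exploration (sampleResampling μ d lam) (window d N n L) (fun _ _ => Set.univ)
      (fun _ _ => MeasurableSet.univ) (fun _ _ _ _ _ h => h) hA ?_ (fun _ => Set.univ)
      (fun _ _ _ _ _ => trivial)).trans (Finset.sum_le_sum fun i _ => mul_le_mul_left ?_ _)
    · intro R hR ω ω' hag hcl hω
      have hRF : R = window d N n L :=
        Finset.Subset.antisymm hR fun i hi => hcl i hi trivial
      subst hRF
      exact Connects.mono hω (hsubset _ ω ω' hag) subset_rfl subset_rfl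
    · rw [measure_univ, ENNReal.one_le_ofReal, E.thetaN_of_le Γ μ hs]
      linarith [hθ (Nat.dist s (siteNorm (coordSite N i)))]
  · refine (osss_exploration (sampleResampling μ d lam) (window d N n L)
      (fun R ω => {i | (siteBox M (coordSite N i) ∩ annulus d M (M * s)).Nonempty ∨
        Connects (E.visible Γ R ω) (siteBox M (coordSite N i)) (annulus d M (M * s))})
      (fun R i => ?_) (fun R i ω ω' hag hω => ?_) hA ?_
      (fun i => E.reachEvent Γ s (coordSite N i)) ?_).trans
      (Finset.sum_le_sum fun i _ => mul_le_mul_left ?_ _)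
    · exact (MeasurableSet.const _).union (E.measurableSet_connects_visible Γ R _ _)
    · exact hω.imp id fun hω => hω.mono (hsubset R ω ω' hag) subset_rfl subset_rfl
    · intro R hR ω ω' hag hcl hω
      have := E.connects_visible_of_closed Γ hM hN (by omega) hsn (R := R)
        (F := window d N n L) hcl hω
      exact this.mono ((hsubset R ω ω' hag).trans (E.visible_mono Γ (by exact_mod_cast hR) ω'))
        subset_rfl subset_rfl
    · intro R _ i ω hi
      exact hi.imp id fun hi => hi.mono (E.visible_subset_coxPoints Γ R ω) subset_rfl subset_rfl
    · refine (E.jointLaw_reachEvent_le Γ μ hM hN lam (by omega) (coordSite N i)).trans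
        (ENNReal.ofReal_le_ofReal ?_)
      linarith [hθ s]

/-- Almost surely, the connection of `Λ_{3M}` and `∂Λ_{Mn}` is decided by the window. -/
theorem connProb_eq_crossing (hM : 1 ≤ M) (hN : 0 < N) {ρ : ℝ}
    (hρ : ∀ᵐ y ∂(lawY d μ), ∀ k : Lattice d, (E.U k y : ℝ) ≤ ρ) {n : ℕ} (hn : 5 ≤ n) (lam : ℝ) :
    E.connProb Γ μ (M * n) lam =
      (jointLaw d μ lam).real (E.crossing Γ (window d N n (⌊ρ⌋₊ + 1)) n) := by
  have hn' : (5 : ℝ) ≤ n := by exact_mod_cast hn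
  have hρ' : ∀ᵐ ω ∂(jointLaw d μ lam), ∀ k : Lattice d, (E.U k ω.2 : ℝ) ≤ ρ :=
    (measurePreserving_snd (μ := Measure.infinitePi fun _ : Lattice d => poissonProcessLaw lam)
      (ν := lawY d μ)).quasiMeasurePreserving.ae hρ
  refine measureReal_congr ?_
  filter_upwards [hρ', ae_height_ne_zero μ lam] with ω hU hne
  refine propext ⟨fun hω => ?_, fun hω => ?_⟩
  · obtain ⟨a, ha, b, hb, hab⟩ := hω
    -- The connection is shortened to stay inside `Λ_{M(n-1)}`, so the balls it uses are centred at
    -- points of the spatial window; `𝒰 ≤ ρ` bounds the strip number.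
    obtain ⟨c, hc, hac, -⟩ := exists_joinedIn_annulus hM hn ha
      ((mem_annulus_iff hM (by omega)).1 hb).1 hab
    refine ⟨a, ha, c, hc, hac.mono ?_⟩
    rintro q ⟨hq, hqn⟩
    have hqn : supNorm q ≤ M * (n - 1) := hqn
    obtain ⟨x, hx, hqx⟩ := mem_ballUnion.1 hq
    rw [coxPoints_eq] at hx
    obtain ⟨⟨k, j, i⟩, ⟨hi, hh⟩, rfl⟩ := hx
    -- A point at height zero would be present even where `𝒰` vanishes, and it would not be visible.
    -- Positive heights force `𝒰 > 0` at every present point.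
    have hpos : (0 : ℝ) < ((ω.1 k j).2 i).2 :=
      lt_of_le_of_ne ((ω.1 k j).2 i).2.2.1 fun h0 => hne k j i (Subtype.ext h0.symm)
    have hh' : (j : ℝ) + (((ω.1 k j).2 i).2 : ℝ) ≤ E.U k ω.2 := hh
    have hj : j < ⌊ρ⌋₊ + 1 := by
      refine Nat.lt_succ_of_le (Nat.le_floor ?_)
      linarith [hU k]
    have hmem : (k, j) ∈ stripWindow d N n (⌊ρ⌋₊ + 1) := by
      rw [stripWindow, Finset.mem_product, Fintype.mem_piFinset]
      refine ⟨fun l => ?_, Finset.mem_range.2 hj⟩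
      have h1 := E.position_apply_bounds Γ hM hN k ω.2 ((ω.1 k j).2 i).1 l
      have h2 : |q l - E.position Γ k ω.2 ((ω.1 k j).2 i).1 l| < 1 / 2 :=
        (abs_sub_apply_le_dist _ _ l).trans_lt hqx
      have h3 := (abs_apply_le_supNorm q l).trans hqn
      rw [abs_lt] at h2
      rw [abs_le] at h3
      have h4 : (coarseSite N k l : ℝ) < n + 1 := by
        by_contra hcon
        push Not at hcon
        nlinarith
      have h5 : -(n + 2 : ℝ) < coarseSite N k l := by
        by_contra hcon
        push Not at hcon
        nlinarith
      have h4' : coarseSite N k l < n + 1 := by exact_mod_cast h4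
      have h5' : -(n + 2 : ℤ) < coarseSite N k l := by exact_mod_cast h5
      have h6 := mul_coarseSite_le hN k l
      have h7 := lt_mul_coarseSite_add_one hN k l
      have hN' : (0 : ℤ) < N := by exact_mod_cast hN
      rw [Finset.mem_Icc]
      constructor <;> nlinarith
    refine mem_ballUnion.2 ⟨_, ⟨(k, j, i), ⟨⟨?_, fun w hw => ?_⟩, ?_, hi, hh⟩, rfl⟩, hqx⟩
    · exact inl_mem_window.2 hmem
    · exact coarseNeighbors_mem_window hN hmem hw
    · have : (0 : ℝ) < E.U k ω.2 := by
        have : (0 : ℝ) ≤ j := Nat.cast_nonneg j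
        linarith
      exact_mod_cast this
  · exact Connects.mono hω (E.visible_subset_coxPoints Γ _ ω) subset_rfl subset_rfl

/-- OSSS is summed over the annuli `s = 1, …, n`. The revealments of each coordinate then add up to
at most `4 ∑ θ_s`, one copy from the `θ_s` terms and three from the distance terms, and what remains
is the sum of the influences. -/
theorem differential_inequality (h : E.OneDependent) (hM : 1 ≤ M) (hN : 0 < N) {ρ : ℝ}
    (hρ : ∀ᵐ y ∂(lawY d μ), ∀ k : Lattice d, (E.U k y : ℝ) ≤ ρ) {n : ℕ} (hn : 5 ≤ n) {lam : ℝ}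
    (hlam : 0 < lam) :
    ∃ θ' : ℝ, 0 ≤ θ' ∧ HasDerivAt (E.thetaN Γ μ n) θ' lam ∧
      n * (E.thetaN Γ μ n lam * (1 - E.thetaN Γ μ n lam)) ≤
        4 * (∑ s ∈ Finset.Icc 1 n, E.thetaN Γ μ s lam) *
          (2 * Real.exp lam ^ ((3 * N + 1) ^ d * (⌊ρ⌋₊ + 1) + 2) * (1 + 3 ^ d)) * θ' := by
  set L := ⌊ρ⌋₊ + 1
  set A := E.crossing Γ (window d N n L) n
  set K : ℝ := 2 * Real.exp lam ^ ((3 * N + 1) ^ d * L + 2) * (1 + 3 ^ d)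
  have hK : 0 ≤ K := by positivity
  have hA : MeasurableSet A := E.measurableSet_crossing Γ _ _
  have hinc : Increasing A := increasing_crossing Γ h hN _ _
  have hfun : E.thetaN Γ μ n = fun lam => (jointLaw d μ lam).real A := by
    funext lam
    rw [thetaN, if_neg (by omega), connProb_eq_crossing Γ μ hM hN hρ hn]
  have hpiv := fun a => pivotal_nonneg μ hinc lam a
  set θ' := ∑ a ∈ stripWindow d N n L, pivotal μ A lam a with hθ'
  have hθ'0 : 0 ≤ θ' := Finset.sum_nonneg fun a _ => hpiv a
  refine ⟨θ', hθ'0, ?_, ?_⟩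
  · rw [hfun]
    exact hasDerivAt_jointLaw_real μ hA (countsIn_crossing Γ h hN n L) hlam
  have hnn := fun k => E.thetaN_nonneg Γ μ k lam
  have hsum : 0 ≤ ∑ s ∈ Finset.Icc 1 n, E.thetaN Γ μ s lam := Finset.sum_nonneg fun s _ => hnn s
  have hreveal : ∀ i : Coord d, ∑ s ∈ Finset.Icc 1 n, ENNReal.ofReal (E.thetaN Γ μ s lam +
      E.thetaN Γ μ (Nat.dist s (siteNorm (coordSite N i))) lam) ≤
      ENNReal.ofReal (4 * ∑ s ∈ Finset.Icc 1 n, E.thetaN Γ μ s lam) := by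
    intro i
    rw [← ENNReal.ofReal_sum_of_nonneg fun s _ => add_nonneg (hnn _) (hnn _)]
    refine ENNReal.ofReal_le_ofReal ?_
    rw [Finset.sum_add_distrib]
    have := sum_antitone_dist_le (E.thetaN_antitone Γ μ hM lam) hnn
      (by rw [E.thetaN_of_le Γ μ (by norm_num), E.thetaN_of_le Γ μ (by norm_num)])
      (by omega : 1 ≤ n) (siteNorm (coordSite N i))
    linarith
  have key : (n : ℝ≥0∞) * (jointLaw d μ lam A * jointLaw d μ lam Aᶜ) ≤
      ENNReal.ofReal (4 * ∑ s ∈ Finset.Icc 1 n, E.thetaN Γ μ s lam) *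
        (ENNReal.ofReal K * ENNReal.ofReal θ') := by
    calc (n : ℝ≥0∞) * (jointLaw d μ lam A * jointLaw d μ lam Aᶜ)
        = ∑ s ∈ Finset.Icc 1 n, jointLaw d μ lam A * jointLaw d μ lam Aᶜ := by simp
      _ ≤ ∑ s ∈ Finset.Icc 1 n, ∑ i ∈ window d N n L, ENNReal.ofReal (E.thetaN Γ μ s lam +
          E.thetaN Γ μ (Nat.dist s (siteNorm (coordSite N i))) lam) *
          (sampleResampling μ d lam).influence A i := Finset.sum_le_sum fun s hs =>
            osss_crossing Γ μ h hM hN lam (Finset.mem_Icc.1 hs).2 L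
      _ = ∑ i ∈ window d N n L, (∑ s ∈ Finset.Icc 1 n, ENNReal.ofReal (E.thetaN Γ μ s lam +
          E.thetaN Γ μ (Nat.dist s (siteNorm (coordSite N i))) lam)) *
          (sampleResampling μ d lam).influence A i := by
            rw [Finset.sum_comm]
            simp only [Finset.sum_mul]
      _ ≤ ∑ i ∈ window d N n L,
          ENNReal.ofReal (4 * ∑ s ∈ Finset.Icc 1 n, E.thetaN Γ μ s lam) *
          (sampleResampling μ d lam).influence A i := Finset.sum_le_sum fun i _ =>
            mul_le_mul_left (hreveal i) _
      _ ≤ _ := by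
            rw [← Finset.mul_sum, hθ', ENNReal.ofReal_sum_of_nonneg fun a _ => hpiv a]
            exact mul_le_mul_right (sum_influence_le Γ μ h hN hlam.le n L) _
  rw [← ENNReal.ofReal_mul hK, ← ENNReal.ofReal_mul (by positivity)] at key
  have hreal := ENNReal.toReal_mono ENNReal.ofReal_ne_top key
  rw [ENNReal.toReal_ofReal (by positivity), ENNReal.toReal_mul, ENNReal.toReal_mul,
    ENNReal.toReal_natCast] at hreal
  have hcompl : (jointLaw d μ lam Aᶜ).toReal = 1 - (jointLaw d μ lam).real A :=
    probReal_compl_eq_one_sub hA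
  rw [hcompl] at hreal
  rw [hfun]
  calc _ ≤ _ := hreal
    _ = _ := by ring

theorem criticalIntensity_nonneg : 0 ≤ E.criticalIntensity Γ μ := by
  refine le_sInf ?_
  rintro _ ⟨lam, ⟨hlam, -⟩, rfl⟩
  exact EReal.coe_nonneg.2 hlam.le

end Environment

end CoxPercolation

end

open CoxPercolation in
theorem proposition5p1 {S : Type*} [MeasurableSpace S] (μ : Measure S) [IsProbabilityMeasure μ]
    (d N : ℕ) (M : ℝ) (hd : 1 ≤ d) (hM : 1 ≤ M) (hN : 2 * (d : ℝ) * M < (N : ℝ))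
    (Γ : cell d N M ≃ᵐ unitInterval) (E : Environment d N M S)
    (h_dep : E.OneDependent) (h_bdd : E.UniformlyBounded μ)
    (h_cov : E.Coverage μ) (h_conn : E.EssentiallyConnected μ)
    (lam' : ℝ) (hlam' : E.criticalIntensity Γ μ < (lam' : EReal)) :
    ∃ c : ℝ, 0 < c ∧ ∀ n : ℕ, 1 ≤ n → ∀ lam : ℝ,
      E.criticalIntensity Γ μ < (lam : EReal) → lam < lam' →
        DifferentiableAt ℝ (E.thetaN Γ μ n) lam ∧
        c * ((n : ℝ) / ∑ s ∈ Finset.Icc 1 n, E.thetaN Γ μ s lam) *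
            (E.thetaN Γ μ n lam * (1 - E.thetaN Γ μ n lam)) ≤
          deriv (E.thetaN Γ μ n) lam := by
  have hNpos : 0 < N := by
    have : (0 : ℝ) ≤ 2 * (d : ℝ) * M := by positivity
    exact_mod_cast this.trans_lt hN
  obtain ⟨ρ, -, hρ⟩ := h_bdd
  set q := (3 * N + 1) ^ d * (⌊ρ⌋₊ + 1) + 2
  set K : ℝ → ℝ := fun lam => 2 * Real.exp lam ^ q * (1 + 3 ^ d) with hKdef
  have hKpos : ∀ lam, 0 < K lam := fun lam => by positivity
  -- `K` increases with the intensity, so its value at `lam'` works for all smaller `lam`.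
  refine ⟨1 / (4 * K lam'), by have := hKpos lam'; positivity, fun n hn lam hcrit hlt => ?_⟩
  have hlam : 0 < lam := by
    have := (Environment.criticalIntensity_nonneg (E := E) Γ μ).trans_lt hcrit
    exact_mod_cast this
  by_cases hn4 : n ≤ 4
  -- For `n ≤ 4` both sides vanish: the derivative of a constant, and the factor `1 - θ_n = 0`.
  · have hconst : E.thetaN Γ μ n = fun _ => 1 := funext fun lam => E.thetaN_of_le Γ μ hn4 lam
    rw [hconst]
    simp
  obtain ⟨θ', hθ', hder, hineq⟩ := Environment.differential_inequality Γ μ h_dep hM hNpos hρ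
    (n := n) (by omega) hlam
  refine ⟨hder.differentiableAt, ?_⟩
  rw [hder.deriv]
  set total := ∑ s ∈ Finset.Icc 1 n, E.thetaN Γ μ s lam
  -- The convention `θ_1 = 1` keeps the denominator at least `1`.
  have hsum : 0 < total := by
    have h1 : E.thetaN Γ μ 1 lam ≤ total := Finset.single_le_sum
      (fun s _ => E.thetaN_nonneg Γ μ s lam) (Finset.mem_Icc.2 ⟨le_rfl, hn⟩)
    rw [E.thetaN_of_le Γ μ (by norm_num)] at h1
    linarith
  have hKle : K lam ≤ K lam' := by
    simp only [hKdef]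
    gcongr
  have hineq' : n * (E.thetaN Γ μ n lam * (1 - E.thetaN Γ μ n lam)) ≤ 4 * total * K lam' * θ' :=
    hineq.trans (by
      change 4 * total * K lam * θ' ≤ _
      gcongr)
  have hK' := hKpos lam'
  rw [one_div, ← mul_div_assoc, div_mul_eq_mul_div, div_le_iff₀ hsum, mul_assoc,
    inv_mul_le_iff₀ (by positivity)]
  linarith
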